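/- **Conventions.** Fix $T>0$ and $\alpha,\beta>1/3$. All increments are real functions of points of $[0,T]$. Direction $1$ is the $s$-variable (exponent $\alpha$), direction $2$ the $t$-variable (exponent $\beta$); for $a\in\{1,2\}$ let $\hat a$ be the other direction, $\gamma$ the exponent of direction $a$ and $\gamma'$ that of $\hat a$. In a quantity with index $a$, the points $p_i$ lie in direction $a$ and are written first, the points $q_i$ lie in direction $\hat a$. For a sheet $f$: $\delta_af_{p_1p_2q}=f_{p_2q}-f_{p_1q}$ and $\delta f_{s_1s_2t_1t_2}=f_{s_2t_2}-f_{s_1t_2}-f_{s_2t_1}+f_{s_1t_1}$. For a function $g$ of two points in direction $a$ (other arguments frozen) $\delta_ag_{p_1p_2p_3}=g_{p_1p_3}-g_{p_1p_2}-g_{p_2p_3}$. On functions of two points in each direction $\delta=\delta_1\delta_2$. For $h=h_{p_1p_2p_3}$, $\Lambda_ah$ is the unique function $r_{p_1p_2}$ that is Hölder of some order $>1$ in direction $a$ and satisfies $\delta_ar=h$ (other arguments frozen). $\Lambda=\Lambda_1\Lambda_2$. *Norms.* $\|g\|_{\rho,\sigma}=\sup|g_{p_1p_2q_1q_2}|/(|p_1-p_2|^\rho|q_1-q_2|^\sigma)$;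 $\|g\|_\rho=\sup|g_{p_1p_2q}|/|p_1-p_2|^\rho$; for functions of $(p_1,p_2,p_3,p_4;q_1,q_2)$, $\|g\|_{\rho_1,\rho_2;\sigma}=\sup|g|/(|p_1-p_2|^{\rho_1}|p_3-p_4|^{\rho_2}|q_1-q_2|^{\sigma})$; for functions of $(p_1,\dots,p_4;q_1,q_2,q_3)$, $\|g\|_{\rho_1,\rho_2;(z)}=\inf\sum_i\sup|h_i|/(|p_1-p_2|^{\rho_1}|p_3-p_4|^{\rho_2}|q_1-q_2|^{\sigma_i}|q_2-q_3|^{z-\sigma_i})$ over all decompositions $g=\sum_ih_i$, $0<\sigma_i<z$. Finally $\mathcal N_{\alpha,\beta}(f)=\|\delta f\|_{\alpha,\beta}+\|\delta_1f\|_\alpha+\|\delta_2f\|_\beta+\|f\|_\infty$. **Rough sheets.** A rough sheet $\mathbb X$ over $x:[0,T]^2\to\mathbb R$ consists of $x$, with $\mathcal N_{\alpha,\beta}(x)<\infty$, and of continuous functions, for $\mu,\nu\in\{x,\omega\}$ and $a\in\{1,2\}$, with finite norms as indicated: $A^\mu$ in $\|\cdot\|_{\alpha,\beta}$; $C^{\mu\nu}$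 in $\|\cdot\|_{2\alpha,2\beta}$; $B_a^{\mu}$ (written $B_a^{x\mu}=\int_a d_ax\int_{\hat a}d\mu$), $H_a,I_a,Q_a$ in $\|\cdot\|_{2\gamma,\gamma'}$; $G_a$ in $\|\cdot\|_{\gamma,\gamma'}$; $L_a$ in $\|\cdot\|_{\gamma,2\gamma'}$; $J_a,K_a,M_a,N_a$ in $\|\cdot\|_{2\gamma,2\gamma'}$; $O_a$ in $\|\cdot\|_{2\gamma,3\gamma'}$; $P_a$ (a function of $p_1,p_2,q$) in $\|\cdot\|_{2\gamma}$; $D_a^{\mu\nu}$ in $\|\cdot\|_{\gamma,\gamma;2\gamma'}$; $E_a^{\mu\nu}$ (that is $E_a^{x\mu\nu}$) in $\|\cdot\|_{2\gamma,\gamma;2\gamma'}$; $F_a^{\mu\nu}$ in $\|\cdot\|_{2\gamma,\gamma;(3\gamma')}$. Here $x$ is continuous too. These satisfy, for both $a$, all $\mu,\nu$ and all points, the following relations. ($A^\mu,C^{\mu\nu}$ and $\delta x$ with $p,q$-arguments are understood with direction $a$ first.) (1) $A^x=\delta x$; $\delta_aA^\mu=0$; $\delta_aB_a^\mu(p_1p_2p_3;q_1q_2)=\delta_ax_{p_1p_2q_1}A^\mu_{p_2p_3q_1q_2}$;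 $\delta_{\hat a}B_a^\mu(p_1p_2;q_1q_2q_3)=-D_{\hat a}^{x\mu}(q_1q_2q_2q_3;p_1p_2)$; $\delta_aC^{\mu\nu}(p_1p_2p_3;q_1q_2)=D_a^{\mu\nu}(p_1p_2p_2p_3;q_1q_2)$; $D_a^{\mu\nu}$ and $E_a^{\mu\nu}$ are additive in $(p_3,p_4)$; $\delta_{\hat a}D_a^{\mu\nu}(p_1p_2p_3p_4;q_1q_2q_3)=A^\mu_{p_1p_2q_1q_2}A^\nu_{p_3p_4q_2q_3}$; $\delta_a$ of $E_a^{\mu\nu}$ in its first pair of $p$-points is $\delta_ax_{p_1p_2q_1}D_a^{\mu\nu}(p_2p_3p_4p_5;q_1q_2)$; $\delta_{\hat a}E_a^{\mu\nu}(p_1p_2p_3p_4;q_1q_2q_3)=F_a^{\mu\nu}(p_1p_2p_3p_4;q_1q_2q_3)+B_a^\mu(p_1p_2;q_1q_2)A^\nu_{p_3p_4q_2q_3}$. (2) $\delta_aG_a=0$ and $\delta_aI_{\hat a}=0$; $\delta_aH_a=\delta_ax_{p_1p_2q_1}G_a(p_2p_3;q_1q_2)$; $\delta_aJ_a=\delta_ax_{p_1p_2q_1}I_{\hat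 a}(q_1q_2;p_2p_3)$; $I_a=B_a^x+C^{xx}$; $A^\omega=G_a-I_{\hat a}=\tfrac12\delta(x^2)-(x_{s_1t_1}A^x+B_1^x+B_2^x+C^{xx})$, where the last bracket is $\iint x\,dx$; $B_a^\omega=H_a-J_a$. (3) $\delta_aK_a=\delta x_{p_1p_2q_1q_2}\,\delta x_{p_2p_3q_1q_2}$; $\delta_aL_a=0$; $\delta_aM_a=\delta_ax_{p_1p_2q_1}L_a(p_2p_3;q_1q_2)$; $\delta_aN_a=\delta x_{p_1p_2q_1q_2}G_a(p_2p_3;q_1q_2)$; $\delta_aO_a=\delta x_{p_1p_2q_1q_2}L_a(p_2p_3;q_1q_2)$. (4) $P_a(p_1p_2;q)=\tfrac12(\delta_ax_{p_1p_2q})^2$; $\delta_aP_a=\delta_ax_{p_1p_2q}\,\delta_ax_{p_2p_3q}$; $P_a(p_1p_2;q_2)-P_a(p_1p_2;q_1)=(B_a^x+Q_a)(p_1p_2;q_1q_2)$; $\delta_aQ_a=\delta x_{p_1p_2q_1q_2}\,\delta_ax_{p_2p_3q_2}$; $\delta_{\hat a}x_{q_1q_2p_1}P_a(p_1p_2;q_2)=\delta_{\hat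 a}x_{q_1q_2p_1}Q_a(p_1p_2;q_1q_2)+H_a(p_1p_2;q_1q_2)-W_a(p_1p_2;q_1q_2)$ with $W_a=\Lambda_a[\delta_ax_{p_1p_2q_1}\delta x_{p_1p_2q_1q_2}\delta_ax_{p_2p_3q_2}+\delta_ax_{p_1p_2q_1}Q_a(p_2p_3;q_1q_2)+\delta x_{p_1p_2q_1q_2}P_a(p_2p_3;q_2)-\delta x_{p_1p_2q_1q_2}Q_a(p_2p_3;q_1q_2)]$; $\delta_{\hat a}x_{q_1q_2p_1}\,\delta_ax_{p_1p_2q_2}=(G_a-Q_a)(p_1p_2;q_1q_2)$. (For smooth $x$ the components are the corresponding iterated integrals.) Let $\|\mathbb X\|_{\mathscr H_{\alpha,\beta}}$ be $\mathcal N_{\alpha,\beta}(x)$ plus the sum of all the component norms listed above; $\mathbb X-\overline{\mathbb X}$ is the componentwise difference. **Integrals.** For sheets $y,y'$ put $y^{\sharp a}=\delta_ay-y'\delta_ax$, that is $y^{\sharp a}_{p_1p_2q}=\delta_ay_{p_1p_2q}-y'_{p_1q}\,\delta_ax_{p_1p_2q}$. In the following formulas the left factor is taken at the first points, respectively on the first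 interval in direction $a$, and at $q_1$: $$\int_ay\int_{\hat a}d\mu=yA^\mu+y'B_a^\mu+\Lambda_a\big[y^{\sharp a}A^\mu+\delta_ay'\,B_a^\mu\big],$$ $$\int_ay\int_{\hat a}d\mu\,d\nu=yC^{\mu\nu}+\Lambda_a\Big[\delta_ay\,C^{\mu\nu}+y'E_a^{\mu\nu}(p_1p_2p_2p_3;\cdot)+R(p_1p_2p_2p_3;\cdot)\Big],$$ where $R=(\Lambda_a\otimes1)\big(y^{\sharp a}D_a^{\mu\nu}+\delta_ay'\,E_a^{\mu\nu}\big)$ is obtained by applying $\Lambda_a$ in the first group of $p$-variables. For $\varphi(x)$ these are used with $y=\varphi^{(k)}(x)$, $y'=\varphi^{(k+1)}(x)$. The remainder $\varphi(x)^\sharp$ is defined by $$\delta\varphi(x)=-\varphi'(x)A^x-\varphi''(x)A^\omega+\sum_{a=1,2}\Big(\int_a\varphi'(x)\int_{\hat a}dx+\int_a\varphi''(x)\int_{\hat a}d\omega\Big)+\varphi(x)^\sharp ,$$ and for $\nu\in\{x,\omega\}$ the rough integral is $$\iint\varphi(x)\,d\nu=-\varphi(x)A^\nu+\sum_a\int_a\varphi(x)\int_{\hat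 a}d\nu+S^\nu+\Lambda\big[\delta\varphi(x)\,A^\nu-\delta S^\nu\big],$$ $$S^\nu=-\varphi'(x)C^{x\nu}-\varphi''(x)C^{\omega\nu}+\sum_a\Big(\int_a\varphi'(x)\int_{\hat a}dx\,d\nu+\int_a\varphi''(x)\int_{\hat a}d\omega\,d\nu\Big),$$ where $\delta\varphi(x)\,A^\nu$ means $\delta\varphi(x)_{s_1s_2t_1t_2}A^\nu_{s_2s_3t_2t_3}$. For $\nu=\omega$ the integral is written $\iint\varphi(x)\,d\omega(x)$, where $d\omega(x)=d_1x\,d_2x$. **Theorem.** There are a polynomial $K$, non-negative on $[0,\infty)$, and a constant $c$, both depending only on $\alpha,\beta,T$, such that for every $\varphi\in C^8(\mathbb R)$ and all rough sheets $\mathbb X$ over $x$ and $\overline{\mathbb X}$ over $\bar x$, $$\|\varphi(x)^\sharp-\varphi(\bar x)^\sharp\|_{2\alpha,2\beta}\le c\,C_1\,K\big(\|\mathbb X\|_{\mathscr H_{\alpha,\beta}}+\|\overline{\mathbb X}\|_{\mathscr H_{\alpha,\beta}}\big)\|\mathbb X-\overline{\mathbb X}\|_{\mathscr H_{\alpha,\beta}}$$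 and $$\Big\|\iint\varphi(x)\,dx-\iint\varphi(\bar x)\,d\bar x\Big\|_{\alpha,\beta}+\Big\|\iint\varphi(x)\,d\omega(x)-\iint\varphi(\bar x)\,d\omega(\bar x)\Big\|_{\alpha,\beta}\le c\,C_0\,K\big(\|\mathbb X\|_{\mathscr H_{\alpha,\beta}}+\|\overline{\mathbb X}\|_{\mathscr H_{\alpha,\beta}}\big)\|\mathbb X-\overline{\mathbb X}\|_{\mathscr H_{\alpha,\beta}},$$ where $C_j=\sum_{k=j}^{8}\sup_{|\xi|\le M}|\varphi^{(k)}(\xi)|$ and $M=\|x\|_\infty+\|\bar x\|_\infty$. -/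

import Mathlib

open scoped ENNReal NNReal

namespace RoughSheets

noncomputable section

/-! ### Increments on `[0,T]` and `[0,T]²`

All increments are real functions of points of `[0,T]`; they are defined for all (not only for
ordered) arguments. -/

/-- The parameter interval `[0,T]`. -/
abbrev Tm (T : ℝ) : Type := Set.Icc (0 : ℝ) T

/-- A sheet: a function of one point `(s, t)` of `[0,T]²`. -/
abbrev Sheet (T : ℝ) : Type := Tm T → Tm T → ℝ

/-- Functions of two points in each direction. -/
abbrev Inc22 (T : ℝ) : Type := Tm T → Tm T → Tm T → Tm T → ℝ

/-- Functions of four points in one direction and two points in the other. -/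
abbrev Inc42 (T : ℝ) : Type := Tm T → Tm T → Tm T → Tm T → Tm T → Tm T → ℝ

/-- Functions of four points in one direction and three points in the other. -/
abbrev Inc43 (T : ℝ) : Type := Tm T → Tm T → Tm T → Tm T → Tm T → Tm T → Tm T → ℝ

/-- Functions of two points in one direction and one point in the other. -/
abbrev Inc21 (T : ℝ) : Type := Tm T → Tm T → Tm T → ℝ

/-- The two directions of the plane: direction one is the `s`-variable, direction two the
`t`-variable. -/
inductive Dir : Type
  | one
  | two

/-- The other direction `â`. -/
def Dir.op : Dir → Dir
  | .one => .two
  | .two => .one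

/-- The two letters: `x` stands for `dx`, `ω` for `dω = d₁x d₂x`. -/
inductive Letter : Type
  | x
  | ω

/-- A sheet with the argument in direction `a` written first. -/
def swapS {T : ℝ} : Dir → Sheet T → Sheet T
  | .one, f => f
  | .two, f => fun p q => f q p

/-- Passage between the standard order of arguments `(s₁ s₂; t₁ t₂)` and the order in which the
arguments in direction `a` come first (an involution). -/
def swap22 {T : ℝ} : Dir → Inc22 T → Inc22 T
  | .one, g => g
  | .two, g => fun p₁ p₂ q₁ q₂ => g q₁ q₂ p₁ p₂

/-- One-dimensional coboundary on functions of two variables: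
`(δg)_{abc} = g_{ac} - g_{ab} - g_{bc}`. -/
def cob {T : ℝ} (g : Tm T → Tm T → ℝ) (a b c : Tm T) : ℝ := g a c - g a b - g b c

/-- Two-dimensional increment of a sheet,
`(δf)_{s₁s₂t₁t₂} = f_{s₂t₂} - f_{s₁t₂} - f_{s₂t₁} + f_{s₁t₁}`. -/
def rect {T : ℝ} (f : Sheet T) : Inc22 T := fun s₁ s₂ t₁ t₂ =>
  f s₂ t₂ - f s₁ t₂ - f s₂ t₁ + f s₁ t₁

/-- The coboundary `δ = δ₁δ₂` on functions of two points in each direction. -/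
def cob22 {T : ℝ} (g : Inc22 T) (s₁ s₂ s₃ t₁ t₂ t₃ : Tm T) : ℝ :=
  cob (fun a b => cob (g a b) t₁ t₂ t₃) s₁ s₂ s₃

/-- `r` is a function with `δr = h` which is Hölder of some order `μ > 1`. -/
def IsSewing {T : ℝ} (h : Tm T → Tm T → Tm T → ℝ) (r : Tm T → Tm T → ℝ) : Prop :=
  (∃ μ C : ℝ, 1 < μ ∧ ∀ a b, |r a b| ≤ C * dist a b ^ μ) ∧ ∀ a b c, cob r a b c = h a b c

open Classical in
/-- The sewing map `Λ`: `Λh` is the function `r` of Hölder order `> 1` with `δr = h` (there is at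
most one; the value is `0` by convention if there is none). In several variables `Λ` is
applied in the variables of one direction, the others being frozen. -/
def sew {T : ℝ} (h : Tm T → Tm T → Tm T → ℝ) : Tm T → Tm T → ℝ :=
  if H : ∃ r, IsSewing h r then H.choose else 0

/-! ### Hölder norms, with values in `[0,∞]`

In `[0,∞]` one has `0 / 0 = 0` and `c / 0 = ∞` for `c ≠ 0`, so a function of finite norm vanishes
where the weight vanishes. -/

/-- `‖g‖_{p,q}` for functions of two points in each direction. -/
def hol22 {T : ℝ} (p q : ℝ) (g : Inc22 T) : ℝ≥0∞ :=
  ⨆ (a) (b) (c) (d), ENNReal.ofReal |g a b c d| / ENNReal.ofReal (dist a b ^ p * dist c d ^ q)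

/-- Hölder norm of order `p` in two points of one direction, uniform in the point of the other. -/
def hol21 {T : ℝ} (p : ℝ) (g : Inc21 T) : ℝ≥0∞ :=
  ⨆ (a) (b) (c), ENNReal.ofReal |g a b c| / ENNReal.ofReal (dist a b ^ p)

/-- Norm of `(𝒞₂^{p₁} ⊗ 𝒞₂^{p₂})(𝒞₂^q)`. -/
def hol42 {T : ℝ} (p₁ p₂ q : ℝ) (g : Inc42 T) : ℝ≥0∞ :=
  ⨆ (a₁) (a₂) (a₃) (a₄) (c) (d), ENNReal.ofReal |g a₁ a₂ a₃ a₄ c d| /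
    ENNReal.ofReal (dist a₁ a₂ ^ p₁ * dist a₃ a₄ ^ p₂ * dist c d ^ q)

/-- Norm of `(𝒞₂^{p₁} ⊗ 𝒞₂^{p₂})(𝒞₃^{ρ,σ})`. -/
def hol43w {T : ℝ} (p₁ p₂ ρ σ : ℝ) (g : Inc43 T) : ℝ≥0∞ :=
  ⨆ (a₁) (a₂) (a₃) (a₄) (c) (d) (e), ENNReal.ofReal |g a₁ a₂ a₃ a₄ c d e| /
    ENNReal.ofReal (dist a₁ a₂ ^ p₁ * dist a₃ a₄ ^ p₂ * (dist c d ^ ρ * dist d e ^ σ))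

/-- Norm of `(𝒞₂^{p₁} ⊗ 𝒞₂^{p₂})(𝒞₃^z)`: the infimum of `∑ᵢ ‖hᵢ‖_{ρᵢ, z-ρᵢ}` over all
decompositions `g = ∑ᵢ hᵢ` and all exponents `0 < ρᵢ < z`. -/
def hol43 {T : ℝ} (p₁ p₂ z : ℝ) (g : Inc43 T) : ℝ≥0∞ :=
  ⨅ (h : ℕ → Inc43 T) (ρ : ℕ → Set.Ioo (0 : ℝ) z)
    (_ : ∀ a₁ a₂ a₃ a₄ c d e,
      HasSum (fun i => h i a₁ a₂ a₃ a₄ c d e) (g a₁ a₂ a₃ a₄ c d e)),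
    ∑' i, hol43w p₁ p₂ (ρ i) (z - ρ i) (h i)

/-- Supremum norm of a sheet. -/
def supNorm {T : ℝ} (f : Sheet T) : ℝ≥0∞ := ⨆ (s) (t), ENNReal.ofReal |f s t|

/-- `𝒩_{α,β}(f) = ‖δf‖_{α,β} + ‖δ₁f‖_{α,0} + ‖δ₂f‖_{0,β} + ‖f‖_∞`. -/
def sheetNorm {T : ℝ} (α β : ℝ) (f : Sheet T) : ℝ≥0∞ :=
  hol22 α β (rect f)
    + hol21 α (fun s₁ s₂ t => f s₂ t - f s₁ t)
    + hol21 β (fun t₁ t₂ s => f s t₂ - f s t₁)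
    + supNorm f

/-! ### Rough sheets -/

/-- The data of a rough sheet over `x`. In the fields that depend on a direction `a`, the
arguments in direction `a` come first; `x`, `A`, `C` have their arguments in the standard order.
The meaning for smooth `x` (with `a = 1`, and `dω = ∂ₛx ∂ₜx ds dt`) is, with `μ, ν ∈ {x, ω}`,
* `A μ = ∬ dμ`, `C μ ν = ∬∬ dμ dν`, `B 1 μ = ∬ δ₁x_{s₁ s t₁} dμ`,
* `D 1 μ ν = ∬_{s₃ t₁}^{s₄ t₂} (∬_{s₁ t₁}^{s₂ t} dμ) dν`,
* `E 1 μ ν = ∬_{s₃ t₁}^{s₄ t₂} (∬_{s₁ t₁}^{s₂ t} δ₁x_{s₁ r t₁} dμ_{r r'}) dν_{st}`,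
* `F 1 μ ν = - ∬_{s₃ t₂}^{s₄ t₃} (∬_{s₁ t₂}^{s₂ t} δx_{s₁ r t₁ t₂} dμ_{r r'}) dν_{st}`,
* `G 1 = ∫ δ₂x_{s t₁ t₂} dₛx_{s t₂}`, `H 1 = ∫ δ₁x_{s₁ s t₁} δ₂x_{s t₁ t₂} dₛx_{s t₂}`,
* `I 1 = ∬ δ₁x_{s₁ s t} dx_{st}`, `J 1 = ∬ δ₁x_{s₁ s t₁} δ₂x_{s t₁ t} dx_{st}`,
* `K 1 = ∫ δx_{s₁ s t₁ t₂} dₛδ₂x_{s t₁ t₂}`, `L 1 = ∫ δ₂x_{s t₁ t₂} dₛδ₂x_{s t₁ t₂}`,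
* `M 1 = ∫ δ₁x_{s₁ s t₁} δ₂x_{s t₁ t₂} dₛδ₂x_{s t₁ t₂}`,
* `N 1 = ∫ δx_{s₁ s t₁ t₂} δ₂x_{s t₁ t₂} dₛx_{s t₂}`,
* `O 1 = ∫ δx_{s₁ s t₁ t₂} δ₂x_{s t₁ t₂} dₛδ₂x_{s t₁ t₂}`,
* `P 1 = ∫ δ₁x_{s₁ s t} dₛx_{st}`, `Q 1 = ∫ δx_{s₁ s t₁ t₂} dₛx_{s t₂}`. -/
structure SheetData (T : ℝ) where
  x : Sheet T
  A : Letter → Inc22 T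
  C : Letter → Letter → Inc22 T
  B : Dir → Letter → Inc22 T
  D : Dir → Letter → Letter → Inc42 T
  E : Dir → Letter → Letter → Inc42 T
  F : Dir → Letter → Letter → Inc43 T
  G : Dir → Inc22 T
  H : Dir → Inc22 T
  I : Dir → Inc22 T
  J : Dir → Inc22 T
  K : Dir → Inc22 T
  L : Dir → Inc22 T
  M : Dir → Inc22 T
  N : Dir → Inc22 T
  O : Dir → Inc22 T
  P : Dir → Inc21 T
  Q : Dir → Inc22 T

namespace SheetData

variable {T : ℝ}

/-- Componentwise difference. -/
instance : Sub (SheetData T) where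
  sub X Y :=
    { x := X.x - Y.x
      A := X.A - Y.A
      C := X.C - Y.C
      B := X.B - Y.B
      D := X.D - Y.D
      E := X.E - Y.E
      F := X.F - Y.F
      G := X.G - Y.G
      H := X.H - Y.H
      I := X.I - Y.I
      J := X.J - Y.J
      K := X.K - Y.K
      L := X.L - Y.L
      M := X.M - Y.M
      N := X.N - Y.N
      O := X.O - Y.O
      P := X.P - Y.P
      Q := X.Q - Y.Q }

/-- `x` with the argument in direction `a` first. -/
def xd (X : SheetData T) (a : Dir) : Sheet T := swapS a X.x

/-- `δx` with the arguments in direction `a` first. -/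
def dxd (X : SheetData T) (a : Dir) : Inc22 T := rect (X.xd a)

/-- `A^μ` with the arguments in direction `a` first. -/
def Ad (X : SheetData T) (a : Dir) (μ : Letter) : Inc22 T := swap22 a (X.A μ)

/-- `C^{μν}` with the arguments in direction `a` first. -/
def Cd (X : SheetData T) (a : Dir) (μ ν : Letter) : Inc22 T := swap22 a (X.C μ ν)

/-- The part of the norm of a rough sheet that belongs to direction `a`; here `γ` is the exponent
in direction `a` and `γ'` the exponent in the other direction. -/
def dirNorm (γ γ' : ℝ) (X : SheetData T) (a : Dir) : ℝ≥0∞ :=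
  (hol22 (2 * γ) γ' (X.B a .x) + hol22 (2 * γ) γ' (X.B a .ω))
    + (hol42 γ γ (2 * γ') (X.D a .x .x) + hol42 γ γ (2 * γ') (X.D a .x .ω)
      + hol42 γ γ (2 * γ') (X.D a .ω .x) + hol42 γ γ (2 * γ') (X.D a .ω .ω))
    + (hol42 (2 * γ) γ (2 * γ') (X.E a .x .x) + hol42 (2 * γ) γ (2 * γ') (X.E a .x .ω)
      + hol42 (2 * γ) γ (2 * γ') (X.E a .ω .x) + hol42 (2 * γ) γ (2 * γ') (X.E a .ω .ω))
    + (hol43 (2 * γ) γ (3 * γ') (X.F a .x .x) + hol43 (2 * γ) γ (3 * γ') (X.F a .x .ω)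
      + hol43 (2 * γ) γ (3 * γ') (X.F a .ω .x) + hol43 (2 * γ) γ (3 * γ') (X.F a .ω .ω))
    + hol22 γ γ' (X.G a) + hol22 (2 * γ) γ' (X.H a)
    + hol22 (2 * γ) γ' (X.I a) + hol22 (2 * γ) (2 * γ') (X.J a)
    + hol22 (2 * γ) (2 * γ') (X.K a) + hol22 γ (2 * γ') (X.L a)
    + hol22 (2 * γ) (2 * γ') (X.M a) + hol22 (2 * γ) (2 * γ') (X.N a)
    + hol22 (2 * γ) (3 * γ') (X.O a)
    + hol21 (2 * γ) (X.P a) + hol22 (2 * γ) γ' (X.Q a)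

/-- The norm of the product of Hölder spaces `ℋ_{α,β}`. -/
def norm (α β : ℝ) (X : SheetData T) : ℝ≥0∞ :=
  sheetNorm α β X.x
    + (hol22 α β (X.A .x) + hol22 α β (X.A .ω))
    + (hol22 (2 * α) (2 * β) (X.C .x .x) + hol22 (2 * α) (2 * β) (X.C .x .ω)
      + hol22 (2 * α) (2 * β) (X.C .ω .x) + hol22 (2 * α) (2 * β) (X.C .ω .ω))
    + X.dirNorm α β .one + X.dirNorm β α .two

/-- Joint continuity of all components. -/
structure IsContinuous (X : SheetData T) : Prop where
  x : Continuous fun z : Tm T × Tm T => X.x z.1 z.2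
  A : ∀ μ, Continuous ↿(X.A μ)
  C : ∀ μ ν, Continuous ↿(X.C μ ν)
  B : ∀ a μ, Continuous ↿(X.B a μ)
  D : ∀ a μ ν, Continuous ↿(X.D a μ ν)
  E : ∀ a μ ν, Continuous ↿(X.E a μ ν)
  F : ∀ a μ ν, Continuous ↿(X.F a μ ν)
  G : ∀ a, Continuous ↿(X.G a)
  H : ∀ a, Continuous ↿(X.H a)
  I : ∀ a, Continuous ↿(X.I a)
  J : ∀ a, Continuous ↿(X.J a)
  K : ∀ a, Continuous ↿(X.K a)
  L : ∀ a, Continuous ↿(X.L a)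
  M : ∀ a, Continuous ↿(X.M a)
  N : ∀ a, Continuous ↿(X.N a)
  O : ∀ a, Continuous ↿(X.O a)
  P : ∀ a, Continuous ↿(X.P a)
  Q : ∀ a, Continuous ↿(X.Q a)

/-- First group of algebraic relations (two-dimensional Chen relations). The points `p` are in
direction `a`, the points `q` in the other direction. -/
structure ChenRelations (X : SheetData T) : Prop where
  A_x : X.A .x = rect X.x
  cob_A : ∀ a μ p₁ p₂ p₃ q₁ q₂,
    cob (fun r r' => X.Ad a μ r r' q₁ q₂) p₁ p₂ p₃ = 0
  cob_B : ∀ a μ p₁ p₂ p₃ q₁ q₂,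
    cob (fun r r' => X.B a μ r r' q₁ q₂) p₁ p₂ p₃
      = (X.xd a p₂ q₁ - X.xd a p₁ q₁) * X.Ad a μ p₂ p₃ q₁ q₂
  cob_B' : ∀ a μ p₁ p₂ q₁ q₂ q₃,
    cob (fun r r' => X.B a μ p₁ p₂ r r') q₁ q₂ q₃ = - X.D a.op .x μ q₁ q₂ q₂ q₃ p₁ p₂
  cob_C : ∀ a μ ν p₁ p₂ p₃ q₁ q₂,
    cob (fun r r' => X.Cd a μ ν r r' q₁ q₂) p₁ p₂ p₃ = X.D a μ ν p₁ p₂ p₂ p₃ q₁ q₂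
  cob_D : ∀ a μ ν p₁ p₂ p₃ p₄ p₅ q₁ q₂,
    cob (fun r r' => X.D a μ ν p₁ p₂ r r' q₁ q₂) p₃ p₄ p₅ = 0
  cob_D' : ∀ a μ ν p₁ p₂ p₃ p₄ q₁ q₂ q₃,
    cob (fun r r' => X.D a μ ν p₁ p₂ p₃ p₄ r r') q₁ q₂ q₃
      = X.Ad a μ p₁ p₂ q₁ q₂ * X.Ad a ν p₃ p₄ q₂ q₃
  cob_E_right : ∀ a μ ν p₁ p₂ p₃ p₄ p₅ q₁ q₂,
    cob (fun r r' => X.E a μ ν p₁ p₂ r r' q₁ q₂) p₃ p₄ p₅ = 0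
  cob_E_left : ∀ a μ ν p₁ p₂ p₃ p₄ p₅ q₁ q₂,
    cob (fun r r' => X.E a μ ν r r' p₄ p₅ q₁ q₂) p₁ p₂ p₃
      = (X.xd a p₂ q₁ - X.xd a p₁ q₁) * X.D a μ ν p₂ p₃ p₄ p₅ q₁ q₂
  cob_E' : ∀ a μ ν p₁ p₂ p₃ p₄ q₁ q₂ q₃,
    cob (fun r r' => X.E a μ ν p₁ p₂ p₃ p₄ r r') q₁ q₂ q₃
      = X.F a μ ν p₁ p₂ p₃ p₄ q₁ q₂ q₃ + X.B a μ p₁ p₂ q₁ q₂ * X.Ad a ν p₃ p₄ q₂ q₃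

/-- Second group of algebraic relations. In `A_ω'` the bracket is the rough integral `∬ x dx`. -/
structure SplittingRelations (X : SheetData T) : Prop where
  cob_G : ∀ (a : Dir) p₁ p₂ p₃ q₁ q₂, cob (fun r r' => X.G a r r' q₁ q₂) p₁ p₂ p₃ = 0
  cob_I : ∀ (a : Dir) p₁ p₂ p₃ q₁ q₂, cob (fun r r' => X.I a.op q₁ q₂ r r') p₁ p₂ p₃ = 0
  cob_H : ∀ (a : Dir) p₁ p₂ p₃ q₁ q₂,
    cob (fun r r' => X.H a r r' q₁ q₂) p₁ p₂ p₃
      = (X.xd a p₂ q₁ - X.xd a p₁ q₁) * X.G a p₂ p₃ q₁ q₂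
  cob_J : ∀ (a : Dir) p₁ p₂ p₃ q₁ q₂,
    cob (fun r r' => X.J a r r' q₁ q₂) p₁ p₂ p₃
      = (X.xd a p₂ q₁ - X.xd a p₁ q₁) * X.I a.op q₁ q₂ p₂ p₃
  I_eq : ∀ (a : Dir) p₁ p₂ q₁ q₂,
    X.I a p₁ p₂ q₁ q₂ = X.B a .x p₁ p₂ q₁ q₂ + X.Cd a .x .x p₁ p₂ q₁ q₂
  A_ω : ∀ (a : Dir) p₁ p₂ q₁ q₂, X.Ad a .ω p₁ p₂ q₁ q₂ = X.G a p₁ p₂ q₁ q₂ - X.I a.op q₁ q₂ p₁ p₂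
  A_ω' : ∀ s₁ s₂ t₁ t₂,
    X.A .ω s₁ s₂ t₁ t₂ = 1 / 2 * rect (fun s t => X.x s t ^ 2) s₁ s₂ t₁ t₂
      - (X.x s₁ t₁ * X.A .x s₁ s₂ t₁ t₂ + X.B .one .x s₁ s₂ t₁ t₂ + X.B .two .x t₁ t₂ s₁ s₂
        + X.C .x .x s₁ s₂ t₁ t₂)
  B_ω : ∀ (a : Dir) p₁ p₂ q₁ q₂, X.B a .ω p₁ p₂ q₁ q₂ = X.H a p₁ p₂ q₁ q₂ - X.J a p₁ p₂ q₁ q₂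

/-- Third group of algebraic relations. -/
structure InterpolationRelations (X : SheetData T) : Prop where
  cob_K : ∀ (a : Dir) p₁ p₂ p₃ q₁ q₂,
    cob (fun r r' => X.K a r r' q₁ q₂) p₁ p₂ p₃ = X.dxd a p₁ p₂ q₁ q₂ * X.dxd a p₂ p₃ q₁ q₂
  cob_L : ∀ (a : Dir) p₁ p₂ p₃ q₁ q₂, cob (fun r r' => X.L a r r' q₁ q₂) p₁ p₂ p₃ = 0
  cob_M : ∀ (a : Dir) p₁ p₂ p₃ q₁ q₂,
    cob (fun r r' => X.M a r r' q₁ q₂) p₁ p₂ p₃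
      = (X.xd a p₂ q₁ - X.xd a p₁ q₁) * X.L a p₂ p₃ q₁ q₂
  cob_N : ∀ (a : Dir) p₁ p₂ p₃ q₁ q₂,
    cob (fun r r' => X.N a r r' q₁ q₂) p₁ p₂ p₃ = X.dxd a p₁ p₂ q₁ q₂ * X.G a p₂ p₃ q₁ q₂
  cob_O : ∀ (a : Dir) p₁ p₂ p₃ q₁ q₂,
    cob (fun r r' => X.O a r r' q₁ q₂) p₁ p₂ p₃ = X.dxd a p₁ p₂ q₁ q₂ * X.L a p₂ p₃ q₁ q₂

/-- The increment `∫_a δ_a x ∘_a δx d_a x`, defined through the sewing map in direction `a`. -/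
def W (X : SheetData T) (a : Dir) : Inc22 T := fun p₁ p₂ q₁ q₂ =>
  sew (fun r₁ r₂ r₃ =>
    (X.xd a r₂ q₁ - X.xd a r₁ q₁) * X.dxd a r₁ r₂ q₁ q₂ * (X.xd a r₃ q₂ - X.xd a r₂ q₂)
      + (X.xd a r₂ q₁ - X.xd a r₁ q₁) * X.Q a r₂ r₃ q₁ q₂
      + X.dxd a r₁ r₂ q₁ q₂ * X.P a r₂ r₃ q₂
      - X.dxd a r₁ r₂ q₁ q₂ * X.Q a r₂ r₃ q₁ q₂) p₁ p₂

/-- Fourth group of algebraic relations. The relation `P_geom` is the one-dimensional chain rule: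
the one-dimensional iterated integral `P_a = ∫_a ∫_a d_a x d_a x` is the geometric one. -/
structure OneDimRelations (X : SheetData T) : Prop where
  cob_P : ∀ (a : Dir) p₁ p₂ p₃ q,
    cob (fun r r' => X.P a r r' q) p₁ p₂ p₃
      = (X.xd a p₂ q - X.xd a p₁ q) * (X.xd a p₃ q - X.xd a p₂ q)
  incr_P : ∀ (a : Dir) p₁ p₂ q₁ q₂,
    X.P a p₁ p₂ q₂ - X.P a p₁ p₂ q₁ = X.B a .x p₁ p₂ q₁ q₂ + X.Q a p₁ p₂ q₁ q₂
  cob_Q : ∀ (a : Dir) p₁ p₂ p₃ q₁ q₂,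
    cob (fun r r' => X.Q a r r' q₁ q₂) p₁ p₂ p₃
      = X.dxd a p₁ p₂ q₁ q₂ * (X.xd a p₃ q₂ - X.xd a p₂ q₂)
  mul_P : ∀ (a : Dir) p₁ p₂ q₁ q₂,
    (X.xd a p₁ q₂ - X.xd a p₁ q₁) * X.P a p₁ p₂ q₂
      = (X.xd a p₁ q₂ - X.xd a p₁ q₁) * X.Q a p₁ p₂ q₁ q₂ + X.H a p₁ p₂ q₁ q₂
        - X.W a p₁ p₂ q₁ q₂
  mul_x : ∀ (a : Dir) p₁ p₂ q₁ q₂,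
    (X.xd a p₁ q₂ - X.xd a p₁ q₁) * (X.xd a p₂ q₂ - X.xd a p₁ q₂)
      = X.G a p₁ p₂ q₁ q₂ - X.Q a p₁ p₂ q₁ q₂
  P_geom : ∀ (a : Dir) p₁ p₂ q, X.P a p₁ p₂ q = 1 / 2 * (X.xd a p₂ q - X.xd a p₁ q) ^ 2

/-- `X` is a rough sheet over `X.x` with exponents `α, β`. -/
structure IsRoughSheet (α β : ℝ) (X : SheetData T) : Prop where
  continuous : X.IsContinuous
  norm_lt_top : X.norm α β < ⊤
  chen : X.ChenRelations
  splitting : X.SplittingRelations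
  interpolation : X.InterpolationRelations
  oneDim : X.OneDimRelations

end SheetData

/-! ### Boundary integrals, controlled sheets and rough integrals -/

variable {T : ℝ}

/-- The boundary integral `∫_a y ∫_â dμ`
`= y A^μ + y' B_a^μ + Λ_a[y^{♯a} A^μ + δ_a y' B_a^μ]`, where `δ_a y = y' δ_a x + y^{♯a}`
(value in the standard order of arguments). -/
def boundary1 (X : SheetData T) (a : Dir) (μ : Letter) (y y' : Sheet T) : Inc22 T :=
  let u := swapS a y
  let u' := swapS a y'
  let uSharp : Inc21 T := fun p₁ p₂ q =>
    u p₂ q - u p₁ q - u' p₁ q * (X.xd a p₂ q - X.xd a p₁ q)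
  swap22 a fun p₁ p₂ q₁ q₂ =>
    u p₁ q₁ * X.Ad a μ p₁ p₂ q₁ q₂ + u' p₁ q₁ * X.B a μ p₁ p₂ q₁ q₂
      + sew (fun r₁ r₂ r₃ =>
          uSharp r₁ r₂ q₁ * X.Ad a μ r₂ r₃ q₁ q₂
            + (u' r₂ q₁ - u' r₁ q₁) * X.B a μ r₂ r₃ q₁ q₂) p₁ p₂

/-- The boundary integral `∫_a y ∫_â dμ dν`
`= y C^{μν} + Λ_a[δ_a y C^{μν} + y' μ_a E_a^{xμν}`
`+ μ_a (Λ_a ⊗ 1)(y^{♯a} D_a^{μν} + δ_a y' E_a^{xμν})]`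
(value in the standard order of arguments). -/
def boundary2 (X : SheetData T) (a : Dir) (μ ν : Letter) (y y' : Sheet T) : Inc22 T :=
  let u := swapS a y
  let u' := swapS a y'
  let uSharp : Inc21 T := fun p₁ p₂ q =>
    u p₂ q - u p₁ q - u' p₁ q * (X.xd a p₂ q - X.xd a p₁ q)
  swap22 a fun p₁ p₂ q₁ q₂ =>
    u p₁ q₁ * X.Cd a μ ν p₁ p₂ q₁ q₂
      + sew (fun r₁ r₂ r₃ =>
          (u r₂ q₁ - u r₁ q₁) * X.Cd a μ ν r₂ r₃ q₁ q₂
            + u' r₁ q₁ * X.E a μ ν r₁ r₂ r₂ r₃ q₁ q₂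
            + sew (fun v₁ v₂ v₃ =>
                uSharp v₁ v₂ q₁ * X.D a μ ν v₂ v₃ r₂ r₃ q₁ q₂
                  + (u' v₂ q₁ - u' v₁ q₁) * X.E a μ ν v₂ v₃ r₂ r₃ q₁ q₂) r₁ r₂) p₁ p₂

/-- The data of a controlled sheet: `y`, its coefficients `y^x`, `y^ω`, and the one-dimensional
derivatives in direction `a` of these three sheets with respect to `x`. -/
structure Controlled (T : ℝ) where
  y : Sheet T
  yx : Sheet T
  yω : Sheet T
  y' : Dir → Sheet T
  yx' : Dir → Sheet T
  yω' : Dir → Sheet T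

/-- The remainder `y^♯`, defined by
`δy = - y^x A^x - y^ω A^ω + ∑_a (∫_a y^x ∫_â dx + ∫_a y^ω ∫_â dω) + y^♯`. -/
def remainder (X : SheetData T) (Y : Controlled T) : Inc22 T := fun s₁ s₂ t₁ t₂ =>
  rect Y.y s₁ s₂ t₁ t₂
    + Y.yx s₁ t₁ * X.A .x s₁ s₂ t₁ t₂ + Y.yω s₁ t₁ * X.A .ω s₁ s₂ t₁ t₂
    - (boundary1 X .one .x Y.yx (Y.yx' .one) s₁ s₂ t₁ t₂
      + boundary1 X .two .x Y.yx (Y.yx' .two) s₁ s₂ t₁ t₂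
      + boundary1 X .one .ω Y.yω (Y.yω' .one) s₁ s₂ t₁ t₂
      + boundary1 X .two .ω Y.yω (Y.yω' .two) s₁ s₂ t₁ t₂)

/-- `- y^x C^{xν} - y^ω C^{ων} + ∑_a (∫_a y^x ∫_â dx dν + ∫_a y^ω ∫_â dω dν)`. -/
def innerPart (X : SheetData T) (ν : Letter) (Y : Controlled T) : Inc22 T := fun s₁ s₂ t₁ t₂ =>
  - (Y.yx s₁ t₁ * X.C .x ν s₁ s₂ t₁ t₂) - Y.yω s₁ t₁ * X.C .ω ν s₁ s₂ t₁ t₂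
    + (boundary2 X .one .x ν Y.yx (Y.yx' .one) s₁ s₂ t₁ t₂
      + boundary2 X .two .x ν Y.yx (Y.yx' .two) s₁ s₂ t₁ t₂
      + boundary2 X .one .ω ν Y.yω (Y.yω' .one) s₁ s₂ t₁ t₂
      + boundary2 X .two .ω ν Y.yω (Y.yω' .two) s₁ s₂ t₁ t₂)

/-- The last term `Λ[δy A^ν - δ(innerPart)]` of the rough integral, with `Λ = Λ₁Λ₂`. -/
def flatPart (X : SheetData T) (ν : Letter) (Y : Controlled T) : Inc22 T := fun s₁ s₂ t₁ t₂ =>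
  sew (fun a₁ a₂ a₃ =>
    sew (fun b₁ b₂ b₃ =>
      rect Y.y a₁ a₂ b₁ b₂ * X.A ν a₂ a₃ b₂ b₃
        - cob22 (innerPart X ν Y) a₁ a₂ a₃ b₁ b₂ b₃) t₁ t₂) s₁ s₂

/-- The rough integral `∬ y dx` (for `ν = x`), respectively `∬ y dω` (for `ν = ω`):
`- y A^ν + ∑_a ∫_a y ∫_â dν + innerPart + flatPart`. -/
def integral (X : SheetData T) (ν : Letter) (Y : Controlled T) : Inc22 T := fun s₁ s₂ t₁ t₂ =>
  - (Y.y s₁ t₁ * X.A ν s₁ s₂ t₁ t₂)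
    + (boundary1 X .one ν Y.y (Y.y' .one) s₁ s₂ t₁ t₂
      + boundary1 X .two ν Y.y (Y.y' .two) s₁ s₂ t₁ t₂)
    + innerPart X ν Y s₁ s₂ t₁ t₂ + flatPart X ν Y s₁ s₂ t₁ t₂

/-- The sheet `φ⁽ᵏ⁾(x)`. -/
def derivComp (φ : ℝ → ℝ) (k : ℕ) (x : Sheet T) : Sheet T := fun s t => iteratedDeriv k φ (x s t)

/-- `φ(x)` as a controlled sheet: `φ(x)^x = φ'(x)`, `φ(x)^ω = φ''(x)`, and the one-dimensional
derivative of `ψ(x)` is `ψ'(x)` in both directions. -/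
def controlledComp (φ : ℝ → ℝ) (x : Sheet T) : Controlled T where
  y := derivComp φ 0 x
  yx := derivComp φ 1 x
  yω := derivComp φ 2 x
  y' := fun _ => derivComp φ 1 x
  yx' := fun _ => derivComp φ 2 x
  yω' := fun _ => derivComp φ 3 x

/-- `‖φ⁽ᵏ⁾‖_{∞,M} = sup_{|ξ| ≤ M} |φ⁽ᵏ⁾(ξ)|`. -/
def derivSup (φ : ℝ → ℝ) (k : ℕ) (M : ℝ≥0∞) : ℝ≥0∞ :=
  ⨆ (ξ : ℝ) (_ : ENNReal.ofReal |ξ| ≤ M), ENNReal.ofReal |iteratedDeriv k φ ξ|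

end

end RoughSheets

/-!
All estimates are obtained from two ideas.

*Pairs of numbers.* For `ε > 0` the pairs `(u, v)` with `|u| ≤ k`, `|v| ≤ k`, `|u - v| ≤ ε k`
(`Bd`) behave like the ball of radius `k` in a Banach algebra. If `ε` bounds the distance of two
rough sheets, then each component of the two, evaluated at the same points, is such a pair, with `k`
a norm times a weight (`Ctx.bd_of_ratio_le`). An a priori bound for an expression in the components
that uses only sums, products, Taylor's formula and the sewing map is therefore at the same time a
local Lipschitz estimate. The predicate `Dom a κ i j k` states such a bound, uniformly in all the
data, with weight of order `i` in direction `a` and `j` in the other one; `Dom.sew` and `Dom.of_cob`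
are the sewing lemma in this language. Letting `ε` tend to the distance of the two sheets yields the
Hölder norms (`Dom.hol22_le`).

*Uniqueness of sewing.* An increment of order larger than one in direction `a` is controlled by its
coboundary in that direction (`IsSuperHolder.le_of_cob_le`). If the coboundary turns out to be of
higher order in the other direction than the increment is known to be, then so is the increment.

For the remainder of `φ(x)` (`remainder_eq`) this is used as follows. In direction `a`, the sewn
parts of the boundary integrals of `φ'(x)` against `dx` and of `φ''(x)` against `dω` are compared
with explicit increments, with the help of the relations between `P`, `Q`, `H`, `W`. The difference
`defect` is of order `(3, 1)`, but its coboundary `cobDefect` is of order `(3, 2)`, whence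
`Dom.defect`. What remains is a function of the values of `x` at the corners of the rectangle, which
is of order `(2, 2)` by Taylor's formula along the bilinear interpolation of these values
(`Dom.rect_taylor`), and products that are visibly of order `(2, 2)`.

For the rough integral one has to see that the function `flatIncr` to which the sewing map is
applied in both directions is of order `(3, 3)` (`Dom.flatIncr`). The coboundary in direction `a` of
the boundary integral against `dμ dν` is the separated integral `sepInt` over two adjacent
intervals. This satisfies Chen's relation in the other direction (`cob_sepInt_q`) up to terms of
third order; the only one that is not explicit is `sepDefect`, which is again estimated through its
coboundary. All other terms combine to the remainder of `φ(x)` times `A^ν` and increments of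
`φ'(x)`, `φ''(x)` times `C` (`flatIncr_eq`).
-/

namespace RoughSheets

variable {T α β : ℝ}

/-! ### The one-dimensional sewing lemma -/

/-- Functions of two points that are Hölder of some order larger than one. The sewing map takes
its values in this class, and additive members of it vanish. -/
def IsSuperHolder (r : Tm T → Tm T → ℝ) : Prop :=
  ∃ μ C : ℝ, 1 < μ ∧ ∀ a b, |r a b| ≤ C * dist a b ^ μ

/-- The midpoint of two points of `[0,T]`. -/
noncomputable def mid (a b : Tm T) : Tm T :=
  ⟨((a : ℝ) + b) / 2, by
    have ha := a.2; have hb := b.2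
    constructor <;> linarith [ha.1, ha.2, hb.1, hb.2]⟩

theorem dist_mid_left (a b : Tm T) : dist a (mid a b) = dist a b / 2 := by
  simp only [Subtype.dist_eq, Real.dist_eq, mid]
  rw [← abs_two, ← abs_div, abs_two]; congr 1; ring

theorem dist_mid_right (a b : Tm T) : dist (mid a b) b = dist a b / 2 := by
  simp only [Subtype.dist_eq, Real.dist_eq, mid]
  rw [← abs_two, ← abs_div, abs_two]; congr 1; ring

/-- The geometric series `∑ₙ 2ⁿ 2^{-nμ}` that appears in dyadic sewing. -/
noncomputable def sewConst (μ : ℝ) : ℝ := (1 - 2 * (1 / 2 : ℝ) ^ μ)⁻¹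

theorem two_mul_half_rpow_lt_one {μ : ℝ} (hμ : 1 < μ) : 2 * (1 / 2 : ℝ) ^ μ < 1 := by
  have h := Real.rpow_lt_rpow_of_exponent_gt (x := 1 / 2) (by norm_num) (by norm_num) hμ
  rw [Real.rpow_one] at h
  linarith

theorem sewConst_pos {μ : ℝ} (hμ : 1 < μ) : 0 < sewConst μ :=
  inv_pos.2 (by linarith [two_mul_half_rpow_lt_one hμ])

theorem sewConst_eq {μ : ℝ} (hμ : 1 < μ) :
    sewConst μ = 2 * (1 / 2 : ℝ) ^ μ * sewConst μ + 1 := by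
  have h := two_mul_half_rpow_lt_one hμ
  unfold sewConst
  have : (1 - 2 * (1 / 2 : ℝ) ^ μ) ≠ 0 := by linarith
  field_simp
  ring

theorem half_rpow {d μ : ℝ} (hd : 0 ≤ d) : (d / 2) ^ μ = (1 / 2 : ℝ) ^ μ * d ^ μ := by
  rw [← Real.mul_rpow (by norm_num) hd]; congr 1; ring

/-- The a priori estimate of the sewing lemma: the Hölder constant of a function of Hölder order
larger than one is controlled by its coboundary, whatever Hölder constant was known before. -/
theorem IsSuperHolder.le_of_cob_le {r : Tm T → Tm T → ℝ} (hr : IsSuperHolder r) {k μ : ℝ}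
    (hμ : 1 < μ)
    (h : ∀ a b c, |cob r a b c| ≤ k * (dist a b + dist b c) ^ μ) (a b : Tm T) :
    |r a b| ≤ k * sewConst μ * dist a b ^ μ := by
  obtain ⟨μ₀, C₀, hμ₀, hr⟩ := hr
  -- after `n` bisections the known bound contributes only `(2 * 2^{-μ₀})ⁿ`
  have key : ∀ (n : ℕ) (a b : Tm T), |r a b| ≤ k * sewConst μ * dist a b ^ μ
      + (2 * (1 / 2 : ℝ) ^ μ₀) ^ n * (max C₀ 0 * dist a b ^ μ₀)
      + |k| * sewConst μ * dist a b ^ μ * (2 * (1 / 2 : ℝ) ^ μ) ^ n := by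
    intro n
    induction n with
    | zero =>
      intro a b
      have h0 : 0 ≤ dist a b ^ μ₀ := Real.rpow_nonneg dist_nonneg _
      have h1 : 0 ≤ dist a b ^ μ := Real.rpow_nonneg dist_nonneg _
      have h2 := mul_nonneg (sewConst_pos hμ).le h1
      have h3 : (0 : ℝ) ≤ (k + |k|) * (sewConst μ * dist a b ^ μ) :=
        mul_nonneg (by linarith [neg_abs_le k]) h2
      have h4 := mul_le_mul_of_nonneg_right (le_max_left C₀ 0) h0
      have := hr a b
      simp only [pow_zero, one_mul, mul_one]
      nlinarith
    | succ n ih =>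
      intro a b
      have h1 := ih a (mid a b)
      have h2 := ih (mid a b) b
      have h3 := h a (mid a b) b
      rw [dist_mid_left] at h1 h3
      rw [dist_mid_right] at h2 h3
      rw [add_halves] at h3
      rw [half_rpow dist_nonneg, half_rpow dist_nonneg] at h1 h2
      have h4 : |r a b| ≤ |r a (mid a b)| + |r (mid a b) b| + |cob r a (mid a b) b| := by
        have : r a b = r a (mid a b) + r (mid a b) b + cob r a (mid a b) b := by
          unfold cob; ring
        rw [this]
        exact abs_add_three _ _ _
      have h5 := sewConst_eq hμ
      have h6 : k * dist a b ^ μ = k * dist a b ^ μ * (sewConst μ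
          - 2 * (1 / 2 : ℝ) ^ μ * sewConst μ) := by
        rw [show sewConst μ - 2 * (1 / 2 : ℝ) ^ μ * sewConst μ = 1 by linarith]; ring
      rw [h6] at h3
      rw [pow_succ, pow_succ]
      linarith
  have l1 : Filter.Tendsto (fun n : ℕ => k * sewConst μ * dist a b ^ μ
      + (2 * (1 / 2 : ℝ) ^ μ₀) ^ n * (max C₀ 0 * dist a b ^ μ₀)
      + |k| * sewConst μ * dist a b ^ μ * (2 * (1 / 2 : ℝ) ^ μ) ^ n) Filter.atTop
      (nhds (k * sewConst μ * dist a b ^ μ + 0 * (max C₀ 0 * dist a b ^ μ₀)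
        + |k| * sewConst μ * dist a b ^ μ * 0)) := by
    have t1 := tendsto_pow_atTop_nhds_zero_of_lt_one (r := 2 * (1 / 2 : ℝ) ^ μ₀) (by positivity)
      (two_mul_half_rpow_lt_one hμ₀)
    have t2 := tendsto_pow_atTop_nhds_zero_of_lt_one (r := 2 * (1 / 2 : ℝ) ^ μ) (by positivity)
      (two_mul_half_rpow_lt_one hμ)
    exact (tendsto_const_nhds.add (t1.mul_const _)).add (t2.const_mul _)
  have := ge_of_tendsto' l1 (fun n => key n a b)
  linarith

theorem rpow_dist_le_of_le {μ ν : ℝ} (hμ : 0 < μ) (hμν : μ ≤ ν) (a b : Tm T) :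
    dist a b ^ ν ≤ |T| ^ (ν - μ) * dist a b ^ μ := by
  rcases (dist_nonneg (x := a) (y := b)).eq_or_lt with h | h
  · rw [← h, Real.zero_rpow (by linarith), Real.zero_rpow (by linarith), mul_zero]
  · have hT : dist a b ≤ |T| := by
      rw [Subtype.dist_eq, Real.dist_eq]
      have ha := a.2; have hb := b.2
      exact (abs_sub_le_iff.2 ⟨by linarith [ha.2, hb.1], by linarith [hb.2, ha.1]⟩).trans
        (le_abs_self T)
    calc dist a b ^ ν = dist a b ^ (ν - μ) * dist a b ^ μ := by
          rw [← Real.rpow_add h]; congr 1; ring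
      _ ≤ _ := by gcongr

theorem IsSuperHolder.mono_exponent {r : Tm T → Tm T → ℝ} {μ ν C : ℝ} (hμ : 1 < μ) (hμν : μ ≤ ν)
    (h : ∀ a b, |r a b| ≤ C * dist a b ^ ν) :
    ∀ a b, |r a b| ≤ max C 0 * |T| ^ (ν - μ) * dist a b ^ μ := by
  intro a b
  calc |r a b| ≤ C * dist a b ^ ν := h a b
    _ ≤ max C 0 * dist a b ^ ν := by gcongr; exact le_max_left _ _
    _ ≤ max C 0 * (|T| ^ (ν - μ) * dist a b ^ μ) := by
        gcongr; exact rpow_dist_le_of_le (by linarith) hμν a b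
    _ = _ := by ring

theorem IsSuperHolder.sub {r r' : Tm T → Tm T → ℝ} (hr : IsSuperHolder r)
    (hr' : IsSuperHolder r') : IsSuperHolder (fun a b => r a b - r' a b) := by
  obtain ⟨μ, C, hμ, h⟩ := hr
  obtain ⟨μ', C', hμ', h'⟩ := hr'
  have hm : 1 < min μ μ' := lt_min hμ hμ'
  have e := IsSuperHolder.mono_exponent hm (min_le_left _ _) h
  have e' := IsSuperHolder.mono_exponent hm (min_le_right _ _) h'
  refine ⟨min μ μ', max C 0 * |T| ^ (μ - min μ μ') + max C' 0 * |T| ^ (μ' - min μ μ'), hm,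
    fun a b => ?_⟩
  rw [add_mul]
  exact (abs_sub _ _).trans (add_le_add (e a b) (e' a b))

theorem cob_sub (r r' : Tm T → Tm T → ℝ) (a b c : Tm T) :
    cob (fun a b => r a b - r' a b) a b c = cob r a b c - cob r' a b c := by
  unfold cob; ring

/-- Uniqueness of the sewing. -/
theorem IsSuperHolder.eq_of_cob_eq {r r' : Tm T → Tm T → ℝ} (hr : IsSuperHolder r)
    (hr' : IsSuperHolder r') (h : ∀ a b c, cob r a b c = cob r' a b c) (a b : Tm T) :
    r a b = r' a b := by
  have := (hr.sub hr').le_of_cob_le (k := 0) (μ := 2) (by norm_num)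
    (fun a b c => by rw [cob_sub, h]; simp) a b
  simp only [zero_mul, abs_nonpos_iff] at this
  linarith

/-- Sums along a monotone chain stay close to the germ, uniformly in the chain: split the chain
at the middle of the interval and induct on its number of points. -/
theorem abs_chain_sub_le {g : Tm T → Tm T → ℝ} {k μ : ℝ} (hk : 0 ≤ k) (hμ : 1 < μ)
    (h : ∀ a b c, |cob g a b c| ≤ k * (dist a b + dist b c) ^ μ) {t : ℕ → Tm T}
    (ht : Monotone t) (N : ℕ) : ∀ m n, m ≤ n → n - m ≤ N →
      |∑ i ∈ Finset.Ico m n, g (t i) (t (i + 1)) - g (t m) (t n)|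
        ≤ 2 * k * sewConst μ * ((t n : ℝ) - t m) ^ μ := by
  have hdiag : ∀ a, g a a = 0 := by
    intro a
    have := h a a a
    simp only [cob, dist_self, add_zero, Real.zero_rpow (by linarith : μ ≠ 0), mul_zero,
      sub_self, zero_sub, abs_neg, abs_nonpos_iff] at this
    exact this
  have hd : ∀ i j, i ≤ j → dist (t i) (t j) = (t j : ℝ) - t i := by
    intro i j hij
    rw [Subtype.dist_eq, Real.dist_eq, abs_sub_comm,
      abs_of_nonneg (sub_nonneg.2 (Subtype.coe_le_coe.2 (ht hij)))]
  have hS := sewConst_pos hμ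
  induction N with
  | zero =>
    intro m n hmn hN
    obtain rfl : m = n := by omega
    simp [hdiag, Real.zero_rpow (by linarith : μ ≠ 0)]
  | succ N ih =>
    intro m n hmn hN
    rcases hmn.eq_or_lt with rfl | hlt
    · simp [hdiag, Real.zero_rpow (by linarith : μ ≠ 0)]
    set L : ℝ := (t n : ℝ) - t m with hL
    have hL0 : 0 ≤ L := sub_nonneg.2 (ht hmn)
    -- the last index whose point lies in the left half
    obtain ⟨i, hmi, hin, hi1, hi2⟩ : ∃ i, m ≤ i ∧ i < n ∧ (t i : ℝ) - t m ≤ L / 2 ∧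
        (t n : ℝ) - t (i + 1) ≤ L / 2 := by
      by_contra hcon
      push Not at hcon
      have : ∀ j, m + j ≤ n → (t (m + j) : ℝ) - t m ≤ L / 2 := by
        intro j
        induction j with
        | zero => intro _; simp; linarith
        | succ j ihj =>
          intro hj
          have := hcon (m + j) (by omega) (by omega) (ihj (by omega))
          rw [add_assoc] at this
          linarith
      have h1 := this (n - m) (by omega)
      rw [show m + (n - m) = n by omega] at h1
      have h2 := hcon m le_rfl hlt (by simp; linarith)
      have h3 : (t m : ℝ) ≤ t (m + 1) := ht (by omega)
      linarith
    have e1 := ih m i hmi (by omega)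
    have e2 := ih (i + 1) n hin (by omega)
    have f1 := h (t m) (t i) (t n)
    have f2 := h (t i) (t (i + 1)) (t n)
    rw [hd _ _ hmi, hd _ _ hin.le, show (t i : ℝ) - t m + (t n - t i) = L by ring] at f1
    rw [hd _ _ (Nat.le_succ i), hd _ _ (hin : i + 1 ≤ n),
      show (t (i + 1) : ℝ) - t i + (t n - t (i + 1)) = t n - t i by ring] at f2
    have hK : 0 ≤ 2 * k * sewConst μ := by positivity
    have f3 : k * ((t n : ℝ) - t i) ^ μ ≤ k * L ^ μ := by
      have : (t m : ℝ) ≤ t i := ht hmi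
      gcongr
      · exact sub_nonneg.2 (ht hin.le)
      · linarith
    have e3 : 2 * k * sewConst μ * ((t i : ℝ) - t m) ^ μ
        ≤ 2 * k * sewConst μ * ((1 / 2 : ℝ) ^ μ * L ^ μ) := by
      rw [← half_rpow hL0]
      gcongr
      exact sub_nonneg.2 (ht hmi)
    have e4 : 2 * k * sewConst μ * ((t n : ℝ) - t (i + 1)) ^ μ
        ≤ 2 * k * sewConst μ * ((1 / 2 : ℝ) ^ μ * L ^ μ) := by
      rw [← half_rpow hL0]
      gcongr
      exact sub_nonneg.2 (ht hin)
    have hsum : ∑ j ∈ Finset.Ico m n, g (t j) (t (j + 1))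
        = ∑ j ∈ Finset.Ico m i, g (t j) (t (j + 1)) + g (t i) (t (i + 1))
          + ∑ j ∈ Finset.Ico (i + 1) n, g (t j) (t (j + 1)) := by
      rw [← Finset.sum_Ico_consecutive _ hmi hin.le, Finset.sum_eq_sum_Ico_succ_bot hin]
      ring
    have hid : ∑ j ∈ Finset.Ico m n, g (t j) (t (j + 1)) - g (t m) (t n)
        = (∑ j ∈ Finset.Ico m i, g (t j) (t (j + 1)) - g (t m) (t i))
          + (∑ j ∈ Finset.Ico (i + 1) n, g (t j) (t (j + 1)) - g (t (i + 1)) (t n))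
          + (-cob g (t m) (t i) (t n) - cob g (t i) (t (i + 1)) (t n)) := by
      rw [hsum]; unfold cob; ring
    rw [hid]
    have e5 : |-cob g (t m) (t i) (t n) - cob g (t i) (t (i + 1)) (t n)| ≤ 2 * (k * L ^ μ) := by
      refine (abs_sub _ _).trans ?_
      rw [abs_neg]; linarith
    have h5 : 2 * k * L ^ μ = 2 * k * L ^ μ * (sewConst μ
          - 2 * (1 / 2 : ℝ) ^ μ * sewConst μ) := by
      rw [show sewConst μ - 2 * (1 / 2 : ℝ) ^ μ * sewConst μ = 1 by linarith [sewConst_eq hμ]]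
      ring
    refine (abs_add_three _ _ _).trans ?_
    linarith

/-- On a finite set of points the germ can be replaced by the increments of a function. -/
theorem exists_potential_finset {g : Tm T → Tm T → ℝ} {k μ : ℝ} (hk : 0 ≤ k) (hμ : 1 < μ)
    (h : ∀ a b c, |cob g a b c| ≤ k * (dist a b + dist b c) ^ μ) (π : Finset (Tm T)) :
    ∃ f : Tm T → ℝ, ∀ a ∈ π, ∀ b ∈ π, a ≤ b →
      |f b - f a - g a b| ≤ 2 * k * sewConst μ * dist a b ^ μ := by
  classical
  rcases π.eq_empty_or_nonempty with rfl | hne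
  · exact ⟨0, by simp⟩
  have hc : 0 < π.card := hne.card_pos
  set e := π.orderEmbOfFin rfl
  let t : ℕ → Tm T := fun i => e ⟨min i (π.card - 1), by omega⟩
  have ht : Monotone t := by
    intro i j hij
    apply e.monotone
    simp only [Fin.mk_le_mk]
    exact min_le_min_right _ hij
  have hsurj : ∀ a ∈ π, ∃ i, t i = a := by
    intro a ha
    have : a ∈ Set.range e := by rw [Finset.range_orderEmbOfFin]; exact ha
    obtain ⟨⟨i, hi⟩, rfl⟩ := this
    refine ⟨i, ?_⟩
    have : min i (π.card - 1) = i := by omega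
    simp only [t, this]
  choose! idx hidx using hsurj
  refine ⟨fun a => ∑ i ∈ Finset.range (idx a), g (t i) (t (i + 1)), fun a ha b hb hab => ?_⟩
  have hab' : (a : ℝ) ≤ b := hab
  have hd : dist a b = (b : ℝ) - a := by
    rw [Subtype.dist_eq, Real.dist_eq, abs_sub_comm, abs_of_nonneg (sub_nonneg.2 hab')]
  rcases le_total (idx a) (idx b) with hi | hi
  · have := abs_chain_sub_le hk hμ h ht _ _ _ hi le_rfl
    rw [hidx a ha, hidx b hb] at this
    rw [hd]
    rwa [← Finset.sum_Ico_eq_sub _ hi]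
  · have hba : a = b := by
      apply le_antisymm hab
      rw [← hidx a ha, ← hidx b hb]
      exact ht hi
    subst hba
    have := abs_chain_sub_le hk hμ h ht _ _ _ (le_refl (idx a)) le_rfl
    rw [hidx a ha] at this
    simpa using this

/-- Existence in the sewing lemma, for the coboundary of a germ. The additive part of the germ is
obtained as a limit, along an ultrafilter on the finite subsets of `[0,T]`, of Riemann sums. -/
theorem exists_isSewing_cob {g : Tm T → Tm T → ℝ} {k μ : ℝ} (hμ : 1 < μ)
    (h : ∀ a b c, |cob g a b c| ≤ k * (dist a b + dist b c) ^ μ) :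
    ∃ r, IsSewing (cob g) r := by
  classical
  rcases isEmpty_or_nonempty (Tm T) with hE | ⟨⟨o⟩⟩
  · exact ⟨0, ⟨2, 0, by norm_num, fun a => (hE.false a).elim⟩, fun a => (hE.false a).elim⟩
  have hle : ∀ a b : Tm T, ∀ r : Tm T → Tm T → ℝ,
      (∀ a b, a ≤ b → |r a b| ≤ 2 * max k 0 * sewConst μ * dist a b ^ μ) →
      (∀ a b c, |cob r a b c| ≤ max k 0 * (dist a b + dist b c) ^ μ) →
      |r a b| ≤ (2 * max k 0 * sewConst μ + max k 0 * 2 ^ μ) * dist a b ^ μ := by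
    intro a b r h1 h2
    have p1 : 0 ≤ dist a b ^ μ := Real.rpow_nonneg dist_nonneg _
    have p2 : 0 ≤ max k 0 * 2 ^ μ * dist a b ^ μ := by positivity
    rcases le_total a b with hab | hab
    · rw [add_mul]; linarith [h1 a b hab]
    · have e1 := h1 b a hab
      have e2 := h2 b a b
      have e3 := h1 b b le_rfl
      rw [dist_self, Real.zero_rpow (by linarith : μ ≠ 0), mul_zero, abs_nonpos_iff] at e3
      rw [dist_comm b a, ← two_mul, Real.mul_rpow (by norm_num) dist_nonneg] at e2
      rw [dist_comm b a] at e1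
      have e4 : r a b = -(r b a + cob r b a b) := by unfold cob; rw [e3]; ring
      rw [e4, abs_neg, add_mul]
      exact (abs_add_le _ _).trans (add_le_add e1 (by linarith))
  have h' : ∀ a b c, |cob g a b c| ≤ max k 0 * (dist a b + dist b c) ^ μ := fun a b c =>
    (h a b c).trans (by gcongr; exact le_max_left _ _)
  choose f₀ hf₀ using exists_potential_finset (le_max_right k 0) hμ h'
  let f : Finset (Tm T) → Tm T → ℝ := fun π b => f₀ π b - f₀ π o
  have hf : ∀ π, ∀ a ∈ π, ∀ b ∈ π, a ≤ b →
      |f π b - f π a - g a b| ≤ 2 * max k 0 * sewConst μ * dist a b ^ μ := by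
    intro π a ha b hb hab
    simpa [f] using hf₀ π a ha b hb hab
  let U : Ultrafilter (Finset (Tm T)) := Ultrafilter.of Filter.atTop
  have hU : (U : Filter (Finset (Tm T))) ≤ Filter.atTop := Ultrafilter.of_le _
  have hmem : ∀ s : Finset (Tm T), ∀ᶠ π in (U : Filter (Finset (Tm T))), s ⊆ π := fun s =>
    hU (Filter.eventually_ge_atTop s)
  have hlim : ∀ b, ∃ y, Filter.Tendsto (fun π => f π b) U (nhds y) := by
    intro b
    obtain ⟨B, hB⟩ : ∃ B, ∀ᶠ π in (U : Filter (Finset (Tm T))), f π b ∈ Set.Icc (-B) B := by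
      refine ⟨|g o b| + |g b o| + 2 * max k 0 * sewConst μ * dist o b ^ μ, ?_⟩
      filter_upwards [hmem {o, b}] with π hπ
      have ho : o ∈ π := hπ (by simp)
      have hb : b ∈ π := hπ (by simp)
      have fo : f π o = 0 := by simp [f]
      rw [Set.mem_Icc, ← abs_le]
      rcases le_total o b with hob | hob
      · have := hf π o ho b hb hob
        rw [fo, sub_zero] at this
        have e := abs_sub_abs_le_abs_sub (f π b) (g o b)
        linarith [abs_nonneg (g b o)]
      · have := hf π b hb o ho hob
        rw [fo, zero_sub, ← neg_add', abs_neg, dist_comm] at this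
        have e := abs_sub_abs_le_abs_sub (f π b) (-g b o)
        rw [abs_neg, sub_neg_eq_add] at e
        linarith [abs_nonneg (g o b)]
    obtain ⟨y, -, hy⟩ := isCompact_Icc.ultrafilter_le_nhds (U.map (fun π => f π b))
      (by rw [Filter.le_principal_iff]; exact hB)
    exact ⟨y, hy⟩
  choose F hF using hlim
  have hFle : ∀ a b, a ≤ b → |F b - F a - g a b| ≤ 2 * max k 0 * sewConst μ * dist a b ^ μ := by
    intro a b hab
    have t := (((hF b).sub (hF a)).sub_const (g a b)).abs
    refine le_of_tendsto t ?_
    filter_upwards [hmem {a, b}] with π hπ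
    exact hf π a (hπ (by simp)) b (hπ (by simp)) hab
  refine ⟨fun a b => g a b - (F b - F a), ⟨μ, 2 * max k 0 * sewConst μ + max k 0 * 2 ^ μ, hμ,
    fun a b => hle a b (fun a b => g a b - (F b - F a)) ?_ ?_⟩, ?_⟩
  · intro a b hab
    rw [abs_sub_comm]; exact hFle a b hab
  · intro a b c
    have : cob (fun a b => g a b - (F b - F a)) a b c = cob g a b c := by unfold cob; ring
    rw [this]; exact h' a b c
  · intro a b c
    unfold cob; ring

/-- The closedness condition `δh = 0` for a function of three points. -/
def IsClosedInc (h : Tm T → Tm T → Tm T → ℝ) : Prop :=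
  ∀ a b c d, h b c d - h a c d + h a b d - h a b c = 0

/-- The sewing lemma: a closed `h` of order larger than one can be sewn. -/
theorem isSewing_sew {h : Tm T → Tm T → Tm T → ℝ} (hc : IsClosedInc h) {k μ : ℝ} (hμ : 1 < μ)
    (hb : ∀ a b c, |h a b c| ≤ k * (dist a b + dist b c) ^ μ) : IsSewing h (sew h) := by
  have hex : ∃ r, IsSewing h r := by
    rcases isEmpty_or_nonempty (Tm T) with hE | ⟨⟨o⟩⟩
    · exact ⟨0, ⟨2, 0, by norm_num, fun a => (hE.false a).elim⟩, fun a => (hE.false a).elim⟩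
    have e : ∀ a b c, cob (fun a b => -h o a b) a b c = h a b c := by
      intro a b c
      have := hc o a b c
      unfold cob; linarith
    obtain ⟨r, hr⟩ := exists_isSewing_cob (g := fun a b => -h o a b) hμ
      (fun a b c => by rw [e]; exact hb a b c)
    exact ⟨r, hr.1, fun a b c => (hr.2 a b c).trans (e a b c)⟩
  unfold sew
  rw [dif_pos hex]
  exact hex.choose_spec

theorem isClosedInc_cob (g : Tm T → Tm T → ℝ) : IsClosedInc (cob g) := by
  intro a b c d; unfold cob; ring

theorem IsClosedInc.of_eq_cob {h : Tm T → Tm T → Tm T → ℝ} (g : Tm T → Tm T → ℝ)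
    (e : ∀ a b c, h a b c = cob g a b c) : IsClosedInc h := by
  intro a b c d; rw [e, e, e, e]; exact isClosedInc_cob g a b c d

/-! ### Lipschitz bounds for pairs of numbers -/

/-- The pair `(u, v)` is bounded by `k` in the Lipschitz norm of functions on a space of two points
at distance `ε`. Since this is (up to a factor `2`) the norm of a Banach algebra, an a priori bound
for polynomial expressions in this norm is at the same time a local Lipschitz estimate. -/
def Bd (ε u v k : ℝ) : Prop := |u| ≤ k ∧ |v| ≤ k ∧ |u - v| ≤ ε * k

namespace Bd

variable {ε u v u' v' k k' : ℝ}

theorem nonneg (h : Bd ε u v k) : 0 ≤ k := (abs_nonneg u).trans h.1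

theorem mono (hε : 0 ≤ ε) (h : Bd ε u v k) (hk : k ≤ k') : Bd ε u v k' :=
  ⟨h.1.trans hk, h.2.1.trans hk, h.2.2.trans (mul_le_mul_of_nonneg_left hk hε)⟩

theorem add (h : Bd ε u v k) (h' : Bd ε u' v' k') : Bd ε (u + u') (v + v') (k + k') := by
  refine ⟨(abs_add_le _ _).trans (add_le_add h.1 h'.1),
    (abs_add_le _ _).trans (add_le_add h.2.1 h'.2.1), ?_⟩
  rw [show u + u' - (v + v') = (u - v) + (u' - v') by ring, mul_add]
  exact (abs_add_le _ _).trans (add_le_add h.2.2 h'.2.2)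

theorem neg (h : Bd ε u v k) : Bd ε (-u) (-v) k := by
  refine ⟨by rw [abs_neg]; exact h.1, by rw [abs_neg]; exact h.2.1, ?_⟩
  rw [show -u - -v = -(u - v) by ring, abs_neg]; exact h.2.2

theorem mul (h : Bd ε u v k) (h' : Bd ε u' v' k') :
    Bd ε (u * u') (v * v') (2 * (k * k')) := by
  have hk := h.nonneg
  have hk' := h'.nonneg
  have p : 0 ≤ k * k' := mul_nonneg hk hk'
  have e1 : |u * u'| ≤ k * k' := by rw [abs_mul]; exact mul_le_mul h.1 h'.1 (abs_nonneg _) hk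
  have e2 : |v * v'| ≤ k * k' := by rw [abs_mul]; exact mul_le_mul h.2.1 h'.2.1 (abs_nonneg _) hk
  refine ⟨by linarith, by linarith, ?_⟩
  rw [show u * u' - v * v' = u * (u' - v') + (u - v) * v' by ring]
  refine (abs_add_le _ _).trans ?_
  rw [abs_mul, abs_mul]
  have e3 := mul_le_mul h.1 h'.2.2 (abs_nonneg _) hk
  have e4 := mul_le_mul h.2.2 h'.2.1 (abs_nonneg _) ((abs_nonneg _).trans h.2.2)
  linarith

theorem const_mul (c : ℝ) (h : Bd ε u v k) : Bd ε (c * u) (c * v) (|c| * k) := by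
  refine ⟨?_, ?_, ?_⟩
  · rw [abs_mul]; exact mul_le_mul_of_nonneg_left h.1 (abs_nonneg c)
  · rw [abs_mul]; exact mul_le_mul_of_nonneg_left h.2.1 (abs_nonneg c)
  · rw [← mul_sub, abs_mul, mul_left_comm]
    exact mul_le_mul_of_nonneg_left h.2.2 (abs_nonneg c)

theorem convex (h : Bd ε u v k) (h' : Bd ε u' v' k) {θ : ℝ} (hθ : θ ∈ Set.Icc (0 : ℝ) 1) :
    Bd ε ((1 - θ) * u + θ * u') ((1 - θ) * v + θ * v') k := by
  have := (h.const_mul (1 - θ)).add (h'.const_mul θ)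
  rw [abs_of_nonneg (by linarith [hθ.2]), abs_of_nonneg hθ.1] at this
  convert this using 1; ring

end Bd

/-! ### Mean value and Taylor estimates for pairs -/

section Taylor

theorem abs_sub_le_of_deriv_le {g g' : ℝ → ℝ} {k : ℝ}
    (hg : ∀ θ ∈ Set.Icc (0 : ℝ) 1, HasDerivAt g (g' θ) θ)
    (hk : ∀ θ ∈ Set.Icc (0 : ℝ) 1, |g' θ| ≤ k) {b : ℝ} (hb : b ∈ Set.Icc (0 : ℝ) 1) :
    |g b - g 0| ≤ k := by
  have h0 : (0 : ℝ) ∈ Set.Icc (0 : ℝ) 1 := by simp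
  have hk0 : 0 ≤ k := (abs_nonneg _).trans (hk 0 h0)
  have := Convex.norm_image_sub_le_of_norm_hasDerivWithin_le (s := Set.Icc (0 : ℝ) 1)
    (fun θ hθ => (hg θ hθ).hasDerivWithinAt) hk (convex_Icc 0 1) h0 hb
  rw [sub_zero, Real.norm_eq_abs, Real.norm_eq_abs, abs_of_nonneg hb.1] at this
  exact this.trans (mul_le_of_le_one_right hk0 hb.2)

variable {ε k : ℝ}

theorem Bd.of_deriv {g g' f f' : ℝ → ℝ}
    (hg : ∀ θ ∈ Set.Icc (0 : ℝ) 1, HasDerivAt g (g' θ) θ)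
    (hf : ∀ θ ∈ Set.Icc (0 : ℝ) 1, HasDerivAt f (f' θ) θ)
    (hk : ∀ θ ∈ Set.Icc (0 : ℝ) 1, Bd ε (g' θ) (f' θ) k) {b : ℝ} (hb : b ∈ Set.Icc (0 : ℝ) 1) :
    Bd ε (g b - g 0) (f b - f 0) k := by
  refine ⟨abs_sub_le_of_deriv_le hg (fun θ hθ => (hk θ hθ).1) hb,
    abs_sub_le_of_deriv_le hf (fun θ hθ => (hk θ hθ).2.1) hb, ?_⟩
  have := abs_sub_le_of_deriv_le (g := fun θ => g θ - f θ) (g' := fun θ => g' θ - f' θ)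
    (fun θ hθ => (hg θ hθ).sub (hf θ hθ)) (fun θ hθ => (hk θ hθ).2.2) hb
  rwa [show g b - g 0 - (f b - f 0) = g b - f b - (g 0 - f 0) by ring]

theorem Bd.of_deriv_two {g g' g'' f f' f'' : ℝ → ℝ}
    (hg : ∀ θ ∈ Set.Icc (0 : ℝ) 1, HasDerivAt g (g' θ) θ)
    (hg' : ∀ θ ∈ Set.Icc (0 : ℝ) 1, HasDerivAt g' (g'' θ) θ)
    (hf : ∀ θ ∈ Set.Icc (0 : ℝ) 1, HasDerivAt f (f' θ) θ)
    (hf' : ∀ θ ∈ Set.Icc (0 : ℝ) 1, HasDerivAt f' (f'' θ) θ)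
    (hk : ∀ θ ∈ Set.Icc (0 : ℝ) 1, Bd ε (g'' θ) (f'' θ) k) {b : ℝ}
    (hb : b ∈ Set.Icc (0 : ℝ) 1) :
    Bd ε (g b - g 0 - b * g' 0) (f b - f 0 - b * f' 0) k := by
  have h1 := Bd.of_deriv (g := fun θ => g θ - θ * g' 0) (f := fun θ => f θ - θ * f' 0)
    (g' := fun θ => g' θ - g' 0) (f' := fun θ => f' θ - f' 0)
    (fun θ hθ => by simpa using (hg θ hθ).fun_sub ((hasDerivAt_id θ).mul_const (g' 0)))
    (fun θ hθ => by simpa using (hf θ hθ).fun_sub ((hasDerivAt_id θ).mul_const (f' 0)))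
    (fun θ hθ => Bd.of_deriv hg' hf' hk hθ) hb
  convert h1 using 1 <;> ring

theorem Bd.of_deriv_three {g g' g'' g''' f f' f'' f''' : ℝ → ℝ}
    (hg : ∀ θ ∈ Set.Icc (0 : ℝ) 1, HasDerivAt g (g' θ) θ)
    (hg' : ∀ θ ∈ Set.Icc (0 : ℝ) 1, HasDerivAt g' (g'' θ) θ)
    (hg'' : ∀ θ ∈ Set.Icc (0 : ℝ) 1, HasDerivAt g'' (g''' θ) θ)
    (hf : ∀ θ ∈ Set.Icc (0 : ℝ) 1, HasDerivAt f (f' θ) θ)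
    (hf' : ∀ θ ∈ Set.Icc (0 : ℝ) 1, HasDerivAt f' (f'' θ) θ)
    (hf'' : ∀ θ ∈ Set.Icc (0 : ℝ) 1, HasDerivAt f'' (f''' θ) θ)
    (hk : ∀ θ ∈ Set.Icc (0 : ℝ) 1, Bd ε (g''' θ) (f''' θ) k) :
    Bd ε (g 1 - g 0 - g' 0 - 1 / 2 * g'' 0) (f 1 - f 0 - f' 0 - 1 / 2 * f'' 0) k := by
  have hd : ∀ c θ : ℝ, HasDerivAt (fun θ : ℝ => 1 / 2 * θ ^ 2 * c) (θ * c) θ := by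
    intro c θ
    have := (((hasDerivAt_id θ).pow 2).const_mul (1 / 2 : ℝ)).mul_const c
    exact this.congr_deriv (by simp)
  have h1 := Bd.of_deriv (g := fun θ => g θ - θ * g' 0 - 1 / 2 * θ ^ 2 * g'' 0)
    (f := fun θ => f θ - θ * f' 0 - 1 / 2 * θ ^ 2 * f'' 0)
    (g' := fun θ => g' θ - g' 0 - θ * g'' 0) (f' := fun θ => f' θ - f' 0 - θ * f'' 0)
    (fun θ hθ => by
      simpa using ((hg θ hθ).fun_sub ((hasDerivAt_id θ).mul_const (g' 0))).fun_sub (hd (g'' 0) θ))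
    (fun θ hθ => by
      simpa using ((hf θ hθ).fun_sub ((hasDerivAt_id θ).mul_const (f' 0))).fun_sub (hd (f'' 0) θ))
    (fun θ hθ => Bd.of_deriv_two hg' hg'' hf' hf'' hk hθ) (b := 1) (by simp)
  convert h1 using 1 <;> ring

/-- Both numbers lie in `[-M, M]`, at distance at most `ε`. -/
def Reg (M ε u v : ℝ) : Prop := |u| ≤ M ∧ |v| ≤ M ∧ |u - v| ≤ ε

theorem abs_convex_le {u v M θ : ℝ} (hu : |u| ≤ M) (hv : |v| ≤ M) (hθ : θ ∈ Set.Icc (0 : ℝ) 1) :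
    |(1 - θ) * u + θ * v| ≤ M := by
  rw [abs_le] at *
  constructor <;> nlinarith [hθ.1, hθ.2]

theorem Reg.convex {M u v u' v' : ℝ} (h : Reg M ε u v) (h' : Reg M ε u' v') {θ : ℝ}
    (hθ : θ ∈ Set.Icc (0 : ℝ) 1) :
    Reg M ε ((1 - θ) * u + θ * u') ((1 - θ) * v + θ * v') := by
  refine ⟨abs_convex_le h.1 h'.1 hθ, abs_convex_le h.2.1 h'.2.1 hθ, ?_⟩
  rw [show (1 - θ) * u + θ * u' - ((1 - θ) * v + θ * v')
    = (1 - θ) * (u - v) + θ * (u' - v') by ring]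
  exact abs_convex_le h.2.2 h'.2.2 hθ

/-- `F 0, F 1, …` are the successive derivatives of a function, and for `1 ≤ k ≤ 7` the pairs
`(F k u, F k v)` are bounded by `K`. -/
structure DerivBd (F : ℕ → ℝ → ℝ) (M ε K : ℝ) : Prop where
  deriv : ∀ k ≤ 7, ∀ u, HasDerivAt (F k) (F (k + 1) u) u
  bd : ∀ k, 1 ≤ k → k ≤ 7 → ∀ u v, Reg M ε u v → Bd ε (F k u) (F k v) K

variable {F : ℕ → ℝ → ℝ} {M K : ℝ}

theorem hasDerivAt_segment {f : ℝ → ℝ} {f' : ℝ → ℝ} (h : ∀ u, HasDerivAt f (f' u) u)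
    (x a θ : ℝ) : HasDerivAt (fun θ => f (x + θ * a)) (f' (x + θ * a) * a) θ := by
  have h1 : HasDerivAt (fun θ : ℝ => x + θ * a) a θ := by
    simpa using ((hasDerivAt_id θ).mul_const a).const_add x
  exact (h _).comp θ h1

theorem Reg.segment {x y x' y' : ℝ} (h : Reg M ε x y) (h' : Reg M ε x' y') {θ : ℝ}
    (hθ : θ ∈ Set.Icc (0 : ℝ) 1) : Reg M ε (x + θ * (x' - x)) (y + θ * (y' - y)) := by
  convert h.convex h' hθ using 1 <;> ring

theorem DerivBd.increment (hF : DerivBd F M ε K) {n : ℕ} (hn : n ≤ 6) {x y x' y' A : ℝ}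
    (h : Reg M ε x y) (h' : Reg M ε x' y') (hA : Bd ε (x' - x) (y' - y) A) :
    Bd ε (F n x' - F n x) (F n y' - F n y) (2 * (K * A)) := by
  have := Bd.of_deriv (g := fun θ => F n (x + θ * (x' - x))) (f := fun θ => F n (y + θ * (y' - y)))
    (fun θ _ => hasDerivAt_segment (hF.deriv n (by omega)) _ _ θ)
    (fun θ _ => hasDerivAt_segment (hF.deriv n (by omega)) _ _ θ)
    (fun θ hθ => (hF.bd (n + 1) (by omega) (by omega) _ _ (h.segment h' hθ)).mul hA)
    (b := 1) (by simp)
  simpa using this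

theorem DerivBd.taylor_two (hF : DerivBd F M ε K) {n : ℕ} (hn : n ≤ 5) {x y x' y' A : ℝ}
    (h : Reg M ε x y) (h' : Reg M ε x' y') (hA : Bd ε (x' - x) (y' - y) A) :
    Bd ε (F n x' - F n x - F (n + 1) x * (x' - x)) (F n y' - F n y - F (n + 1) y * (y' - y))
      (4 * (K * A ^ 2)) := by
  have := Bd.of_deriv_two (g := fun θ => F n (x + θ * (x' - x)))
    (f := fun θ => F n (y + θ * (y' - y)))
    (fun θ _ => hasDerivAt_segment (hF.deriv n (by omega)) _ _ θ)
    (fun θ _ => (hasDerivAt_segment (hF.deriv (n + 1) (by omega)) _ _ θ).mul_const _)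
    (fun θ _ => hasDerivAt_segment (hF.deriv n (by omega)) _ _ θ)
    (fun θ _ => (hasDerivAt_segment (hF.deriv (n + 1) (by omega)) _ _ θ).mul_const _)
    (fun θ hθ =>
      ((hF.bd (n + 2) (by omega) (by omega) _ _ (h.segment h' hθ)).mul hA).mul hA)
    (b := 1) (by simp)
  convert this using 1 <;> [skip; skip; ring] <;> simp

theorem DerivBd.taylor_three (hF : DerivBd F M ε K) {n : ℕ} (hn : n ≤ 4) {x y x' y' A : ℝ}
    (h : Reg M ε x y) (h' : Reg M ε x' y') (hA : Bd ε (x' - x) (y' - y) A) :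
    Bd ε (F n x' - F n x - F (n + 1) x * (x' - x) - 1 / 2 * F (n + 2) x * (x' - x) ^ 2)
      (F n y' - F n y - F (n + 1) y * (y' - y) - 1 / 2 * F (n + 2) y * (y' - y) ^ 2)
      (8 * (K * A ^ 3)) := by
  have := Bd.of_deriv_three (g := fun θ => F n (x + θ * (x' - x)))
    (f := fun θ => F n (y + θ * (y' - y)))
    (fun θ _ => hasDerivAt_segment (hF.deriv n (by omega)) _ _ θ)
    (fun θ _ => (hasDerivAt_segment (hF.deriv (n + 1) (by omega)) _ _ θ).mul_const _)
    (fun θ _ => ((hasDerivAt_segment (hF.deriv (n + 2) (by omega)) _ _ θ).mul_const _).mul_const _)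
    (fun θ _ => hasDerivAt_segment (hF.deriv n (by omega)) _ _ θ)
    (fun θ _ => (hasDerivAt_segment (hF.deriv (n + 1) (by omega)) _ _ θ).mul_const _)
    (fun θ _ => ((hasDerivAt_segment (hF.deriv (n + 2) (by omega)) _ _ θ).mul_const _).mul_const _)
    (fun θ hθ =>
      (((hF.bd (n + 3) (by omega) (by omega) _ _ (h.segment h' hθ)).mul hA).mul hA).mul hA)
  convert this using 1 <;> [skip; skip; ring] <;> simp <;> ring

/-- Bilinear interpolation between the values `x`, `x + a`, `x + b`, `x + a + b + e` at the corners
of the unit square. It stays in the convex hull of these values. -/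
def bilin (x a b e θ η : ℝ) : ℝ := x + θ * a + η * b + θ * η * e

theorem hasDerivAt_bilin_left {f f' : ℝ → ℝ} (h : ∀ u, HasDerivAt f (f' u) u)
    (x a b e θ η : ℝ) : HasDerivAt (fun θ => f (bilin x a b e θ η))
      (f' (bilin x a b e θ η) * (a + η * e)) θ := by
  have := hasDerivAt_segment h (x + η * b) (a + η * e) θ
  have e1 : ∀ θ, x + η * b + θ * (a + η * e) = bilin x a b e θ η := by
    intro θ; unfold bilin; ring
  simpa only [e1] using this

theorem hasDerivAt_bilin_right {f f' : ℝ → ℝ} (h : ∀ u, HasDerivAt f (f' u) u)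
    (x a b e θ η : ℝ) : HasDerivAt (fun η => f (bilin x a b e θ η))
      (f' (bilin x a b e θ η) * (b + θ * e)) η := by
  have := hasDerivAt_segment h (x + θ * a) (b + θ * e) η
  have e1 : ∀ η, x + θ * a + η * (b + θ * e) = bilin x a b e θ η := by
    intro η; unfold bilin; ring
  simpa only [e1] using this

theorem hasDerivAt_affine (b e θ : ℝ) : HasDerivAt (fun θ => b + θ * e) e θ := by
  simpa using ((hasDerivAt_id θ).mul_const e).const_add b

/-- The four corner values of a rectangle, their increments and the rectangular increment, as
pairs, with bounds of the increments. -/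
structure Corners (M ε x a b e y c d f A B E : ℝ) : Prop where
  r11 : Reg M ε x y
  r21 : Reg M ε (x + a) (y + c)
  r12 : Reg M ε (x + b) (y + d)
  r22 : Reg M ε (x + a + b + e) (y + c + d + f)
  ha : Bd ε a c A
  ha' : Bd ε (a + e) (c + f) A
  hb : Bd ε b d B
  hb' : Bd ε (b + e) (d + f) B
  he : Bd ε e f E

namespace Corners

variable {x a b e y c d f A B E : ℝ}

theorem reg (h : Corners M ε x a b e y c d f A B E) {θ η : ℝ} (hθ : θ ∈ Set.Icc (0 : ℝ) 1)
    (hη : η ∈ Set.Icc (0 : ℝ) 1) : Reg M ε (bilin x a b e θ η) (bilin y c d f θ η) := by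
  convert (h.r11.convex h.r21 hθ).convex (h.r12.convex h.r22 hθ) hη using 1 <;>
    unfold bilin <;> ring

theorem bdl (h : Corners M ε x a b e y c d f A B E) {η : ℝ} (hη : η ∈ Set.Icc (0 : ℝ) 1) :
    Bd ε (a + η * e) (c + η * f) A := by
  convert h.ha.convex h.ha' hη using 1 <;> ring

theorem bdr (h : Corners M ε x a b e y c d f A B E) {θ : ℝ} (hθ : θ ∈ Set.Icc (0 : ℝ) 1) :
    Bd ε (b + θ * e) (d + θ * f) B := by
  convert h.hb.convex h.hb' hθ using 1 <;> ring

end Corners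

variable {x a b e y c d f A B E : ℝ}

/-- The rectangular increment of `F n` is of first order in both directions. -/
theorem DerivBd.rect (hF : DerivBd F M ε K) {n : ℕ} (hn : n ≤ 5)
    (h : Corners M ε x a b e y c d f A B E) :
    Bd ε (F n (x + a + b + e) - F n (x + a) - F n (x + b) + F n x)
      (F n (y + c + d + f) - F n (y + c) - F n (y + d) + F n y)
      (4 * (K * A * B) + 2 * (K * E)) := by
  have inner : ∀ (x a b e θ : ℝ), ∀ η ∈ Set.Icc (0 : ℝ) 1,
      HasDerivAt (fun η => F (n + 1) (bilin x a b e θ η) * (a + η * e))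
        (F (n + 2) (bilin x a b e θ η) * (b + θ * e) * (a + η * e)
          + F (n + 1) (bilin x a b e θ η) * e) η := fun x a b e θ η _ =>
    (hasDerivAt_bilin_right (hF.deriv (n + 1) (by omega)) x a b e θ η).mul
      (hasDerivAt_affine a e η)
  have outer : ∀ (x a b e : ℝ), ∀ θ ∈ Set.Icc (0 : ℝ) 1,
      HasDerivAt (fun θ => F n (bilin x a b e θ 1) - F n (bilin x a b e θ 0))
        (F (n + 1) (bilin x a b e θ 1) * (a + 1 * e)
          - F (n + 1) (bilin x a b e θ 0) * (a + 0 * e)) θ := fun x a b e θ _ =>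
    (hasDerivAt_bilin_left (hF.deriv n (by omega)) x a b e θ 1).sub
      (hasDerivAt_bilin_left (hF.deriv n (by omega)) x a b e θ 0)
  have := Bd.of_deriv (outer x a b e) (outer y c d f) (fun θ hθ =>
    Bd.of_deriv (inner x a b e θ) (inner y c d f θ) (fun η hη =>
      (((hF.bd (n + 2) (by omega) (by omega) _ _ (h.reg hθ hη)).mul (h.bdr hθ)).mul
        (h.bdl hη)).add ((hF.bd (n + 1) (by omega) (by omega) _ _ (h.reg hθ hη)).mul h.he))
      (b := 1) (by simp)) (b := 1) (by simp)
  simp only [bilin] at this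
  convert this using 1
  · simp only [one_mul, zero_mul, mul_one, mul_zero, add_zero]
    ring
  · simp only [one_mul, zero_mul, mul_one, mul_zero, add_zero]
    ring
  · ring

/-- The increment in one direction of the second order Taylor remainder in the other. -/
theorem DerivBd.taylor_two_increment (hF : DerivBd F M ε K) {n : ℕ} (hn : n ≤ 4)
    (h : Corners M ε x a b e y c d f A B E) :
    Bd ε (F n (x + a + b + e) - F n (x + b) - F (n + 1) (x + b) * (a + e)
        - (F n (x + a) - F n x - F (n + 1) x * a))
      (F n (y + c + d + f) - F n (y + d) - F (n + 1) (y + d) * (c + f)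
        - (F n (y + c) - F n y - F (n + 1) y * c))
      (8 * (K * A ^ 2 * B) + 8 * (K * A * E)) := by
  have d1 : ∀ (x a b e η : ℝ), ∀ θ ∈ Set.Icc (0 : ℝ) 1,
      HasDerivAt (fun θ => F (n + 1) (bilin x a b e θ η) * (b + θ * e))
        (F (n + 2) (bilin x a b e θ η) * (a + η * e) * (b + θ * e)
          + F (n + 1) (bilin x a b e θ η) * e) θ := fun x a b e η θ _ =>
    (hasDerivAt_bilin_left (hF.deriv (n + 1) (by omega)) x a b e θ η).mul
      (hasDerivAt_affine b e θ)
  have d2 : ∀ (x a b e η : ℝ), ∀ θ ∈ Set.Icc (0 : ℝ) 1,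
      HasDerivAt (fun θ => F (n + 2) (bilin x a b e θ η) * (a + η * e) * (b + θ * e)
          + F (n + 1) (bilin x a b e θ η) * e)
        (F (n + 3) (bilin x a b e θ η) * (a + η * e) * (a + η * e) * (b + θ * e)
          + 2 * (F (n + 2) (bilin x a b e θ η) * (a + η * e) * e)) θ := by
    intro x a b e η θ _
    have h1 := ((hasDerivAt_bilin_left (hF.deriv (n + 2) (by omega)) x a b e θ η).mul_const
      (a + η * e)).mul (hasDerivAt_affine b e θ)
    have h2 := (hasDerivAt_bilin_left (hF.deriv (n + 1) (by omega)) x a b e θ η).mul_const e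
    exact (h1.add h2).congr_deriv (by ring)
  have outer : ∀ (x a b e : ℝ), ∀ η ∈ Set.Icc (0 : ℝ) 1,
      HasDerivAt (fun η => F n (bilin x a b e 1 η) - F n (bilin x a b e 0 η)
          - F (n + 1) (bilin x a b e 0 η) * (a + η * e))
        (F (n + 1) (bilin x a b e 1 η) * (b + 1 * e) - F (n + 1) (bilin x a b e 0 η) * (b + 0 * e)
          - 1 * (F (n + 2) (bilin x a b e 0 η) * (a + η * e) * (b + 0 * e)
            + F (n + 1) (bilin x a b e 0 η) * e)) η := by
    intro x a b e η _
    have h1 := (hasDerivAt_bilin_right (hF.deriv n (by omega)) x a b e 1 η).sub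
      (hasDerivAt_bilin_right (hF.deriv n (by omega)) x a b e 0 η)
    have h2 := (hasDerivAt_bilin_right (hF.deriv (n + 1) (by omega)) x a b e 0 η).mul
      (hasDerivAt_affine a e η)
    exact (h1.sub h2).congr_deriv (by ring)
  have := Bd.of_deriv (outer x a b e) (outer y c d f) (fun η hη =>
    Bd.of_deriv_two (d1 x a b e η) (d2 x a b e η) (d1 y c d f η) (d2 y c d f η) (fun θ hθ =>
      ((((hF.bd (n + 3) (by omega) (by omega) _ _ (h.reg hθ hη)).mul (h.bdl hη)).mul
        (h.bdl hη)).mul (h.bdr hθ)).add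
        ((((hF.bd (n + 2) (by omega) (by omega) _ _ (h.reg hθ hη)).mul (h.bdl hη)).mul
          h.he).const_mul 2))
      (b := 1) (by simp)) (b := 1) (by simp)
  simp only [bilin] at this
  convert this using 1
  · simp only [one_mul, zero_mul, mul_one, mul_zero, add_zero]
  · simp only [one_mul, zero_mul, mul_one, mul_zero, add_zero]
  · rw [abs_two]; ring

/-- The rectangular increment of `F n`, minus all Taylor terms of order at most one in one of the
two directions, is of second order in both directions. -/
theorem DerivBd.rect_taylor (hF : DerivBd F M ε K) {n : ℕ} (hn : n ≤ 3)
    (h : Corners M ε x a b e y c d f A B E) :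
    Bd ε (F n (x + a + b + e) - F n (x + a) - F n (x + b) + F n x - F (n + 1) x * e
        + F (n + 2) x * (a * b) - (F (n + 1) (x + b) - F (n + 1) x) * (a + e)
        - (F (n + 1) (x + a) - F (n + 1) x) * (b + e))
      (F n (y + c + d + f) - F n (y + c) - F n (y + d) + F n y - F (n + 1) y * f
        + F (n + 2) y * (c * d) - (F (n + 1) (y + d) - F (n + 1) y) * (c + f)
        - (F (n + 1) (y + c) - F (n + 1) y) * (d + f))
      (16 * (K * A ^ 2 * B ^ 2) + 32 * (K * A * B * E) + 8 * (K * E ^ 2)) := by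
  have d1 : ∀ (x a b e η : ℝ), ∀ θ ∈ Set.Icc (0 : ℝ) 1,
      HasDerivAt (fun θ => F (n + 2) (bilin x a b e θ η) * (b + θ * e) * (b + θ * e))
        (F (n + 3) (bilin x a b e θ η) * (a + η * e) * (b + θ * e) * (b + θ * e)
          + 2 * (F (n + 2) (bilin x a b e θ η) * (b + θ * e) * e)) θ := by
    intro x a b e η θ _
    have h1 := ((hasDerivAt_bilin_left (hF.deriv (n + 2) (by omega)) x a b e θ η).fun_mul
      (hasDerivAt_affine b e θ)).fun_mul (hasDerivAt_affine b e θ)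
    exact h1.congr_deriv (by ring)
  have d2 : ∀ (x a b e η : ℝ), ∀ θ ∈ Set.Icc (0 : ℝ) 1,
      HasDerivAt (fun θ => F (n + 3) (bilin x a b e θ η) * (a + η * e) * (b + θ * e) * (b + θ * e)
          + 2 * (F (n + 2) (bilin x a b e θ η) * (b + θ * e) * e))
        (F (n + 4) (bilin x a b e θ η) * (a + η * e) * (a + η * e) * (b + θ * e) * (b + θ * e)
          + 4 * (F (n + 3) (bilin x a b e θ η) * (a + η * e) * (b + θ * e) * e)
          + 2 * (F (n + 2) (bilin x a b e θ η) * e * e)) θ := by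
    intro x a b e η θ _
    have h1 := (((hasDerivAt_bilin_left (hF.deriv (n + 3) (by omega)) x a b e θ η).mul_const
      (a + η * e)).fun_mul (hasDerivAt_affine b e θ)).fun_mul (hasDerivAt_affine b e θ)
    have h2 := (((hasDerivAt_bilin_left (hF.deriv (n + 2) (by omega)) x a b e θ η).mul
      (hasDerivAt_affine b e θ)).mul_const e).const_mul 2
    exact (h1.add h2).congr_deriv (by ring)
  have o1 : ∀ (x a b e : ℝ), ∀ η ∈ Set.Icc (0 : ℝ) 1,
      HasDerivAt (fun η => F n (bilin x a b e 1 η) - F n (bilin x a b e 0 η)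
          - F (n + 1) (bilin x a b e 0 η) * (a + η * e))
        (F (n + 1) (bilin x a b e 1 η) * (b + 1 * e) - F (n + 1) (bilin x a b e 0 η) * (b + 0 * e)
          - (F (n + 2) (bilin x a b e 0 η) * (b + 0 * e) * (a + η * e)
            + F (n + 1) (bilin x a b e 0 η) * e)) η := by
    intro x a b e η _
    have h1 := (hasDerivAt_bilin_right (hF.deriv n (by omega)) x a b e 1 η).sub
      (hasDerivAt_bilin_right (hF.deriv n (by omega)) x a b e 0 η)
    have h2 := (hasDerivAt_bilin_right (hF.deriv (n + 1) (by omega)) x a b e 0 η).mul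
      (hasDerivAt_affine a e η)
    exact h1.sub h2
  have o2 : ∀ (x a b e : ℝ), ∀ η ∈ Set.Icc (0 : ℝ) 1,
      HasDerivAt (fun η => F (n + 1) (bilin x a b e 1 η) * (b + 1 * e)
          - F (n + 1) (bilin x a b e 0 η) * (b + 0 * e)
          - (F (n + 2) (bilin x a b e 0 η) * (b + 0 * e) * (a + η * e)
            + F (n + 1) (bilin x a b e 0 η) * e))
        (F (n + 2) (bilin x a b e 1 η) * (b + 1 * e) * (b + 1 * e)
          - F (n + 2) (bilin x a b e 0 η) * (b + 0 * e) * (b + 0 * e)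
          - 1 * (F (n + 3) (bilin x a b e 0 η) * (a + η * e) * (b + 0 * e) * (b + 0 * e)
          + 2 * (F (n + 2) (bilin x a b e 0 η) * (b + 0 * e) * e))) η := by
    intro x a b e η _
    have h1 := ((hasDerivAt_bilin_right (hF.deriv (n + 1) (by omega)) x a b e 1 η).mul_const
      (b + 1 * e)).sub
      ((hasDerivAt_bilin_right (hF.deriv (n + 1) (by omega)) x a b e 0 η).mul_const (b + 0 * e))
    have h2 := ((hasDerivAt_bilin_right (hF.deriv (n + 2) (by omega)) x a b e 0 η).mul_const
      (b + 0 * e)).mul (hasDerivAt_affine a e η)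
    have h3 := (hasDerivAt_bilin_right (hF.deriv (n + 1) (by omega)) x a b e 0 η).mul_const e
    exact (h1.sub (h2.add h3)).congr_deriv (by ring)
  have := Bd.of_deriv_two (o1 x a b e) (o2 x a b e) (o1 y c d f) (o2 y c d f) (fun η hη =>
    Bd.of_deriv_two (d1 x a b e η) (d2 x a b e η) (d1 y c d f η) (d2 y c d f η) (fun θ hθ =>
      ((((((hF.bd (n + 4) (by omega) (by omega) _ _ (h.reg hθ hη)).mul (h.bdl hη)).mul
        (h.bdl hη)).mul (h.bdr hθ)).mul (h.bdr hθ)).add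
        (((((hF.bd (n + 3) (by omega) (by omega) _ _ (h.reg hθ hη)).mul (h.bdl hη)).mul
          (h.bdr hθ)).mul h.he).const_mul 4)).add
        ((((hF.bd (n + 2) (by omega) (by omega) _ _ (h.reg hθ hη)).mul h.he).mul
          h.he).const_mul 2))
      (b := 1) (by simp)) (b := 1) (by simp)
  simp only [bilin] at this
  convert this using 1
  · simp only [one_mul, zero_mul, mul_one, mul_zero, add_zero]
    rw [show x + a + b + e = x + a + (b + e) by ring]
    ring_nf
  · simp only [one_mul, zero_mul, mul_one, mul_zero, add_zero]
    rw [show y + c + d + f = y + c + (d + f) by ring]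
    ring_nf
  · rw [abs_two, abs_of_pos (by norm_num : (0 : ℝ) < 4)]; ring

end Taylor

/-! ### Reading off bounds from the norm of a rough sheet -/

/-- The Hölder exponent of a direction. -/
def expo (α β : ℝ) : Dir → ℝ
  | .one => α
  | .two => β

theorem Dir.op_op (a : Dir) : a.op.op = a := by cases a <;> rfl

theorem expo_op_op (a : Dir) : expo α β a.op.op = expo α β a := by rw [Dir.op_op]

theorem le_sum_letter (f : Letter → ℝ≥0∞) (μ : Letter) : f μ ≤ f .x + f .ω := by
  cases μ
  · exact le_add_right le_rfl
  · exact le_add_left le_rfl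

theorem le_sum_letter_letter (f : Letter → Letter → ℝ≥0∞) (μ ν : Letter) :
    f μ ν ≤ f .x .x + f .x .ω + f .ω .x + f .ω .ω := by
  cases μ <;> cases ν
  · exact le_add_right (le_add_right (le_add_right le_rfl))
  · exact le_add_right (le_add_right (le_add_left le_rfl))
  · exact le_add_right (le_add_left le_rfl)
  · exact le_add_left le_rfl

section NormBounds

variable (Z : SheetData T)

theorem dirNorm_le_norm (a : Dir) :
    Z.dirNorm (expo α β a) (expo α β a.op) a ≤ Z.norm α β := by
  cases a
  · exact le_add_right (le_add_left le_rfl)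
  · exact le_add_left le_rfl

theorem hol22_A_le (μ : Letter) : hol22 α β (Z.A μ) ≤ Z.norm α β :=
  (le_sum_letter (fun μ => hol22 α β (Z.A μ)) μ).trans
    (le_add_right (le_add_right (le_add_right (le_add_left le_rfl))))

theorem hol22_C_le (μ ν : Letter) : hol22 (2 * α) (2 * β) (Z.C μ ν) ≤ Z.norm α β :=
  (le_sum_letter_letter (fun μ ν => hol22 (2 * α) (2 * β) (Z.C μ ν)) μ ν).trans
    (le_add_right (le_add_right (le_add_left le_rfl)))

theorem sheetNorm_x_le : sheetNorm α β Z.x ≤ Z.norm α β :=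
  le_add_right (le_add_right (le_add_right (le_add_right le_rfl)))

theorem supNorm_x_le : supNorm Z.x ≤ Z.norm α β :=
  le_trans (le_add_left le_rfl) (sheetNorm_x_le Z)

theorem hol22_B_le (a : Dir) (μ : Letter) :
    hol22 (2 * expo α β a) (expo α β a.op) (Z.B a μ) ≤ Z.norm α β := by
  refine ((le_sum_letter (fun μ => hol22 (2 * expo α β a) (expo α β a.op) (Z.B a μ)) μ).trans
    ?_).trans (dirNorm_le_norm Z a)
  unfold SheetData.dirNorm
  iterate 14 refine le_add_right ?_
  exact le_rfl

theorem hol42_D_le (a : Dir) (μ ν : Letter) :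
    hol42 (expo α β a) (expo α β a) (2 * expo α β a.op) (Z.D a μ ν) ≤ Z.norm α β := by
  refine ((le_sum_letter_letter (fun μ ν => hol42 (expo α β a) (expo α β a) (2 * expo α β a.op)
    (Z.D a μ ν)) μ ν).trans ?_).trans (dirNorm_le_norm Z a)
  unfold SheetData.dirNorm
  iterate 13 refine le_add_right ?_
  exact le_add_left le_rfl

theorem hol42_E_le (a : Dir) (μ ν : Letter) :
    hol42 (2 * expo α β a) (expo α β a) (2 * expo α β a.op) (Z.E a μ ν) ≤ Z.norm α β := by
  refine ((le_sum_letter_letter (fun μ ν => hol42 (2 * expo α β a) (expo α β a)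
    (2 * expo α β a.op) (Z.E a μ ν)) μ ν).trans ?_).trans (dirNorm_le_norm Z a)
  unfold SheetData.dirNorm
  iterate 12 refine le_add_right ?_
  exact le_add_left le_rfl

theorem hol43_F_le (a : Dir) (μ ν : Letter) :
    hol43 (2 * expo α β a) (expo α β a) (3 * expo α β a.op) (Z.F a μ ν) ≤ Z.norm α β := by
  refine ((le_sum_letter_letter (fun μ ν => hol43 (2 * expo α β a) (expo α β a)
    (3 * expo α β a.op) (Z.F a μ ν)) μ ν).trans ?_).trans (dirNorm_le_norm Z a)
  unfold SheetData.dirNorm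
  iterate 11 refine le_add_right ?_
  exact le_add_left le_rfl

theorem hol22_I_le (a : Dir) :
    hol22 (2 * expo α β a) (expo α β a.op) (Z.I a) ≤ Z.norm α β := by
  refine le_trans ?_ (dirNorm_le_norm Z a)
  unfold SheetData.dirNorm
  iterate 8 refine le_add_right ?_
  exact le_add_left le_rfl

theorem hol22_J_le (a : Dir) :
    hol22 (2 * expo α β a) (2 * expo α β a.op) (Z.J a) ≤ Z.norm α β := by
  refine le_trans ?_ (dirNorm_le_norm Z a)
  unfold SheetData.dirNorm
  iterate 7 refine le_add_right ?_
  exact le_add_left le_rfl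

theorem hol22_Q_le (a : Dir) :
    hol22 (2 * expo α β a) (expo α β a.op) (Z.Q a) ≤ Z.norm α β := by
  refine le_trans ?_ (dirNorm_le_norm Z a)
  unfold SheetData.dirNorm
  exact le_add_left le_rfl

end NormBounds

theorem ratio_le_hol22 (p q : ℝ) (g : Inc22 T) (a b c d : Tm T) :
    ENNReal.ofReal |g a b c d| / ENNReal.ofReal (dist a b ^ p * dist c d ^ q) ≤ hol22 p q g :=
  le_iSup_of_le a (le_iSup_of_le b (le_iSup_of_le c (le_iSup_of_le d le_rfl)))

theorem ratio_le_hol21 (p : ℝ) (g : Inc21 T) (a b c : Tm T) :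
    ENNReal.ofReal |g a b c| / ENNReal.ofReal (dist a b ^ p) ≤ hol21 p g :=
  le_iSup_of_le a (le_iSup_of_le b (le_iSup_of_le c le_rfl))

theorem ratio_le_hol42 (p₁ p₂ q : ℝ) (g : Inc42 T) (a₁ a₂ a₃ a₄ c d : Tm T) :
    ENNReal.ofReal |g a₁ a₂ a₃ a₄ c d|
      / ENNReal.ofReal (dist a₁ a₂ ^ p₁ * dist a₃ a₄ ^ p₂ * dist c d ^ q) ≤ hol42 p₁ p₂ q g :=
  le_iSup_of_le a₁ (le_iSup_of_le a₂ (le_iSup_of_le a₃ (le_iSup_of_le a₄ (le_iSup_of_le c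
    (le_iSup_of_le d le_rfl)))))

theorem ratio_le_hol43w (p₁ p₂ ρ σ : ℝ) (g : Inc43 T) (a₁ a₂ a₃ a₄ c d e : Tm T) :
    ENNReal.ofReal |g a₁ a₂ a₃ a₄ c d e| / ENNReal.ofReal
      (dist a₁ a₂ ^ p₁ * dist a₃ a₄ ^ p₂ * (dist c d ^ ρ * dist d e ^ σ)) ≤ hol43w p₁ p₂ ρ σ g :=
  le_iSup_of_le a₁ (le_iSup_of_le a₂ (le_iSup_of_le a₃ (le_iSup_of_le a₄ (le_iSup_of_le c
    (le_iSup_of_le d (le_iSup_of_le e le_rfl))))))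

theorem rpow_mul_rpow_le_add_rpow {u v ρ z : ℝ} (hu : 0 ≤ u) (hv : 0 ≤ v) (hρ : 0 < ρ)
    (hz : ρ < z) : u ^ ρ * v ^ (z - ρ) ≤ (u + v) ^ z := by
  rcases hu.eq_or_lt with rfl | hu'
  · rw [Real.zero_rpow hρ.ne', zero_mul]; exact Real.rpow_nonneg (by linarith) _
  · calc u ^ ρ * v ^ (z - ρ) ≤ (u + v) ^ ρ * (u + v) ^ (z - ρ) := by
          gcongr
          · linarith
          · linarith
      _ = (u + v) ^ z := by
          rw [← Real.rpow_add (by linarith)]; congr 1; ring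

/-- A function in `(𝒞₂^{p₁} ⊗ 𝒞₂^{p₂})(𝒞₃^z)` is bounded by the `z`-th power of the total length of
the two intervals of the second direction, whatever the exponents in its decompositions. -/
theorem ratio_le_hol43 (p₁ p₂ z : ℝ) (g : Inc43 T) (a₁ a₂ a₃ a₄ c d e : Tm T) :
    ENNReal.ofReal |g a₁ a₂ a₃ a₄ c d e| / ENNReal.ofReal
      (dist a₁ a₂ ^ p₁ * dist a₃ a₄ ^ p₂ * (dist c d + dist d e) ^ z) ≤ hol43 p₁ p₂ z g := by
  refine le_iInf fun h => le_iInf fun ρ => le_iInf fun hsum => ?_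
  by_cases htop : ∑' i, hol43w p₁ p₂ (ρ i) (z - ρ i) (h i) = ⊤
  · rw [htop]; exact le_top
  have hne := ENNReal.ne_top_of_tsum_ne_top htop
  refine ENNReal.div_le_of_le_mul ?_
  rw [← (hsum a₁ a₂ a₃ a₄ c d e).tsum_eq, ← ENNReal.tsum_mul_right]
  calc ENNReal.ofReal |∑' i, h i a₁ a₂ a₃ a₄ c d e|
      = ‖∑' i, h i a₁ a₂ a₃ a₄ c d e‖ₑ := by rw [← Real.enorm_eq_ofReal_abs]
    _ ≤ ∑' i, ‖h i a₁ a₂ a₃ a₄ c d e‖ₑ := enorm_tsum_le_tsum_enorm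
    _ ≤ _ := by
      refine ENNReal.tsum_le_tsum fun i => ?_
      rw [Real.enorm_eq_ofReal_abs]
      have h1 := ratio_le_hol43w p₁ p₂ (ρ i) (z - ρ i) (h i) a₁ a₂ a₃ a₄ c d e
      have h2 : dist a₁ a₂ ^ p₁ * dist a₃ a₄ ^ p₂ * (dist c d ^ (ρ i : ℝ) * dist d e ^ (z - ρ i))
          ≤ dist a₁ a₂ ^ p₁ * dist a₃ a₄ ^ p₂ * (dist c d + dist d e) ^ z := by
        gcongr
        exact rpow_mul_rpow_le_add_rpow dist_nonneg dist_nonneg (ρ i).2.1 (ρ i).2.2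
      rw [ENNReal.div_le_iff_le_mul (Or.inr (hne i)) (Or.inl ENNReal.ofReal_ne_top)] at h1
      exact h1.trans (mul_le_mul_right (ENNReal.ofReal_le_ofReal h2) _)

theorem abs_le_of_ratio_le {u w k : ℝ} (hk : 0 ≤ k) (hw : 0 ≤ w)
    (h : ENNReal.ofReal |u| / ENNReal.ofReal w ≤ ENNReal.ofReal k) : |u| ≤ k * w := by
  rcases hw.eq_or_lt with rfl | hw'
  · rw [ENNReal.ofReal_zero] at h
    by_contra hcon
    have hu : 0 < |u| := by simpa using hcon
    rw [ENNReal.div_zero (by simpa using hu)] at h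
    exact absurd h (by simp)
  · rw [ENNReal.div_le_iff (by simpa using hw') (by simp), ← ENNReal.ofReal_mul hk] at h
    exact (ENNReal.ofReal_le_ofReal_iff (by positivity)).1 h

/-! ### Uniform bounds for pairs of rough sheets -/

/-- Two rough sheets at distance at most `ε` with values in `[-rad, rad]`, and a function. All
estimates are uniform over this type. -/
structure Ctx (T α β : ℝ) where
  X : SheetData T
  Y : SheetData T
  hX : X.IsRoughSheet α β
  hY : Y.IsRoughSheet α β
  φ : ℝ → ℝ
  hφ : ContDiff ℝ 8 φ
  ε : ℝ
  hε : 0 < ε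
  hXY : (X - Y).norm α β ≤ ENNReal.ofReal ε
  rad : ℝ≥0∞
  rad_ne_top : rad ≠ ⊤
  supNorm_X_le : supNorm X.x ≤ rad
  supNorm_Y_le : supNorm Y.x ≤ rad

/-- `Z` is one of the two rough sheets. -/
def Ctx.Has (c : Ctx T α β) (Z : SheetData T) : Prop := Z = c.X ∨ Z = c.Y

theorem Ctx.Has.rough {c : Ctx T α β} {Z : SheetData T} (h : c.Has Z) : Z.IsRoughSheet α β := by
  rcases h with rfl | rfl
  · exact c.hX
  · exact c.hY

theorem Ctx.has_X (c : Ctx T α β) : c.Has c.X := Or.inl rfl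

theorem Ctx.has_Y (c : Ctx T α β) : c.Has c.Y := Or.inr rfl

/-- One plus the sum of the norms of the two rough sheets. -/
noncomputable def Ctx.Θ (c : Ctx T α β) : ℝ := 1 + (c.X.norm α β + c.Y.norm α β).toReal

theorem Ctx.one_le_Θ (c : Ctx T α β) : 1 ≤ c.Θ := by
  unfold Ctx.Θ; linarith [ENNReal.toReal_nonneg (a := c.X.norm α β + c.Y.norm α β)]

theorem Ctx.norm_X_le (c : Ctx T α β) : c.X.norm α β ≤ ENNReal.ofReal c.Θ := by
  have h1 := c.hX.norm_lt_top
  have h2 := c.hY.norm_lt_top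
  refine (le_add_right le_rfl : _ ≤ c.X.norm α β + c.Y.norm α β).trans ?_
  rw [← ENNReal.ofReal_toReal (ENNReal.add_ne_top.2 ⟨h1.ne, h2.ne⟩)]
  exact ENNReal.ofReal_le_ofReal (by unfold Ctx.Θ; linarith)

theorem Ctx.norm_Y_le (c : Ctx T α β) : c.Y.norm α β ≤ ENNReal.ofReal c.Θ := by
  have h1 := c.hX.norm_lt_top
  have h2 := c.hY.norm_lt_top
  refine (le_add_left le_rfl : _ ≤ c.X.norm α β + c.Y.norm α β).trans ?_
  rw [← ENNReal.ofReal_toReal (ENNReal.add_ne_top.2 ⟨h1.ne, h2.ne⟩)]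
  exact ENNReal.ofReal_le_ofReal (by unfold Ctx.Θ; linarith)

/-- A quantity that depends linearly on the rough sheet, and whose weighted size is part of the
norm, is bounded as a pair. -/
theorem Ctx.bd_of_ratio_le (c : Ctx T α β) {u : SheetData T → ℝ} {w : ℝ} (hw : 0 ≤ w)
    (hsub : u (c.X - c.Y) = u c.X - u c.Y)
    (hle : ∀ Z : SheetData T, ENNReal.ofReal |u Z| / ENNReal.ofReal w ≤ Z.norm α β) :
    Bd c.ε (u c.X) (u c.Y) (c.Θ * w) := by
  have hΘ := c.one_le_Θ
  refine ⟨abs_le_of_ratio_le (by linarith) hw ((hle _).trans c.norm_X_le),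
    abs_le_of_ratio_le (by linarith) hw ((hle _).trans c.norm_Y_le), ?_⟩
  rw [← hsub]
  refine (abs_le_of_ratio_le c.hε.le hw ((hle _).trans c.hXY)).trans ?_
  exact mul_le_mul_of_nonneg_left (le_mul_of_one_le_left hw hΘ) c.hε.le

/-- A point of the space on which the estimates are made: two rough sheets, three points in a
direction `a`, three points in the other direction, and two further points in direction `a`. -/
structure Idx (T α β : ℝ) extends Ctx T α β where
  p1 : Tm T
  p2 : Tm T
  p3 : Tm T
  q1 : Tm T
  q2 : Tm T
  q3 : Tm T
  r1 : Tm T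
  r2 : Tm T

namespace Idx

/-- The length of the chain `p1, p2, p3`. -/
noncomputable def lp (I : Idx T α β) : ℝ := dist I.p1 I.p2 + dist I.p2 I.p3

/-- The length of the chain `q1, q2, q3`. -/
noncomputable def lq (I : Idx T α β) : ℝ := dist I.q1 I.q2 + dist I.q2 I.q3

/-- The length of the interval between `r1` and `r2`. -/
noncomputable def lr (I : Idx T α β) : ℝ := dist I.r1 I.r2

theorem lp_nonneg (I : Idx T α β) : 0 ≤ I.lp := add_nonneg dist_nonneg dist_nonneg

theorem lq_nonneg (I : Idx T α β) : 0 ≤ I.lq := add_nonneg dist_nonneg dist_nonneg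

theorem lr_nonneg (I : Idx T α β) : 0 ≤ I.lr := dist_nonneg

theorem dist_le_abs (a b : Tm T) : dist a b ≤ |T| := by
  rw [Subtype.dist_eq, Real.dist_eq]
  have ha := a.2; have hb := b.2
  exact (abs_sub_le_iff.2 ⟨by linarith [ha.2, hb.1], by linarith [hb.2, ha.1]⟩).trans
    (le_abs_self T)

theorem lp_le (I : Idx T α β) : I.lp ≤ 2 * |T| := by
  unfold lp; linarith [dist_le_abs I.p1 I.p2, dist_le_abs I.p2 I.p3]

theorem lq_le (I : Idx T α β) : I.lq ≤ 2 * |T| := by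
  unfold lq; linarith [dist_le_abs I.q1 I.q2, dist_le_abs I.q2 I.q3]

theorem lr_le (I : Idx T α β) : I.lr ≤ 2 * |T| := by
  unfold lr; linarith [dist_le_abs I.r1 I.r2, abs_nonneg T]

theorem dp12 (I : Idx T α β) : dist I.p1 I.p2 ≤ I.lp := le_add_of_nonneg_right dist_nonneg

theorem dp23 (I : Idx T α β) : dist I.p2 I.p3 ≤ I.lp := le_add_of_nonneg_left dist_nonneg

theorem dq12 (I : Idx T α β) : dist I.q1 I.q2 ≤ I.lq := le_add_of_nonneg_right dist_nonneg

theorem dq23 (I : Idx T α β) : dist I.q2 I.q3 ≤ I.lq := le_add_of_nonneg_left dist_nonneg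

/-- The weight `|p|^γ |q|^γ' |r|^γ` to the powers `i, j, k`, where `γ` is the exponent of direction
`a` and `γ'` that of the other direction. -/
noncomputable def wt (a : Dir) (i j k : ℕ) (I : Idx T α β) : ℝ :=
  (I.lp ^ expo α β a) ^ i * (I.lq ^ expo α β a.op) ^ j * (I.lr ^ expo α β a) ^ k

theorem wt_nonneg (a : Dir) (i j k : ℕ) (I : Idx T α β) : 0 ≤ I.wt a i j k := by
  have := I.lp_nonneg; have := I.lq_nonneg; have := I.lr_nonneg
  unfold wt; positivity

theorem wt_mul (a : Dir) (i j k i' j' k' : ℕ) (I : Idx T α β) :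
    I.wt a i j k * I.wt a i' j' k' = I.wt a (i + i') (j + j') (k + k') := by
  unfold wt; ring

/-- Replace the points `p`. -/
def setP (I : Idx T α β) (p p' p'' : Tm T) : Idx T α β := { I with p1 := p, p2 := p', p3 := p'' }

/-- Exchange the two directions. -/
def swap (I : Idx T α β) : Idx T α β :=
  { I with p1 := I.q1, p2 := I.q2, p3 := I.q3, q1 := I.p1, q2 := I.p2, q3 := I.p3 }

end Idx

instance expo_fact [hα : Fact (1 / 3 < α)] [hβ : Fact (1 / 3 < β)] (a : Dir) :
    Fact (1 / 3 < expo α β a) := by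
  cases a
  · exact hα
  · exact hβ

theorem pow_le_const_mul_pow {l L γ : ℝ} (hl : 0 ≤ l) (hL : l ≤ L) (hγ : 0 ≤ γ) {i i' : ℕ}
    (hi : i' ≤ i) : (l ^ γ) ^ i ≤ (L ^ γ) ^ (i - i') * (l ^ γ) ^ i' := by
  obtain ⟨m, rfl⟩ := Nat.exists_eq_add_of_le hi
  rw [Nat.add_sub_cancel_left, pow_add, mul_comm]
  gcongr

/-- A family of functions of the rough sheet is of order `i` in the points `p`, `j` in the points
`q`, and `k` in the points `r`, with constants of the form `κ` times a polynomial in the norms of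
the rough sheets. The bounds are in the Lipschitz norm of pairs. -/
def Dom (a : Dir) (κ : Ctx T α β → ℝ≥0) (i j k : ℕ) (f : Idx T α β → SheetData T → ℝ) : Prop :=
  ∃ (c : ℝ) (n : ℕ), 0 ≤ c ∧ ∀ I : Idx T α β,
    Bd I.ε (f I I.X) (f I I.Y) (c * I.Θ ^ n * κ I.toCtx * I.wt a i j k)

/-- The factor `1`. -/
def one (_ : Ctx T α β) : ℝ≥0 := 1

namespace Dom

variable {a : Dir} {κ : Ctx T α β → ℝ≥0} {i j k i' j' k' : ℕ} {f g : Idx T α β → SheetData T → ℝ}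

theorem congr (hf : Dom a κ i j k f) (h : ∀ (I : Idx T α β) (Z), I.Has Z → g I Z = f I Z) :
    Dom a κ i j k g := by
  obtain ⟨c, n, hc, hf⟩ := hf
  refine ⟨c, n, hc, fun I => ?_⟩
  rw [h I _ I.has_X, h I _ I.has_Y]
  exact hf I

/-- The constants of a bound may be enlarged. -/
theorem of_le {c c' : ℝ} {n n' : ℕ} (hc : 0 ≤ c) (hcc : c ≤ c') (hn : n ≤ n') (I : Idx T α β)
    {w : ℝ} (hw : 0 ≤ w) : c * I.Θ ^ n * κ I.toCtx * w ≤ c' * I.Θ ^ n' * κ I.toCtx * w := by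
  have := I.one_le_Θ
  have hc' := hc.trans hcc
  gcongr

theorem add (hf : Dom a κ i j k f) (hg : Dom a κ i j k g) :
    Dom a κ i j k (fun I Z => f I Z + g I Z) := by
  obtain ⟨c, n, hc, hf⟩ := hf
  obtain ⟨c', n', hc', hg⟩ := hg
  refine ⟨c + c', max n n', by positivity, fun I => ?_⟩
  refine ((hf I).add (hg I)).mono I.hε.le ?_
  have h1 := of_le (κ := κ) hc le_rfl (le_max_left n n') I (I.wt_nonneg a i j k)
  have h2 := of_le (κ := κ) hc' le_rfl (le_max_right n n') I (I.wt_nonneg a i j k)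
  linarith

theorem neg (hf : Dom a κ i j k f) : Dom a κ i j k (fun I Z => -f I Z) := by
  obtain ⟨c, n, hc, hf⟩ := hf
  exact ⟨c, n, hc, fun I => (hf I).neg⟩

theorem sub (hf : Dom a κ i j k f) (hg : Dom a κ i j k g) :
    Dom a κ i j k (fun I Z => f I Z - g I Z) :=
  (hf.add hg.neg).congr fun _ _ _ => sub_eq_add_neg _ _

theorem const_mul (s : ℝ) (hf : Dom a κ i j k f) : Dom a κ i j k (fun I Z => s * f I Z) := by
  obtain ⟨c, n, hc, hf⟩ := hf
  refine ⟨|s| * c, n, by positivity, fun I => ?_⟩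
  convert (hf I).const_mul s using 1
  ring

theorem mono [Fact (1 / 3 < α)] [Fact (1 / 3 < β)] (hf : Dom a κ i j k f)
    (hi : i' ≤ i) (hj : j' ≤ j) (hk : k' ≤ k) : Dom a κ i' j' k' f := by
  obtain ⟨c, n, hc, hf⟩ := hf
  have ha : 0 ≤ expo α β a := by linarith [(expo_fact (α := α) (β := β) a).out]
  have ha' : 0 ≤ expo α β a.op := by linarith [(expo_fact (α := α) (β := β) a.op).out]
  refine ⟨c * (((2 * |T|) ^ expo α β a) ^ (i - i') * ((2 * |T|) ^ expo α β a.op) ^ (j - j')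
    * ((2 * |T|) ^ expo α β a) ^ (k - k')), n, by positivity, fun I => (hf I).mono I.hε.le ?_⟩
  have h0 := I.one_le_Θ
  have n1 := I.lp_nonneg
  have n2 := I.lq_nonneg
  have n3 := I.lr_nonneg
  have h1 := pow_le_const_mul_pow n1 I.lp_le ha hi
  have h2 := pow_le_const_mul_pow n2 I.lq_le ha' hj
  have h3 := pow_le_const_mul_pow n3 I.lr_le ha hk
  calc _ ≤ c * I.Θ ^ n * κ I.toCtx * ((((2 * |T|) ^ expo α β a) ^ (i - i')
        * (I.lp ^ expo α β a) ^ i') * (((2 * |T|) ^ expo α β a.op) ^ (j - j')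
        * (I.lq ^ expo α β a.op) ^ j') * (((2 * |T|) ^ expo α β a) ^ (k - k')
        * (I.lr ^ expo α β a) ^ k')) := by unfold Idx.wt; gcongr
    _ = _ := by unfold Idx.wt; ring

theorem mul_right [Fact (1 / 3 < α)] [Fact (1 / 3 < β)] {i'' j'' k'' : ℕ}
    (hf : Dom a κ i j k f) (hg : Dom a one i' j' k' g)
    (hi : i'' ≤ i + i' := by omega) (hj : j'' ≤ j + j' := by omega)
    (hk : k'' ≤ k + k' := by omega) :
    Dom a κ i'' j'' k'' (fun I Z => f I Z * g I Z) := by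
  refine Dom.mono ?_ hi hj hk
  obtain ⟨c, n, hc, hf⟩ := hf
  obtain ⟨c', n', hc', hg⟩ := hg
  refine ⟨2 * (c * c'), n + n', by positivity, fun I => ?_⟩
  convert (hf I).mul (hg I) using 1
  rw [← Idx.wt_mul]
  simp only [one, NNReal.coe_one]
  ring

/-- The points `r` may be taken among the points `p`. -/
theorem comp_fold [Fact (1 / 3 < α)] [Fact (1 / 3 < β)] (hf : Dom a κ i j k f)
    (σ : Idx T α β → Idx T α β) (hctx : ∀ I, (σ I).toCtx = I.toCtx)
    (hp : ∀ I, (σ I).lp ≤ I.lp) (hq : ∀ I, (σ I).lq ≤ I.lq) (hr : ∀ I, (σ I).lr ≤ I.lp) :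
    Dom a κ (i + k) j 0 (fun I Z => f (σ I) Z) := by
  obtain ⟨c, n, hc, hf⟩ := hf
  have ha : 0 ≤ expo α β a := by linarith [(expo_fact (α := α) (β := β) a).out]
  have ha' : 0 ≤ expo α β a.op := by linarith [(expo_fact (α := α) (β := β) a.op).out]
  refine ⟨c, n, hc, fun I => ?_⟩
  have := hf (σ I)
  rw [hctx I] at this
  refine this.mono I.hε.le ?_
  have h0 := I.one_le_Θ
  have n1 := (σ I).lp_nonneg
  have n2 := (σ I).lq_nonneg
  have n3 := (σ I).lr_nonneg
  have h1 := hp I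
  have h2 := hq I
  have h3 := hr I
  have n4 := I.lp_nonneg
  have n5 := I.lq_nonneg
  have e : I.wt a (i + k) j 0 = (I.lp ^ expo α β a) ^ i * (I.lq ^ expo α β a.op) ^ j
      * (I.lp ^ expo α β a) ^ k := by unfold Idx.wt; ring
  rw [e]
  unfold Idx.wt
  gcongr

/-- Exchange of the two directions. -/
theorem swap (hf : Dom a κ i j 0 f) : Dom a.op κ j i 0 (fun I Z => f I.swap Z) := by
  obtain ⟨c, n, hc, hf⟩ := hf
  refine ⟨c, n, hc, fun I => ?_⟩
  have e : I.wt a.op j i 0 = I.swap.wt a i j 0 := by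
    unfold Idx.wt
    rw [expo_op_op]
    simp only [pow_zero, mul_one]
    rw [mul_comm]
    rfl
  rw [e]
  exact hf I.swap

/-- The bound in the points `p` of a function `h` of three of them. -/
theorem exists_bound {h : Idx T α β → SheetData T → Tm T → Tm T → Tm T → ℝ}
    (hI : ∀ I p p' p'', h (I.setP p p' p'') = h I)
    (hh : Dom a κ 3 j k (fun I Z => h I Z I.p1 I.p2 I.p3)) :
    ∃ (c : ℝ) (n : ℕ), 0 ≤ c ∧ ∀ (I : Idx T α β) (p p' p'' : Tm T),
      Bd I.ε (h I I.X p p' p'') (h I I.Y p p' p'')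
        (c * I.Θ ^ n * κ I.toCtx * I.wt a 0 j k * (dist p p' + dist p' p'') ^ (3 * expo α β a))
      := by
  obtain ⟨c, n, hc, hh⟩ := hh
  refine ⟨c, n, hc, fun I p p' p'' => ?_⟩
  have := hh (I.setP p p' p'')
  simp only [hI] at this
  refine Bd.mono (k := c * I.Θ ^ n * κ I.toCtx * (I.setP p p' p'').wt a 3 j k) I.hε.le this
    (le_of_eq ?_)
  have e : (dist p p' + dist p' p'') ^ (3 * expo α β a)
      = ((dist p p' + dist p' p'') ^ expo α β a) ^ 3 := by
    rw [← Real.rpow_natCast, ← Real.rpow_mul (by positivity)]; congr 1; push_cast; ring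
  rw [e]
  simp only [Idx.wt, Idx.setP, Idx.lp, Idx.lq, Idx.lr, pow_zero]
  ring

variable [Fact (1 / 3 < α)] [Fact (1 / 3 < β)]

theorem one_lt_three_mul_expo (a : Dir) : 1 < 3 * expo α β a := by
  linarith [(expo_fact (α := α) (β := β) a).out]

/-- A function of order three in the points `p` is Hölder of order larger than one. -/
theorem isSuperHolder {r : Idx T α β → SheetData T → Tm T → Tm T → ℝ}
    (hI : ∀ I p p' p'', r (I.setP p p' p'') = r I)
    (hr : Dom a κ 3 j k (fun I Z => r I Z I.p1 I.p2)) (I : Idx T α β) (Z : SheetData T)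
    (hZ : I.Has Z) : IsSuperHolder (r I Z) := by
  obtain ⟨c, n, hc, hr⟩ := exists_bound (h := fun I Z p p' _ => r I Z p p')
    (fun I p p' p'' => by rw [hI]) hr
  refine ⟨3 * expo α β a, c * I.Θ ^ n * κ I.toCtx * I.wt a 0 j k, one_lt_three_mul_expo a,
    fun p p' => ?_⟩
  have := hr I p p' p'
  rw [dist_self, add_zero] at this
  rcases hZ with rfl | rfl
  · exact this.1
  · exact this.2.1

/-- The bound on the coboundary of a Hölder function of order larger than one passes to the
function itself. -/
theorem of_cob {r : Idx T α β → SheetData T → Tm T → Tm T → ℝ}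
    {h : Idx T α β → SheetData T → Tm T → Tm T → Tm T → ℝ}
    (hI : ∀ I p p' p'', h (I.setP p p' p'') = h I)
    (hS : ∀ (I : Idx T α β) Z, I.Has Z → IsSuperHolder (r I Z))
    (hcob : ∀ (I : Idx T α β) Z, I.Has Z → ∀ p p' p'', cob (r I Z) p p' p'' = h I Z p p' p'')
    (hh : Dom a κ 3 j k (fun I Z => h I Z I.p1 I.p2 I.p3)) :
    Dom a κ 3 j k (fun I Z => r I Z I.p1 I.p2) := by
  obtain ⟨c, n, hc, hh⟩ := exists_bound hI hh
  have hμ := one_lt_three_mul_expo (α := α) (β := β) a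
  have hpos := sewConst_pos hμ
  refine ⟨c * sewConst (3 * expo α β a), n, by positivity, fun I => ?_⟩
  have hΘ := I.one_le_Θ
  have hw := I.wt_nonneg a 0 j k
  have key : Bd I.ε (r I I.X I.p1 I.p2) (r I I.Y I.p1 I.p2)
      (c * I.Θ ^ n * κ I.toCtx * I.wt a 0 j k * sewConst (3 * expo α β a)
        * dist I.p1 I.p2 ^ (3 * expo α β a)) := by
    refine ⟨?_, ?_, ?_⟩
    · exact (hS I _ I.has_X).le_of_cob_le hμ
        (fun p p' p'' => by rw [hcob I _ I.has_X]; exact (hh I p p' p'').1) _ _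
    · exact (hS I _ I.has_Y).le_of_cob_le hμ
        (fun p p' p'' => by rw [hcob I _ I.has_Y]; exact (hh I p p' p'').2.1) _ _
    · have := ((hS I _ I.has_X).sub (hS I _ I.has_Y)).le_of_cob_le
        (k := I.ε * (c * I.Θ ^ n * κ I.toCtx * I.wt a 0 j k)) hμ
        (fun p p' p'' => by
          rw [cob_sub, hcob I _ I.has_X, hcob I _ I.has_Y, mul_assoc]
          exact (hh I p p' p'').2.2) I.p1 I.p2
      refine this.trans (le_of_eq ?_)
      ring
  refine key.mono I.hε.le ?_
  have e : I.wt a 3 j k = I.lp ^ (3 * expo α β a) * I.wt a 0 j k := by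
    have : I.lp ^ (3 * expo α β a) = (I.lp ^ expo α β a) ^ 3 := by
      rw [← Real.rpow_natCast, ← Real.rpow_mul I.lp_nonneg]; congr 1; push_cast; ring
    rw [this]; unfold Idx.wt; ring
  have hd : dist I.p1 I.p2 ^ (3 * expo α β a) ≤ I.lp ^ (3 * expo α β a) :=
    Real.rpow_le_rpow dist_nonneg I.dp12 (by linarith)
  rw [e]
  calc _ ≤ c * I.Θ ^ n * κ I.toCtx * I.wt a 0 j k * sewConst (3 * expo α β a)
        * I.lp ^ (3 * expo α β a) := by gcongr
    _ = _ := by ring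

/-- A closed family of order three can be sewn. -/
theorem isSewing {h : Idx T α β → SheetData T → Tm T → Tm T → Tm T → ℝ}
    (hI : ∀ I p p' p'', h (I.setP p p' p'') = h I)
    (hcl : ∀ (I : Idx T α β) Z, I.Has Z → IsClosedInc (h I Z))
    (hh : Dom a κ 3 j k (fun I Z => h I Z I.p1 I.p2 I.p3)) (I : Idx T α β) (Z : SheetData T)
    (hZ : I.Has Z) : IsSewing (h I Z) (sew (h I Z)) := by
  obtain ⟨c, n, hc, hh⟩ := exists_bound hI hh
  refine isSewing_sew (hcl I Z hZ) (one_lt_three_mul_expo (α := α) (β := β) a)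
    (k := c * I.Θ ^ n * κ I.toCtx * I.wt a 0 j k) fun p p' p'' => ?_
  rcases hZ with rfl | rfl
  · exact (hh I p p' p'').1
  · exact (hh I p p' p'').2.1

/-- The sewing map preserves uniform bounds of order three. -/
theorem sew {h : Idx T α β → SheetData T → Tm T → Tm T → Tm T → ℝ}
    (hI : ∀ I p p' p'', h (I.setP p p' p'') = h I)
    (hcl : ∀ (I : Idx T α β) Z, I.Has Z → IsClosedInc (h I Z))
    (hh : Dom a κ 3 j k (fun I Z => h I Z I.p1 I.p2 I.p3)) :
    Dom a κ 3 j k (fun I Z => RoughSheets.sew (h I Z) I.p1 I.p2) :=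
  of_cob (r := fun I Z => RoughSheets.sew (h I Z)) hI
    (fun I Z hZ => (isSewing hI hcl hh I Z hZ).1)
    (fun I Z hZ => (isSewing hI hcl hh I Z hZ).2) hh

end Dom

/-! ### Orders of the components of a rough sheet -/

theorem rpow_nat_mul_eq {d : ℝ} (hd : 0 ≤ d) (γ : ℝ) (n : ℕ) : d ^ ((n : ℝ) * γ) = (d ^ γ) ^ n := by
  rw [mul_comm, Real.rpow_mul hd, Real.rpow_natCast]

theorem Idx.mul_le_wt [Fact (1 / 3 < α)] [Fact (1 / 3 < β)] (a : Dir) (i j k : ℕ) (I : Idx T α β)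
    {d d' d'' : ℝ} (h : 0 ≤ d) (h' : 0 ≤ d') (h'' : 0 ≤ d'') (hp : d ≤ I.lp) (hq : d' ≤ I.lq)
    (hr : d'' ≤ I.lr) :
    d ^ ((i : ℝ) * expo α β a) * d' ^ ((j : ℝ) * expo α β a.op) * d'' ^ ((k : ℝ) * expo α β a)
      ≤ I.wt a i j k := by
  have ha : 0 ≤ expo α β a := by linarith [(expo_fact (α := α) (β := β) a).out]
  have ha' : 0 ≤ expo α β a.op := by linarith [(expo_fact (α := α) (β := β) a.op).out]
  rw [rpow_nat_mul_eq h, rpow_nat_mul_eq h', rpow_nat_mul_eq h'']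
  have := I.lp_nonneg
  have := I.lq_nonneg
  unfold Idx.wt
  gcongr

namespace Dom

variable {s t u v : Idx T α β → Tm T} {a : Dir}

theorem of_ratio_le {i j k : ℕ} {f : Idx T α β → SheetData T → ℝ} {w : Idx T α β → ℝ}
    (hw : ∀ I, 0 ≤ w I) (hw' : ∀ I, w I ≤ I.wt a i j k)
    (hsub : ∀ I (X Y : SheetData T), f I (X - Y) = f I X - f I Y)
    (hle : ∀ I (Z : SheetData T), ENNReal.ofReal |f I Z| / ENNReal.ofReal (w I) ≤ Z.norm α β) :
    Dom a one i j k f := by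
  refine ⟨1, 1, zero_le_one, fun I => ?_⟩
  refine (I.bd_of_ratio_le (hw I) (hsub I _ _) (hle I)).mono I.hε.le ?_
  have := I.one_le_Θ
  simp only [one, NNReal.coe_one, one_mul, pow_one, mul_one]
  have := hw' I
  gcongr

theorem ratio_Ad_le (Z : SheetData T) (a : Dir) (μ : Letter) (p p' q q' : Tm T) :
    ENNReal.ofReal |Z.Ad a μ p p' q q'|
      / ENNReal.ofReal (dist p p' ^ expo α β a * dist q q' ^ expo α β a.op) ≤ Z.norm α β := by
  cases a
  · exact (ratio_le_hol22 _ _ _ p p' q q').trans (hol22_A_le Z μ)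
  · rw [mul_comm]
    exact (ratio_le_hol22 _ _ _ q q' p p').trans (hol22_A_le Z μ)

theorem ratio_Cd_le (Z : SheetData T) (a : Dir) (μ ν : Letter) (p p' q q' : Tm T) :
    ENNReal.ofReal |Z.Cd a μ ν p p' q q'| / ENNReal.ofReal (dist p p' ^ (2 * expo α β a)
      * dist q q' ^ (2 * expo α β a.op)) ≤ Z.norm α β := by
  cases a
  · exact (ratio_le_hol22 _ _ _ p p' q q').trans (hol22_C_le Z μ ν)
  · rw [mul_comm]
    exact (ratio_le_hol22 _ _ _ q q' p p').trans (hol22_C_le Z μ ν)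

section

variable [Fact (1 / 3 < α)] [Fact (1 / 3 < β)]

theorem of_hol22 {i j : ℕ} {g : SheetData T → Inc22 T}
    (hsub : ∀ X Y, g (X - Y) = g X - g Y)
    (hle : ∀ Z, hol22 (i * expo α β a) (j * expo α β a.op) (g Z) ≤ Z.norm α β)
    (hp : ∀ I, dist (s I) (t I) ≤ I.lp) (hq : ∀ I, dist (u I) (v I) ≤ I.lq) :
    Dom a one i j 0 (fun I Z => g Z (s I) (t I) (u I) (v I)) := by
  refine of_ratio_le (w := fun I => dist (s I) (t I) ^ (i * expo α β a)
    * dist (u I) (v I) ^ (j * expo α β a.op)) (fun I => by positivity) (fun I => ?_)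
    (fun I X Y => by rw [hsub]; rfl) (fun I Z => (ratio_le_hol22 _ _ _ _ _ _ _).trans (hle Z))
  have := Idx.mul_le_wt a i j 0 I (dist_nonneg) (dist_nonneg) I.lr_nonneg (hp I) (hq I) le_rfl
  simpa using this

theorem B (μ : Letter) (hp : ∀ I, dist (s I) (t I) ≤ I.lp) (hq : ∀ I, dist (u I) (v I) ≤ I.lq) :
    Dom a one 2 1 0 (fun I Z => Z.B a μ (s I) (t I) (u I) (v I)) :=
  of_hol22 (g := fun Z => Z.B a μ) (fun _ _ => rfl)
    (fun Z => by simpa using hol22_B_le Z a μ) hp hq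

theorem J (hp : ∀ I, dist (s I) (t I) ≤ I.lp) (hq : ∀ I, dist (u I) (v I) ≤ I.lq) :
    Dom a one 2 2 0 (fun I Z => Z.J a (s I) (t I) (u I) (v I)) :=
  of_hol22 (g := fun Z => Z.J a) (fun _ _ => rfl) (fun Z => by simpa using hol22_J_le Z a) hp hq

theorem Q (hp : ∀ I, dist (s I) (t I) ≤ I.lp) (hq : ∀ I, dist (u I) (v I) ≤ I.lq) :
    Dom a one 2 1 0 (fun I Z => Z.Q a (s I) (t I) (u I) (v I)) :=
  of_hol22 (g := fun Z => Z.Q a) (fun _ _ => rfl) (fun Z => by simpa using hol22_Q_le Z a) hp hq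

theorem I_op (hp : ∀ I, dist (s I) (t I) ≤ I.lp) (hq : ∀ I, dist (u I) (v I) ≤ I.lq) :
    Dom a one 1 2 0 (fun I Z => Z.I a.op (u I) (v I) (s I) (t I)) := by
  refine of_hol22 (g := fun Z p p' q q' => Z.I a.op q q' p p') (fun _ _ => rfl) (fun Z => ?_) hp hq
  refine iSup_le fun p => iSup_le fun p' => iSup_le fun q => iSup_le fun q' => ?_
  have := (ratio_le_hol22 _ _ (Z.I a.op) q q' p p').trans (hol22_I_le (α := α) (β := β) Z a.op)
  rw [expo_op_op, mul_comm] at this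
  simpa using this

theorem Ad (μ : Letter) (hp : ∀ I, dist (s I) (t I) ≤ I.lp)
    (hq : ∀ I, dist (u I) (v I) ≤ I.lq) :
    Dom a one 1 1 0 (fun I Z => Z.Ad a μ (s I) (t I) (u I) (v I)) := by
  refine of_hol22 (g := fun Z => Z.Ad a μ) (fun _ _ => by cases a <;> rfl) (fun Z => ?_) hp hq
  refine iSup_le fun p => iSup_le fun p' => iSup_le fun q => iSup_le fun q' => ?_
  simpa using ratio_Ad_le Z a μ p p' q q'

theorem Cd (μ ν : Letter) (hp : ∀ I, dist (s I) (t I) ≤ I.lp)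
    (hq : ∀ I, dist (u I) (v I) ≤ I.lq) :
    Dom a one 2 2 0 (fun I Z => Z.Cd a μ ν (s I) (t I) (u I) (v I)) := by
  refine of_hol22 (g := fun Z => Z.Cd a μ ν) (fun _ _ => by cases a <;> rfl) (fun Z => ?_) hp hq
  refine iSup_le fun p => iSup_le fun p' => iSup_le fun q => iSup_le fun q' => ?_
  simpa using ratio_Cd_le Z a μ ν p p' q q'

theorem D (μ ν : Letter) (hp : ∀ I, dist (s I) (t I) ≤ I.lp)
    (hq : ∀ I, dist (u I) (v I) ≤ I.lq) :
    Dom a one 1 2 1 (fun I Z => Z.D a μ ν (s I) (t I) I.r1 I.r2 (u I) (v I)) := by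
  refine of_ratio_le (w := fun I => dist (s I) (t I) ^ expo α β a
    * dist I.r1 I.r2 ^ expo α β a * dist (u I) (v I) ^ (2 * expo α β a.op))
    (fun I => by positivity) (fun I => ?_) (fun I X Y => rfl)
    (fun I Z => (ratio_le_hol42 _ _ _ _ _ _ _ _ _ _).trans (hol42_D_le Z a μ ν))
  have := Idx.mul_le_wt a 1 2 1 I dist_nonneg dist_nonneg dist_nonneg (hp I) (hq I) le_rfl
  simp only [Nat.cast_one, Nat.cast_ofNat, one_mul] at this
  rw [mul_right_comm]
  exact this

theorem E (μ ν : Letter) (hp : ∀ I, dist (s I) (t I) ≤ I.lp)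
    (hq : ∀ I, dist (u I) (v I) ≤ I.lq) :
    Dom a one 2 2 1 (fun I Z => Z.E a μ ν (s I) (t I) I.r1 I.r2 (u I) (v I)) := by
  refine of_ratio_le (w := fun I => dist (s I) (t I) ^ (2 * expo α β a)
    * dist I.r1 I.r2 ^ expo α β a * dist (u I) (v I) ^ (2 * expo α β a.op))
    (fun I => by positivity) (fun I => ?_) (fun I X Y => rfl)
    (fun I Z => (ratio_le_hol42 _ _ _ _ _ _ _ _ _ _).trans (hol42_E_le Z a μ ν))
  have := Idx.mul_le_wt a 2 2 1 I dist_nonneg dist_nonneg dist_nonneg (hp I) (hq I) le_rfl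
  simp only [Nat.cast_one, Nat.cast_ofNat, one_mul] at this
  rw [mul_right_comm]
  exact this

theorem F (μ ν : Letter) (hp : ∀ I, dist (s I) (t I) ≤ I.lp) :
    Dom a one 2 3 1 (fun I Z => Z.F a μ ν (s I) (t I) I.r1 I.r2 I.q1 I.q2 I.q3) := by
  refine of_ratio_le (w := fun I => dist (s I) (t I) ^ (2 * expo α β a)
    * dist I.r1 I.r2 ^ expo α β a
    * (dist I.q1 I.q2 + dist I.q2 I.q3) ^ (3 * expo α β a.op))
    (fun I => by positivity) (fun I => ?_) (fun I X Y => rfl)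
    (fun I Z => (ratio_le_hol43 _ _ _ _ _ _ _ _ _ _ _).trans (hol43_F_le Z a μ ν))
  have := Idx.mul_le_wt a 2 3 1 I dist_nonneg I.lq_nonneg dist_nonneg (hp I) le_rfl le_rfl
  simp only [Nat.cast_one, Nat.cast_ofNat, one_mul] at this
  rw [mul_right_comm]
  exact this

end

end Dom

/-! ### Increments of the sheet -/

theorem xd_op (Z : SheetData T) (a : Dir) (p q : Tm T) : Z.xd a.op q p = Z.xd a p q := by
  cases a <;> rfl

theorem dxd_eq (Z : SheetData T) (a : Dir) (p p' q q' : Tm T) :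
    Z.dxd a p p' q q' = Z.xd a p' q' - Z.xd a p q' - Z.xd a p' q + Z.xd a p q := rfl

theorem dxd_op (Z : SheetData T) (a : Dir) (p p' q q' : Tm T) :
    Z.dxd a.op q q' p p' = Z.dxd a p p' q q' := by
  simp only [dxd_eq, xd_op]; ring

theorem Ad_x {Z : SheetData T} (hZ : Z.ChenRelations) (a : Dir) : Z.Ad a .x = Z.dxd a := by
  cases a
  · exact hZ.A_x
  · funext p p' q q'
    rw [show Dir.two = Dir.one.op from rfl, dxd_op]
    show Z.A .x q q' p p' = _
    rw [hZ.A_x]; rfl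

namespace Ctx

variable (c : Ctx T α β)

theorem bd_x_p (a : Dir) (p p' q : Tm T) :
    Bd c.ε (c.X.xd a p' q - c.X.xd a p q) (c.Y.xd a p' q - c.Y.xd a p q)
      (c.Θ * dist p p' ^ expo α β a) := by
  refine c.bd_of_ratio_le (u := fun Z => Z.xd a p' q - Z.xd a p q) (by positivity) ?_
    fun Z => ?_
  · cases a <;> exact sub_sub_sub_comm _ _ _ _
  · refine le_trans ?_ (sheetNorm_x_le Z)
    cases a
    · exact (ratio_le_hol21 _ (fun s₁ s₂ t => Z.x s₂ t - Z.x s₁ t) p p' q).trans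
        (le_add_right (le_add_right (le_add_left le_rfl)))
    · exact (ratio_le_hol21 _ (fun t₁ t₂ s => Z.x s t₂ - Z.x s t₁) p p' q).trans
        (le_add_right (le_add_left le_rfl))

theorem bd_x_q (a : Dir) (p q q' : Tm T) :
    Bd c.ε (c.X.xd a p q' - c.X.xd a p q) (c.Y.xd a p q' - c.Y.xd a p q)
      (c.Θ * dist q q' ^ expo α β a.op) := by
  simpa only [xd_op] using c.bd_x_p a.op q q' p

theorem bd_dx (a : Dir) (p p' q q' : Tm T) :
    Bd c.ε (c.X.dxd a p p' q q') (c.Y.dxd a p p' q q')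
      (c.Θ * (dist p p' ^ expo α β a * dist q q' ^ expo α β a.op)) := by
  have := c.bd_of_ratio_le (u := fun Z => Z.Ad a .x p p' q q')
    (w := dist p p' ^ expo α β a * dist q q' ^ expo α β a.op) (by positivity)
    (by cases a <;> rfl) (fun Z => Dom.ratio_Ad_le Z a .x p p' q q')
  rwa [Ad_x c.hX.chen, Ad_x c.hY.chen] at this

/-- The radius of an interval which contains the values of both sheets. -/
noncomputable def M : ℝ := c.rad.toReal

theorem reg (a : Dir) (p q : Tm T) : Reg c.M c.ε (c.X.xd a p q) (c.Y.xd a p q) := by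
  have h : ∀ s t, Reg c.M c.ε (c.X.x s t) (c.Y.x s t) := by
    intro s t
    refine ⟨?_, ?_, ?_⟩
    · refine (ENNReal.ofReal_le_iff_le_toReal c.rad_ne_top).1 ?_
      exact (le_iSup_of_le s (le_iSup_of_le t le_rfl) : _ ≤ supNorm c.X.x).trans
        c.supNorm_X_le
    · refine (ENNReal.ofReal_le_iff_le_toReal c.rad_ne_top).1 ?_
      exact (le_iSup_of_le s (le_iSup_of_le t le_rfl) : _ ≤ supNorm c.Y.x).trans
        c.supNorm_Y_le
    · refine (ENNReal.ofReal_le_ofReal_iff c.hε.le).1 (le_trans ?_ c.hXY)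
      exact (le_iSup_of_le s (le_iSup_of_le t le_rfl) : _ ≤ supNorm (c.X - c.Y).x).trans
        (supNorm_x_le _)
  cases a
  · exact h p q
  · exact h q p

/-- `∑_{k = j}^8 sup_{|ξ| ≤ M} |φ⁽ᵏ⁾(ξ)|`. -/
noncomputable def cst (j : ℕ) : ℝ≥0 :=
  (∑ k ∈ Finset.Icc j 8, derivSup c.φ k c.rad).toNNReal

theorem continuous_iteratedDeriv {k : ℕ} (hk : k ≤ 8) : Continuous (iteratedDeriv k c.φ) :=
  c.hφ.continuous_iteratedDeriv k (by exact_mod_cast hk)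

theorem derivSup_ne_top {k : ℕ} (hk : k ≤ 8) :
    derivSup c.φ k c.rad ≠ ⊤ := by
  obtain ⟨C, hC⟩ := (isCompact_Icc (a := -c.M) (b := c.M)).exists_bound_of_continuousOn
    (c.continuous_iteratedDeriv hk).continuousOn
  refine ne_top_of_le_ne_top (ENNReal.ofReal_ne_top (r := C)) 
    (iSup_le fun ξ => iSup_le fun hξ => ?_)
  refine ENNReal.ofReal_le_ofReal (hC ξ ?_)
  rw [Set.mem_Icc, ← abs_le]
  exact (ENNReal.ofReal_le_iff_le_toReal c.rad_ne_top).1 hξ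

theorem sum_derivSup_ne_top (j : ℕ) :
    ∑ k ∈ Finset.Icc j 8, derivSup c.φ k c.rad ≠ ⊤ :=
  ENNReal.sum_ne_top.2 fun _ hk => c.derivSup_ne_top (Finset.mem_Icc.1 hk).2

theorem coe_cst (j : ℕ) : (c.cst j : ℝ≥0∞)
    = ∑ k ∈ Finset.Icc j 8, derivSup c.φ k c.rad :=
  ENNReal.coe_toNNReal (c.sum_derivSup_ne_top j)

theorem abs_iteratedDeriv_le {j k : ℕ} (hj : j ≤ k) (hk : k ≤ 8) {u : ℝ} (hu : |u| ≤ c.M) :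
    |iteratedDeriv k c.φ u| ≤ c.cst j := by
  have h1 : ENNReal.ofReal |iteratedDeriv k c.φ u|
      ≤ derivSup c.φ k c.rad :=
    le_iSup_of_le u (le_iSup_of_le ((ENNReal.ofReal_le_iff_le_toReal c.rad_ne_top).2 hu) le_rfl)
  have h2 : derivSup c.φ k c.rad ≤ c.cst j := by
    rw [coe_cst]
    exact Finset.single_le_sum (f := fun k => derivSup c.φ k c.rad)
      (fun _ _ => zero_le) (Finset.mem_Icc.2 ⟨hj, hk⟩)
  have h3 := h1.trans h2
  rwa [← ENNReal.ofReal_coe_nnreal, ENNReal.ofReal_le_ofReal_iff (NNReal.coe_nonneg _)] at h3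

theorem hasDerivAt_iteratedDeriv {k : ℕ} (hk : k ≤ 7) (u : ℝ) :
    HasDerivAt (iteratedDeriv k c.φ) (iteratedDeriv (k + 1) c.φ u) u := by
  rw [iteratedDeriv_succ]
  refine DifferentiableAt.hasDerivAt ?_
  exact (c.hφ.differentiable_iteratedDeriv k (by exact_mod_cast (by omega : k < 8))) u

theorem bd_iteratedDeriv {j k : ℕ} (hj : j ≤ k) (hk : k ≤ 7) {u v : ℝ} (h : Reg c.M c.ε u v) :
    Bd c.ε (iteratedDeriv k c.φ u) (iteratedDeriv k c.φ v) (c.cst j) := by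
  refine ⟨c.abs_iteratedDeriv_le hj (by omega) h.1, c.abs_iteratedDeriv_le hj (by omega) h.2.1, ?_⟩
  have h1 := Convex.norm_image_sub_le_of_norm_hasDerivWithin_le (s := Set.Icc (-c.M) c.M)
    (f := iteratedDeriv k c.φ) (C := c.cst j)
    (fun θ _ => (c.hasDerivAt_iteratedDeriv hk θ).hasDerivWithinAt)
    (fun θ hθ => c.abs_iteratedDeriv_le (by omega) (by omega) (abs_le.2 hθ)) (convex_Icc _ _)
    (abs_le.1 h.2.1) (abs_le.1 h.1)
  refine h1.trans ?_
  rw [mul_comm]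
  exact mul_le_mul_of_nonneg_right h.2.2 (NNReal.coe_nonneg _)

theorem derivBd {j : ℕ} (hj : j ≤ 1) :
    DerivBd (fun k => iteratedDeriv k c.φ) c.M c.ε (c.cst j) where
  deriv _ hk u := c.hasDerivAt_iteratedDeriv hk u
  bd _ hk hk' _ _ h := c.bd_iteratedDeriv (hj.trans hk) hk' h

theorem corners (a : Dir) (p p' q q' : Tm T) :
    Corners c.M c.ε (c.X.xd a p q) (c.X.xd a p' q - c.X.xd a p q) (c.X.xd a p q' - c.X.xd a p q)
      (c.X.dxd a p p' q q') (c.Y.xd a p q) (c.Y.xd a p' q - c.Y.xd a p q)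
      (c.Y.xd a p q' - c.Y.xd a p q) (c.Y.dxd a p p' q q') (c.Θ * dist p p' ^ expo α β a)
      (c.Θ * dist q q' ^ expo α β a.op)
      (c.Θ * (dist p p' ^ expo α β a * dist q q' ^ expo α β a.op)) where
  r11 := c.reg a p q
  r21 := by convert c.reg a p' q using 1 <;> ring
  r12 := by convert c.reg a p q' using 1 <;> ring
  r22 := by convert c.reg a p' q' using 1 <;> rw [dxd_eq] <;> ring
  ha := c.bd_x_p a p p' q
  ha' := by convert c.bd_x_p a p p' q' using 1 <;> rw [dxd_eq] <;> ring
  hb := c.bd_x_q a p q q'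
  hb' := by convert c.bd_x_q a p' q q' using 1 <;> rw [dxd_eq] <;> ring
  he := c.bd_dx a p p' q q'

end Ctx

/-! ### Orders of functions of the sheet -/

/-- `φ⁽ᵏ⁾(x)` with the argument in direction `a` first. -/
noncomputable def fk (φ : ℝ → ℝ) (k : ℕ) (Z : SheetData T) (a : Dir) (p q : Tm T) : ℝ :=
  iteratedDeriv k φ (Z.xd a p q)

/-- The remainder `y^{♯a}` for `y = φ⁽ᵏ⁾(x)`. -/
noncomputable def sharp (φ : ℝ → ℝ) (k : ℕ) (Z : SheetData T) (a : Dir) (p p' q : Tm T) : ℝ :=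
  fk φ k Z a p' q - fk φ k Z a p q - fk φ (k + 1) Z a p q * (Z.xd a p' q - Z.xd a p q)

namespace Dom

variable {s t u v : Idx T α β → Tm T} {a : Dir}

theorem of_bd {κ : Ctx T α β → ℝ≥0} {i j k : ℕ} {f : Idx T α β → SheetData T → ℝ} (c : ℝ) (n : ℕ)
    (hc : 0 ≤ c)
    (h : ∀ I : Idx T α β, ∃ w, Bd I.ε (f I I.X) (f I I.Y) w ∧
      w ≤ c * I.Θ ^ n * κ I.toCtx * I.wt a i j k) :
    Dom a κ i j k f := by
  refine ⟨c, n, hc, fun I => ?_⟩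
  obtain ⟨w, h1, h2⟩ := h I
  exact h1.mono I.hε.le h2

theorem fk {j k : ℕ} (hj : j ≤ k) (hk : k ≤ 7) :
    Dom a (Ctx.cst · j) 0 0 0 (fun I Z => fk I.φ k Z a (s I) (u I)) := by
  refine of_bd 1 0 zero_le_one fun I => ⟨_, I.bd_iteratedDeriv hj hk (I.reg a (s I) (u I)), ?_⟩
  simp [Idx.wt]

theorem fk_increment {j k i i' i'' : ℕ} (hj : j ≤ 1) (hk : k ≤ 6)
    (h : Dom a one i i' i'' (fun I Z => Z.xd a (t I) (v I) - Z.xd a (s I) (u I))) :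
    Dom a (Ctx.cst · j) i i' i''
      (fun I Z => RoughSheets.fk I.φ k Z a (t I) (v I) - RoughSheets.fk I.φ k Z a (s I) (u I)) := by
  obtain ⟨c, n, hc, h⟩ := h
  refine of_bd (2 * c) n (by positivity) fun I =>
    ⟨_, (I.derivBd hj).increment hk (I.reg a _ _) (I.reg a _ _) (h I), le_of_eq ?_⟩
  simp only [one, NNReal.coe_one]; ring

variable [Fact (1 / 3 < α)] [Fact (1 / 3 < β)]

theorem x_p (hp : ∀ I, dist (s I) (t I) ≤ I.lp) :
    Dom a one 1 0 0 (fun I Z => Z.xd a (t I) (u I) - Z.xd a (s I) (u I)) := by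
  refine of_bd 1 1 zero_le_one fun I => ⟨_, I.bd_x_p a (s I) (t I) (u I), ?_⟩
  have := Idx.mul_le_wt a 1 0 0 I dist_nonneg I.lq_nonneg I.lr_nonneg (hp I) le_rfl le_rfl
  have h0 := I.one_le_Θ
  simp only [Nat.cast_one, Nat.cast_zero, one_mul, zero_mul, Real.rpow_zero, mul_one] at this
  simp only [one, NNReal.coe_one, one_mul, pow_one, mul_one]
  gcongr

theorem x_q (hq : ∀ I, dist (u I) (v I) ≤ I.lq) :
    Dom a one 0 1 0 (fun I Z => Z.xd a (s I) (v I) - Z.xd a (s I) (u I)) := by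
  refine of_bd 1 1 zero_le_one fun I => ⟨_, I.bd_x_q a (s I) (u I) (v I), ?_⟩
  have := Idx.mul_le_wt a 0 1 0 I I.lp_nonneg dist_nonneg I.lr_nonneg le_rfl (hq I) le_rfl
  have h0 := I.one_le_Θ
  simp only [Nat.cast_one, Nat.cast_zero, one_mul, zero_mul, Real.rpow_zero, mul_one] at this
  simp only [one, NNReal.coe_one, one_mul, pow_one, mul_one]
  gcongr

theorem dx (hp : ∀ I, dist (s I) (t I) ≤ I.lp) (hq : ∀ I, dist (u I) (v I) ≤ I.lq) :
    Dom a one 1 1 0 (fun I Z => Z.dxd a (s I) (t I) (u I) (v I)) :=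
  (Ad .x hp hq).congr fun I Z hZ => by rw [Ad_x hZ.rough.chen]

theorem fk_p {j k : ℕ} (hj : j ≤ 1) (hk : k ≤ 6) (hp : ∀ I, dist (s I) (t I) ≤ I.lp) :
    Dom a (Ctx.cst · j) 1 0 0
      (fun I Z => RoughSheets.fk I.φ k Z a (t I) (u I) - RoughSheets.fk I.φ k Z a (s I) (u I)) :=
  fk_increment hj hk (x_p hp)

theorem fk_q {j k : ℕ} (hj : j ≤ 1) (hk : k ≤ 6) (hq : ∀ I, dist (u I) (v I) ≤ I.lq) :
    Dom a (Ctx.cst · j) 0 1 0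
      (fun I Z => RoughSheets.fk I.φ k Z a (s I) (v I) - RoughSheets.fk I.φ k Z a (s I) (u I)) :=
  fk_increment hj hk (x_q hq)

theorem sharp {j k : ℕ} (hj : j ≤ 1) (hk : k ≤ 5) (hp : ∀ I, dist (s I) (t I) ≤ I.lp) :
    Dom a (Ctx.cst · j) 2 0 0 (fun I Z => sharp I.φ k Z a (s I) (t I) (u I)) := by
  obtain ⟨c, n, hc, h⟩ := x_p (a := a) (u := u) hp
  refine of_bd (4 * c ^ 2) (n * 2) (by positivity) fun I =>
    ⟨_, (I.derivBd hj).taylor_two hk (I.reg a _ _) (I.reg a _ _) (h I), le_of_eq ?_⟩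
  simp only [one, NNReal.coe_one, Idx.wt]; ring

/-- The third order Taylor remainder. -/
theorem taylor_three {j k : ℕ} (hj : j ≤ 1) (hk : k ≤ 4) (hp : ∀ I, dist (s I) (t I) ≤ I.lp) :
    Dom a (Ctx.cst · j) 3 0 0 (fun I Z => RoughSheets.sharp I.φ k Z a (s I) (t I) (u I)
      - 1 / 2 * RoughSheets.fk I.φ (k + 2) Z a (s I) (u I)
        * (Z.xd a (t I) (u I) - Z.xd a (s I) (u I)) ^ 2) := by
  obtain ⟨c, n, hc, h⟩ := x_p (a := a) (u := u) hp
  refine of_bd (8 * c ^ 3) (n * 3) (by positivity) fun I =>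
    ⟨_, (I.derivBd hj).taylor_three hk (I.reg a _ _) (I.reg a _ _) (h I), le_of_eq ?_⟩
  simp only [one, NNReal.coe_one, Idx.wt]; ring

theorem weights_le (I : Idx T α β) (hp : dist (s I) (t I) ≤ I.lp) (hq : dist (u I) (v I) ≤ I.lq)
    (i i' : ℕ) : (dist (s I) (t I) ^ expo α β a) ^ i * (dist (u I) (v I) ^ expo α β a.op) ^ i'
      ≤ I.wt a i i' 0 := by
  have := Idx.mul_le_wt a i i' 0 I dist_nonneg dist_nonneg I.lr_nonneg hp hq le_rfl
  rw [rpow_nat_mul_eq dist_nonneg, rpow_nat_mul_eq dist_nonneg] at this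
  simpa using this

theorem fk_rect {j k : ℕ} (hj : j ≤ 1) (hk : k ≤ 5) (hp : ∀ I, dist (s I) (t I) ≤ I.lp)
    (hq : ∀ I, dist (u I) (v I) ≤ I.lq) :
    Dom a (Ctx.cst · j) 1 1 0 (fun I Z => rect (RoughSheets.fk I.φ k Z a) (s I) (t I) (u I) (v I))
      := by
  refine of_bd 6 2 (by norm_num) fun I =>
    ⟨6 * I.Θ ^ 2 * I.cst j * ((dist (s I) (t I) ^ expo α β a) ^ 1
      * (dist (u I) (v I) ^ expo α β a.op) ^ 1), ?_, ?_⟩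
  · have h := (I.derivBd hj).rect hk (I.corners a (s I) (t I) (u I) (v I))
    have hΘ := I.one_le_Θ
    have e : ∀ Z : SheetData T, rect (RoughSheets.fk I.φ k Z a) (s I) (t I) (u I) (v I)
        = iteratedDeriv k I.φ (Z.xd a (s I) (u I) + (Z.xd a (t I) (u I) - Z.xd a (s I) (u I))
            + (Z.xd a (s I) (v I) - Z.xd a (s I) (u I)) + Z.dxd a (s I) (t I) (u I) (v I))
          - iteratedDeriv k I.φ (Z.xd a (s I) (u I) + (Z.xd a (t I) (u I) - Z.xd a (s I) (u I)))
          - iteratedDeriv k I.φ (Z.xd a (s I) (u I) + (Z.xd a (s I) (v I) - Z.xd a (s I) (u I)))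
          + iteratedDeriv k I.φ (Z.xd a (s I) (u I)) := by
      intro Z
      rw [dxd_eq]; unfold rect RoughSheets.fk
      ring_nf
    rw [e, e]
    refine h.mono I.hε.le ?_
    set P := dist (s I) (t I) ^ expo α β a
    set Q := dist (u I) (v I) ^ expo α β a.op
    have hPQ : 0 ≤ I.cst j * (P * Q) := by positivity
    nlinarith [mul_nonneg hPQ (mul_nonneg (by linarith : 0 ≤ I.Θ) (by linarith : 0 ≤ I.Θ - 1))]
  · have := weights_le I (a := a) (hp I) (hq I) 1 1
    have hΘ := I.one_le_Θ
    gcongr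

/-- The increment of `y^{♯a}` in the other direction. -/
theorem sharp_q {j k : ℕ} (hj : j ≤ 1) (hk : k ≤ 4) (hp : ∀ I, dist (s I) (t I) ≤ I.lp)
    (hq : ∀ I, dist (u I) (v I) ≤ I.lq) :
    Dom a (Ctx.cst · j) 2 1 0 (fun I Z => RoughSheets.sharp I.φ k Z a (s I) (t I) (v I)
      - RoughSheets.sharp I.φ k Z a (s I) (t I) (u I)) := by
  refine of_bd 16 3 (by norm_num) fun I =>
    ⟨16 * I.Θ ^ 3 * I.cst j * ((dist (s I) (t I) ^ expo α β a) ^ 2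
      * (dist (u I) (v I) ^ expo α β a.op) ^ 1), ?_, ?_⟩
  · have h := (I.derivBd hj).taylor_two_increment hk (I.corners a (s I) (t I) (u I) (v I))
    have hΘ := I.one_le_Θ
    have e : ∀ Z : SheetData T, RoughSheets.sharp I.φ k Z a (s I) (t I) (v I)
          - RoughSheets.sharp I.φ k Z a (s I) (t I) (u I)
        = iteratedDeriv k I.φ (Z.xd a (s I) (u I) + (Z.xd a (t I) (u I) - Z.xd a (s I) (u I))
            + (Z.xd a (s I) (v I) - Z.xd a (s I) (u I)) + Z.dxd a (s I) (t I) (u I) (v I))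
          - iteratedDeriv k I.φ (Z.xd a (s I) (u I) + (Z.xd a (s I) (v I) - Z.xd a (s I) (u I)))
          - iteratedDeriv (k + 1) I.φ (Z.xd a (s I) (u I)
              + (Z.xd a (s I) (v I) - Z.xd a (s I) (u I)))
            * (Z.xd a (t I) (u I) - Z.xd a (s I) (u I) + Z.dxd a (s I) (t I) (u I) (v I))
          - (iteratedDeriv k I.φ (Z.xd a (s I) (u I) + (Z.xd a (t I) (u I) - Z.xd a (s I) (u I)))
            - iteratedDeriv k I.φ (Z.xd a (s I) (u I))
            - iteratedDeriv (k + 1) I.φ (Z.xd a (s I) (u I))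
              * (Z.xd a (t I) (u I) - Z.xd a (s I) (u I))) := by
      intro Z
      rw [dxd_eq]; unfold RoughSheets.sharp RoughSheets.fk
      ring_nf
    rw [e, e]
    refine h.mono I.hε.le ?_
    set P := dist (s I) (t I) ^ expo α β a
    set Q := dist (u I) (v I) ^ expo α β a.op
    have hPQ : 0 ≤ I.cst j * (P ^ 2 * Q) := by positivity
    have hΘ2 : 0 ≤ I.Θ ^ 2 := by positivity
    nlinarith [mul_nonneg hPQ (mul_nonneg hΘ2 (by linarith : 0 ≤ I.Θ - 1))]
  · have := weights_le I (a := a) (hp I) (hq I) 2 1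
    have hΘ := I.one_le_Θ
    gcongr

/-- The part of the remainder of `φ(x)` which is a function of the values of `x` at the corners of
the rectangle is of second order in both directions. -/
theorem rect_taylor (hp : ∀ I, dist (s I) (t I) ≤ I.lp)
    (hq : ∀ I, dist (u I) (v I) ≤ I.lq) :
    Dom a (Ctx.cst · 1) 2 2 0 (fun I Z => rect (RoughSheets.fk I.φ 0 Z a) (s I) (t I) (u I) (v I)
      - RoughSheets.fk I.φ 1 Z a (s I) (u I) * Z.dxd a (s I) (t I) (u I) (v I)
      + RoughSheets.fk I.φ 2 Z a (s I) (u I) * ((Z.xd a (t I) (u I) - Z.xd a (s I) (u I))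
        * (Z.xd a (s I) (v I) - Z.xd a (s I) (u I)))
      - (RoughSheets.fk I.φ 1 Z a (s I) (v I) - RoughSheets.fk I.φ 1 Z a (s I) (u I))
        * (Z.xd a (t I) (v I) - Z.xd a (s I) (v I))
      - (RoughSheets.fk I.φ 1 Z a (t I) (u I) - RoughSheets.fk I.φ 1 Z a (s I) (u I))
        * (Z.xd a (t I) (v I) - Z.xd a (t I) (u I))) := by
  refine of_bd 56 4 (by norm_num) fun I =>
    ⟨56 * I.Θ ^ 4 * I.cst 1 * ((dist (s I) (t I) ^ expo α β a) ^ 2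
      * (dist (u I) (v I) ^ expo α β a.op) ^ 2), ?_, ?_⟩
  · have h := (I.derivBd (le_refl 1)).rect_taylor (n := 0) (by omega)
      (I.corners a (s I) (t I) (u I) (v I))
    have hΘ := I.one_le_Θ
    set P := dist (s I) (t I) ^ expo α β a
    set Q := dist (u I) (v I) ^ expo α β a.op
    refine Bd.mono (k := 16 * (I.cst 1 * (I.Θ * P) ^ 2 * (I.Θ * Q) ^ 2)
      + 32 * (I.cst 1 * (I.Θ * P) * (I.Θ * Q) * (I.Θ * (P * Q)))
      + 8 * (I.cst 1 * (I.Θ * (P * Q)) ^ 2)) I.hε.le ?_ ?_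
    · convert h using 1
      · rw [dxd_eq]; unfold rect RoughSheets.fk; ring_nf
      · rw [dxd_eq]; unfold rect RoughSheets.fk; ring_nf
    have hPQ : 0 ≤ I.cst 1 * (P ^ 2 * Q ^ 2) := by positivity
    have hΘ2 : 0 ≤ I.Θ ^ 2 := by positivity
    have hΘ3 : 0 ≤ I.Θ ^ 3 := by positivity
    nlinarith [mul_nonneg hPQ (mul_nonneg hΘ3 (by linarith : 0 ≤ I.Θ - 1)),
      mul_nonneg hPQ (mul_nonneg hΘ2 (by nlinarith : 0 ≤ I.Θ ^ 2 - 1))]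
  · have := weights_le I (a := a) (hp I) (hq I) 2 2
    have hΘ := I.one_le_Θ
    gcongr

end Dom

/-! ### The boundary integrals with one integrator -/

/-- The function sewn in the boundary integral `∫_a φ⁽ᵏ⁾(x) ∫_â dμ`. -/
noncomputable def bdryIncr (φ : ℝ → ℝ) (k : ℕ) (μ : Letter) (Z : SheetData T) (a : Dir)
    (q₁ q₂ : Tm T) (p₁ p₂ p₃ : Tm T) : ℝ :=
  sharp φ k Z a p₁ p₂ q₁ * Z.Ad a μ p₂ p₃ q₁ q₂
    + (fk φ (k + 1) Z a p₂ q₁ - fk φ (k + 1) Z a p₁ q₁) * Z.B a μ p₂ p₃ q₁ q₂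

theorem boundary1_eq (φ : ℝ → ℝ) (k : ℕ) (μ : Letter) (Z : SheetData T) (a : Dir) :
    boundary1 Z a μ (derivComp φ k Z.x) (derivComp φ (k + 1) Z.x)
      = swap22 a (fun p₁ p₂ q₁ q₂ => fk φ k Z a p₁ q₁ * Z.Ad a μ p₁ p₂ q₁ q₂
        + fk φ (k + 1) Z a p₁ q₁ * Z.B a μ p₁ p₂ q₁ q₂ + sew (bdryIncr φ k μ Z a q₁ q₂) p₁ p₂) := by
  cases a <;> rfl

theorem bdryIncr_eq_cob {Z : SheetData T} (hZ : Z.ChenRelations) (φ : ℝ → ℝ) (k : ℕ) (μ : Letter)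
    (a : Dir) (q₁ q₂ p₁ p₂ p₃ : Tm T) :
    bdryIncr φ k μ Z a q₁ q₂ p₁ p₂ p₃ = cob (fun p p' => -(fk φ k Z a p q₁ * Z.Ad a μ p p' q₁ q₂
      + fk φ (k + 1) Z a p q₁ * Z.B a μ p p' q₁ q₂)) p₁ p₂ p₃ := by
  have e1 := hZ.cob_A a μ p₁ p₂ p₃ q₁ q₂
  have e2 := hZ.cob_B a μ p₁ p₂ p₃ q₁ q₂
  unfold cob at *
  unfold bdryIncr sharp
  linear_combination (fk φ k Z a p₁ q₁) * e1 + (fk φ (k + 1) Z a p₁ q₁) * e2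

/-- The function sewn in the boundary integral of `φ''(x)` against `I_â`. -/
noncomputable def splitIncr (φ : ℝ → ℝ) (Z : SheetData T) (a : Dir) (q₁ q₂ : Tm T)
    (p₁ p₂ p₃ : Tm T) : ℝ :=
  sharp φ 2 Z a p₁ p₂ q₁ * Z.I a.op q₁ q₂ p₂ p₃
    + (fk φ 3 Z a p₂ q₁ - fk φ 3 Z a p₁ q₁) * Z.J a p₂ p₃ q₁ q₂

theorem splitIncr_eq_cob {Z : SheetData T} (hZ : Z.SplittingRelations) (φ : ℝ → ℝ)
    (a : Dir) (q₁ q₂ p₁ p₂ p₃ : Tm T) :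
    splitIncr φ Z a q₁ q₂ p₁ p₂ p₃ = cob (fun p p' => -(fk φ 2 Z a p q₁ * Z.I a.op q₁ q₂ p p'
      + fk φ 3 Z a p q₁ * Z.J a p p' q₁ q₂)) p₁ p₂ p₃ := by
  have e1 := hZ.cob_I a p₁ p₂ p₃ q₁ q₂
  have e2 := hZ.cob_J a p₁ p₂ p₃ q₁ q₂
  unfold cob at *
  unfold splitIncr sharp
  linear_combination (fk φ 2 Z a p₁ q₁) * e1 + (fk φ 3 Z a p₁ q₁) * e2

/-- The function sewn in the definition of `W`. -/
def wIncr (Z : SheetData T) (a : Dir) (q₁ q₂ : Tm T) (r₁ r₂ r₃ : Tm T) : ℝ :=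
  (Z.xd a r₂ q₁ - Z.xd a r₁ q₁) * Z.dxd a r₁ r₂ q₁ q₂ * (Z.xd a r₃ q₂ - Z.xd a r₂ q₂)
    + (Z.xd a r₂ q₁ - Z.xd a r₁ q₁) * Z.Q a r₂ r₃ q₁ q₂
    + Z.dxd a r₁ r₂ q₁ q₂ * Z.P a r₂ r₃ q₂
    - Z.dxd a r₁ r₂ q₁ q₂ * Z.Q a r₂ r₃ q₁ q₂

theorem wIncr_eq_cob {Z : SheetData T} (hS : Z.SplittingRelations) (hO : Z.OneDimRelations)
    (a : Dir) (q₁ q₂ p₁ p₂ p₃ : Tm T) :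
    wIncr Z a q₁ q₂ p₁ p₂ p₃ = cob (fun p p' => (Z.xd a p q₂ - Z.xd a p q₁)
      * (Z.Q a p p' q₁ q₂ - Z.P a p p' q₂) + Z.H a p p' q₁ q₂) p₁ p₂ p₃ := by
  have e1 := hO.cob_Q a p₁ p₂ p₃ q₁ q₂
  have e2 := hO.cob_P a p₁ p₂ p₃ q₂
  have e3 := hS.cob_H a p₁ p₂ p₃ q₁ q₂
  have e4 := hO.mul_x a p₂ p₃ q₁ q₂
  unfold cob at *
  unfold wIncr
  rw [dxd_eq] at *
  linear_combination -(Z.xd a p₁ q₂ - Z.xd a p₁ q₁) * (e1 - e2) - e3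
    + (Z.xd a p₂ q₁ - Z.xd a p₁ q₁) * e4

section

variable [Fact (1 / 3 < α)] [Fact (1 / 3 < β)] {a : Dir}

namespace Dom

theorem bdryIncr {j k : ℕ} (hj : j ≤ 1) (hk : k ≤ 5) (μ : Letter) :
    Dom a (Ctx.cst · j) 3 1 0
      (fun (I : Idx T α β) Z => bdryIncr I.φ k μ Z a I.q1 I.q2 I.p1 I.p2 I.p3) :=
  ((sharp hj hk Idx.dp12).mul_right (Ad μ Idx.dp23 Idx.dq12)).add
    ((fk_p hj (by omega) Idx.dp12).mul_right (B μ Idx.dp23 Idx.dq12))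

theorem splitIncr : Dom a (Ctx.cst · 1) 3 2 0
    (fun (I : Idx T α β) Z => splitIncr I.φ Z a I.q1 I.q2 I.p1 I.p2 I.p3) :=
  ((sharp le_rfl (by omega) Idx.dp12).mul_right (I_op Idx.dp23 Idx.dq12)).add
    ((fk_p le_rfl (by omega) Idx.dp12).mul_right (J Idx.dp23 Idx.dq12))

theorem P {s t u : Idx T α β → Tm T} (hp : ∀ I, dist (s I) (t I) ≤ I.lp) :
    Dom a one 2 0 0 (fun I Z => Z.P a (s I) (t I) (u I)) :=
  (((x_p hp).mul_right (x_p hp)).const_mul (1 / 2)).congr fun I Z hZ => by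
    rw [hZ.rough.oneDim.P_geom]; ring

theorem wIncr : Dom a one 3 1 0 (fun (I : Idx T α β) Z => wIncr Z a I.q1 I.q2 I.p1 I.p2 I.p3) :=
  (((((x_p Idx.dp12).mul_right (dx Idx.dp12 Idx.dq12) : Dom a one 2 1 0 _).mul_right
    (x_p Idx.dp23)).add
    ((x_p Idx.dp12).mul_right (Q Idx.dp23 Idx.dq12))).add
    ((dx Idx.dp12 Idx.dq12).mul_right (P Idx.dp23))).sub
    ((dx Idx.dp12 Idx.dq12).mul_right (Q Idx.dp23 Idx.dq12))

/-- The sewn part of a boundary integral of a function of `x`. -/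
theorem sew_bdryIncr {j k : ℕ} (hj : j ≤ 1) (hk : k ≤ 5) (μ : Letter) :
    Dom a (Ctx.cst · j) 3 1 0
      (fun (I : Idx T α β) Z =>
        RoughSheets.sew (RoughSheets.bdryIncr I.φ k μ Z a I.q1 I.q2) I.p1 I.p2) :=
  sew (h := fun I Z => RoughSheets.bdryIncr I.φ k μ Z a I.q1 I.q2) (fun _ _ _ _ => rfl)
    (fun _ _ hZ => IsClosedInc.of_eq_cob _ (bdryIncr_eq_cob hZ.rough.chen _ _ _ _ _ _))
    (bdryIncr hj hk μ)

theorem isSewing_bdryIncr {k : ℕ} (hk : k ≤ 5) (μ : Letter) (I : Idx T α β) (Z : SheetData T)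
    (hZ : I.Has Z) (a : Dir) : IsSewing (RoughSheets.bdryIncr I.φ k μ Z a I.q1 I.q2)
      (RoughSheets.sew (RoughSheets.bdryIncr I.φ k μ Z a I.q1 I.q2)) :=
  isSewing (h := fun I Z => RoughSheets.bdryIncr I.φ k μ Z a I.q1 I.q2) (fun _ _ _ _ => rfl)
    (fun _ _ hZ => IsClosedInc.of_eq_cob _ (bdryIncr_eq_cob hZ.rough.chen _ _ _ _ _ _))
    (bdryIncr le_rfl hk μ) I Z hZ

theorem sew_splitIncr : Dom a (Ctx.cst · 1) 3 2 0
    (fun (I : Idx T α β) Z =>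
      RoughSheets.sew (RoughSheets.splitIncr I.φ Z a I.q1 I.q2) I.p1 I.p2) :=
  sew (h := fun I Z => RoughSheets.splitIncr I.φ Z a I.q1 I.q2) (fun _ _ _ _ => rfl)
    (fun _ _ hZ => IsClosedInc.of_eq_cob _ (splitIncr_eq_cob hZ.rough.splitting _ _ _ _)) splitIncr

theorem isSewing_splitIncr (I : Idx T α β) (Z : SheetData T) (hZ : I.Has Z) (a : Dir) :
    IsSewing (RoughSheets.splitIncr I.φ Z a I.q1 I.q2)
      (RoughSheets.sew (RoughSheets.splitIncr I.φ Z a I.q1 I.q2)) :=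
  isSewing (h := fun I Z => RoughSheets.splitIncr I.φ Z a I.q1 I.q2) (fun _ _ _ _ => rfl)
    (fun _ _ hZ => IsClosedInc.of_eq_cob _ (splitIncr_eq_cob hZ.rough.splitting _ _ _ _))
    splitIncr I Z hZ

theorem W : Dom a one 3 1 0 (fun (I : Idx T α β) Z => Z.W a I.p1 I.p2 I.q1 I.q2) :=
  sew (h := fun I Z => RoughSheets.wIncr Z a I.q1 I.q2) (fun _ _ _ _ => rfl)
    (fun _ _ hZ => IsClosedInc.of_eq_cob _ (wIncr_eq_cob hZ.rough.splitting hZ.rough.oneDim _ _ _))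
    wIncr

end Dom

end

/-! ### The remainder of a function of the sheet -/

/-- The defect in the comparison of the sewn parts of the boundary integrals of `φ'(x)` and
`φ''(x)` with explicit increments: each of its terms is of order three in direction `a` and one in
the other direction, while its coboundary is of order two in the other direction. -/
noncomputable def defect (φ : ℝ → ℝ) (Z : SheetData T) (a : Dir) (q₁ q₂ p₁ p₂ : Tm T) : ℝ :=
  (sharp φ 1 Z a p₁ p₂ q₁ - 1 / 2 * fk φ 3 Z a p₁ q₁ * (Z.xd a p₂ q₁ - Z.xd a p₁ q₁) ^ 2)
      * (Z.xd a p₂ q₂ - Z.xd a p₂ q₁)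
    + 1 / 2 * (fk φ 3 Z a p₁ q₁
      * ((Z.xd a p₂ q₁ - Z.xd a p₁ q₁) * ((Z.xd a p₂ q₁ - Z.xd a p₁ q₁) * Z.dxd a p₁ p₂ q₁ q₂)))
    - fk φ 3 Z a p₁ q₁ * Z.W a p₁ p₂ q₁ q₂
    - (sew (bdryIncr φ 1 .x Z a q₁ q₂) p₁ p₂ + sew (bdryIncr φ 2 .ω Z a q₁ q₂) p₁ p₂
      + sew (splitIncr φ Z a q₁ q₂) p₁ p₂)

/-- The coboundary of the defect. -/
noncomputable def cobDefect (φ : ℝ → ℝ) (Z : SheetData T) (a : Dir) (q₁ q₂ p₁ p₂ p₃ : Tm T) : ℝ :=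
  -(fk φ 3 Z a p₁ q₁ * ((Z.xd a p₂ q₁ - Z.xd a p₁ q₁) * (Z.dxd a p₁ p₂ q₁ q₂ * Z.dxd a p₂ p₃ q₁ q₂)
      + (Z.xd a p₃ q₁ - Z.xd a p₂ q₁) * (Z.dxd a p₁ p₂ q₁ q₂ * Z.dxd a p₂ p₃ q₁ q₂)
      + 1 / 2 * (Z.dxd a p₁ p₂ q₁ q₂ * (Z.dxd a p₂ p₃ q₁ q₂ * Z.dxd a p₂ p₃ q₁ q₂))
      - Z.dxd a p₁ p₂ q₁ q₂ * Z.Q a p₂ p₃ q₁ q₂))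
    - 1 / 2 * ((fk φ 2 Z a p₂ q₁ - fk φ 2 Z a p₁ q₁)
      * (Z.dxd a p₂ p₃ q₁ q₂ * Z.dxd a p₂ p₃ q₁ q₂))
    - sharp φ 2 Z a p₁ p₂ q₁ * ((Z.xd a p₂ q₂ - Z.xd a p₂ q₁) * Z.dxd a p₂ p₃ q₁ q₂)
    - (fk φ 3 Z a p₂ q₁ - fk φ 3 Z a p₁ q₁) * ((Z.xd a p₂ q₂ - Z.xd a p₂ q₁)
      * ((Z.xd a p₃ q₁ - Z.xd a p₂ q₁) * Z.dxd a p₂ p₃ q₁ q₂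
        + 1 / 2 * (Z.dxd a p₂ p₃ q₁ q₂ * Z.dxd a p₂ p₃ q₁ q₂) - Z.Q a p₂ p₃ q₁ q₂))

/-- The terms of the coboundary that are only of first order in the other direction cancel: `B^x` is
traded for squares of increments and `Q`, the parts `G`, `H` of `A^ω`, `B^ω` for products and `W`,
and the parts `I_â`, `J` are removed by the sewing of `splitIncr`. -/
theorem cob_defect {φ : ℝ → ℝ} {Z : SheetData T} {a : Dir} {q₁ q₂ : Tm T}
    (hC : Z.ChenRelations) (hS : Z.SplittingRelations) (hO : Z.OneDimRelations)
    (s1 : IsSewing (bdryIncr φ 1 .x Z a q₁ q₂) (sew (bdryIncr φ 1 .x Z a q₁ q₂)))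
    (s2 : IsSewing (bdryIncr φ 2 .ω Z a q₁ q₂) (sew (bdryIncr φ 2 .ω Z a q₁ q₂)))
    (s3 : IsSewing (splitIncr φ Z a q₁ q₂) (sew (splitIncr φ Z a q₁ q₂))) (p₁ p₂ p₃ : Tm T) :
    cob (defect φ Z a q₁ q₂) p₁ p₂ p₃ = cobDefect φ Z a q₁ q₂ p₁ p₂ p₃ := by
  have e1 := s1.2 p₁ p₂ p₃
  have e2 := s2.2 p₁ p₂ p₃
  have e3 := s3.2 p₁ p₂ p₃
  -- `W` is explicit in terms of `H`, `P`, `Q`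
  have eW : ∀ p p', Z.W a p p' q₁ q₂ = (Z.xd a p q₂ - Z.xd a p q₁)
      * (Z.Q a p p' q₁ q₂ - Z.P a p p' q₂) + Z.H a p p' q₁ q₂ := by
    intro p p'
    linear_combination hO.mul_P a p p' q₁ q₂
  have e4 := wIncr_eq_cob hS hO a q₁ q₂ p₁ p₂ p₃
  have g1 := hO.incr_P a p₂ p₃ q₁ q₂
  rw [hO.P_geom, hO.P_geom] at g1
  have g2 := hO.mul_x a p₂ p₃ q₁ q₂
  have g3 := hS.A_ω a p₂ p₃ q₁ q₂
  have g4 := hS.B_ω a p₂ p₃ q₁ q₂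
  have g5 := eW p₂ p₃
  rw [hO.P_geom] at g5
  unfold cob defect cobDefect at *
  generalize sew (bdryIncr φ 1 .x Z a q₁ q₂) = R₁ at *
  generalize sew (bdryIncr φ 2 .ω Z a q₁ q₂) = R₂ at *
  generalize sew (splitIncr φ Z a q₁ q₂) = R₃ at *
  unfold bdryIncr at e1 e2
  unfold splitIncr at e3
  rw [Ad_x hC] at e1
  rw [g3, g4] at e2
  simp only [← eW] at e4
  unfold wIncr at e4
  rw [hO.P_geom] at e4
  simp only [dxd_eq, sharp, Nat.reduceAdd] at *
  linear_combination -e1 - e2 - e3 + fk φ 3 Z a p₁ q₁ * e4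
    + (fk φ 2 Z a p₂ q₁ - fk φ 2 Z a p₁ q₁) * g1
    + (fk φ 2 Z a p₂ q₁ - fk φ 2 Z a p₁ q₁ - fk φ 3 Z a p₁ q₁ * (Z.xd a p₂ q₁ - Z.xd a p₁ q₁)) * g2
    + (fk φ 3 Z a p₂ q₁ - fk φ 3 Z a p₁ q₁) * g5

section

variable [Fact (1 / 3 < α)] [Fact (1 / 3 < β)] {a : Dir}

namespace Dom

/-- The a priori order of the defect. -/
theorem defect_one : Dom a (Ctx.cst · 1) 3 1 0
    (fun (I : Idx T α β) Z => defect I.φ Z a I.q1 I.q2 I.p1 I.p2) :=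
  ((((taylor_three le_rfl (by omega) Idx.dp12).mul_right (x_q Idx.dq12)).add
    (((fk (by omega) (by omega)).mul_right
      ((x_p Idx.dp12).mul_right ((x_p Idx.dp12).mul_right (dx Idx.dp12 Idx.dq12) :
        Dom a one 2 1 0 _) : Dom a one 3 1 0 _) :
        Dom a (Ctx.cst · 1) 3 1 0 _).const_mul (1 / 2))).sub
    ((fk (by omega) (by omega)).mul_right W)).sub
    (((sew_bdryIncr le_rfl (by omega) .x).add (sew_bdryIncr le_rfl (by omega) .ω)).add
      (sew_splitIncr.mono le_rfl (by omega) le_rfl))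

theorem cobDefect : Dom a (Ctx.cst · 1) 3 2 0
    (fun (I : Idx T α β) Z => cobDefect I.φ Z a I.q1 I.q2 I.p1 I.p2 I.p3) := by
  have e12 : Dom a one 1 1 0 (fun (I : Idx T α β) Z => Z.dxd a I.p1 I.p2 I.q1 I.q2) :=
    dx Idx.dp12 Idx.dq12
  have e23 : Dom a one 1 1 0 (fun (I : Idx T α β) Z => Z.dxd a I.p2 I.p3 I.q1 I.q2) :=
    dx Idx.dp23 Idx.dq12
  have ee : Dom a one 2 2 0 (fun (I : Idx T α β) Z =>
      Z.dxd a I.p1 I.p2 I.q1 I.q2 * Z.dxd a I.p2 I.p3 I.q1 I.q2) := e12.mul_right e23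
  have ee' : Dom a one 2 2 0 (fun (I : Idx T α β) Z =>
      Z.dxd a I.p2 I.p3 I.q1 I.q2 * Z.dxd a I.p2 I.p3 I.q1 I.q2) := e23.mul_right e23
  have hQ : Dom a one 2 1 0 (fun (I : Idx T α β) Z => Z.Q a I.p2 I.p3 I.q1 I.q2) :=
    Q Idx.dp23 Idx.dq12
  have hd : Dom a one 0 1 0 (fun (I : Idx T α β) Z => Z.xd a I.p2 I.q2 - Z.xd a I.p2 I.q1) :=
    x_q Idx.dq12
  have V : Dom a one 1 0 0 (fun (I : Idx T α β) Z => Z.xd a I.p3 I.q1 - Z.xd a I.p2 I.q1) :=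
    x_p Idx.dp23
  refine Dom.sub (Dom.sub (Dom.sub (Dom.neg ?_) ?_) ?_) ?_
  · refine (fk (by omega) (by omega)).mul_right (i' := 3) (j' := 2) (k' := 0) ?_
    exact ((((x_p Idx.dp12).mul_right ee).add (V.mul_right ee)).add
      ((e12.mul_right ee' : Dom a one 3 2 0 _).const_mul _)).sub (e12.mul_right hQ)
  · exact ((fk_p le_rfl (by omega) Idx.dp12).mul_right ee' : Dom a _ 3 2 0 _).const_mul _
  · exact (sharp le_rfl (by omega) Idx.dp12).mul_right (hd.mul_right e23 : Dom a one 1 2 0 _)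
  · refine (fk_p le_rfl (by omega) Idx.dp12).mul_right (i' := 2) (j' := 2) (k' := 0) ?_
    refine hd.mul_right (i' := 2) (j' := 1) (k' := 0) ?_
    exact ((V.mul_right e23).add ((ee'.mono le_rfl (by omega) le_rfl).const_mul _)).sub hQ

/-- The defect is of second order in the other direction: this gain of regularity comes from its
coboundary, by uniqueness of sewing. -/
theorem defect : Dom a (Ctx.cst · 1) 3 2 0
    (fun (I : Idx T α β) Z => defect I.φ Z a I.q1 I.q2 I.p1 I.p2) :=
  of_cob (r := fun I Z => RoughSheets.defect I.φ Z a I.q1 I.q2)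
    (h := fun I Z => RoughSheets.cobDefect I.φ Z a I.q1 I.q2) (fun _ _ _ _ => rfl)
    (fun I Z hZ => isSuperHolder (r := fun I Z => RoughSheets.defect I.φ Z a I.q1 I.q2)
      (fun _ _ _ _ => rfl) defect_one I Z hZ)
    (fun I Z hZ => cob_defect hZ.rough.chen hZ.rough.splitting hZ.rough.oneDim
      (isSewing_bdryIncr (by omega) .x I Z hZ a) (isSewing_bdryIncr (by omega) .ω I Z hZ a)
      (isSewing_splitIncr I Z hZ a)) cobDefect

end Dom

end

/-- The contribution of direction `a` to the remainder of `φ(x)`. -/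
noncomputable def remainderPart (φ : ℝ → ℝ) (Z : SheetData T) (a : Dir) (p₁ p₂ q₁ q₂ : Tm T) : ℝ :=
  fk φ 3 Z a p₁ q₁ * ((Z.xd a p₁ q₂ - Z.xd a p₁ q₁) * Z.Q a p₁ p₂ q₁ q₂ + Z.J a p₁ p₂ q₁ q₂
    - (Z.xd a p₂ q₁ - Z.xd a p₁ q₁) * ((Z.xd a p₁ q₂ - Z.xd a p₁ q₁) * Z.dxd a p₁ p₂ q₁ q₂)
    - 1 / 2 * ((Z.xd a p₁ q₂ - Z.xd a p₁ q₁)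
      * (Z.dxd a p₁ p₂ q₁ q₂ * Z.dxd a p₁ p₂ q₁ q₂)))
  + sew (splitIncr φ Z a q₁ q₂) p₁ p₂ + defect φ Z a q₁ q₂ p₁ p₂

/-- The two boundary integrals in direction `a` in the remainder of `φ(x)`, up to terms of second
order in both directions. -/
theorem boundary_eq {Z : SheetData T} (hC : Z.ChenRelations) (hS : Z.SplittingRelations)
    (hO : Z.OneDimRelations) (φ : ℝ → ℝ) (a : Dir) (p₁ p₂ q₁ q₂ : Tm T) :
    swap22 a (boundary1 Z a .x (derivComp φ 1 Z.x) (derivComp φ 2 Z.x)) p₁ p₂ q₁ q₂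
      + swap22 a (boundary1 Z a .ω (derivComp φ 2 Z.x) (derivComp φ 3 Z.x)) p₁ p₂ q₁ q₂
    = fk φ 1 Z a p₁ q₁ * Z.dxd a p₁ p₂ q₁ q₂
      + fk φ 2 Z a p₁ q₁ * (Z.B a .x p₁ p₂ q₁ q₂ + Z.Ad a .ω p₁ p₂ q₁ q₂)
      + (fk φ 1 Z a p₂ q₁ - fk φ 1 Z a p₁ q₁
        - fk φ 2 Z a p₁ q₁ * (Z.xd a p₂ q₁ - Z.xd a p₁ q₁)) * (Z.xd a p₂ q₂ - Z.xd a p₂ q₁)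
      - remainderPart φ Z a p₁ p₂ q₁ q₂ := by
  have e1 := hS.B_ω a p₁ p₂ q₁ q₂
  have e2 := hO.mul_P a p₁ p₂ q₁ q₂
  rw [hO.P_geom] at e2
  have e3 : ∀ (g : Inc22 T), swap22 a (swap22 a g) = g := by intro g; cases a <;> rfl
  rw [boundary1_eq φ 1 .x Z a, boundary1_eq φ 2 .ω Z a, e3, e3]
  simp only [remainderPart, defect]
  rw [Ad_x hC, e1]
  simp only [dxd_eq, sharp, Nat.reduceAdd] at *
  linear_combination -(fk φ 3 Z a p₁ q₁) * e2

/-- The chain rule that defines `A^ω` removes the components of first order in one of the two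
directions from the remainder of `φ(x)`. -/
theorem remainder_eq {Z : SheetData T} (hC : Z.ChenRelations) (hS : Z.SplittingRelations)
    (hO : Z.OneDimRelations) (φ : ℝ → ℝ) (s₁ s₂ t₁ t₂ : Tm T) :
    remainder Z (controlledComp φ Z.x) s₁ s₂ t₁ t₂
    = (rect (fk φ 0 Z .one) s₁ s₂ t₁ t₂
      - fk φ 1 Z .one s₁ t₁ * Z.dxd .one s₁ s₂ t₁ t₂
      + fk φ 2 Z .one s₁ t₁ * ((Z.xd .one s₂ t₁ - Z.xd .one s₁ t₁)
        * (Z.xd .one s₁ t₂ - Z.xd .one s₁ t₁))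
      - (fk φ 1 Z .one s₁ t₂ - fk φ 1 Z .one s₁ t₁) * (Z.xd .one s₂ t₂ - Z.xd .one s₁ t₂)
      - (fk φ 1 Z .one s₂ t₁ - fk φ 1 Z .one s₁ t₁) * (Z.xd .one s₂ t₂ - Z.xd .one s₂ t₁))
    + fk φ 2 Z .one s₁ t₁ * (Z.Cd .one .x .x s₁ s₂ t₁ t₂
      - 1 / 2 * (Z.dxd .one s₁ s₂ t₁ t₂ * Z.dxd .one s₁ s₂ t₁ t₂))
    + remainderPart φ Z .one s₁ s₂ t₁ t₂ + remainderPart φ Z .two t₁ t₂ s₁ s₂ := by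
  have b1 := boundary_eq hC hS hO φ .one s₁ s₂ t₁ t₂
  have b2 := boundary_eq hC hS hO φ .two t₁ t₂ s₁ s₂
  have e1 := hO.incr_P .one s₁ s₂ t₁ t₂
  have e2 := hO.incr_P .two t₁ t₂ s₁ s₂
  rw [hO.P_geom, hO.P_geom] at e1 e2
  have e3 := hS.A_ω' s₁ s₂ t₁ t₂
  rw [hC.A_x] at e3
  have e4 : ∀ k p q, fk φ k Z .two q p = fk φ k Z .one p q := fun _ _ _ => rfl
  have e5 : ∀ p q, Z.xd .two q p = Z.xd .one p q := fun _ _ => rfl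
  have e6 : ∀ p q, Z.x p q = Z.xd .one p q := fun _ _ => rfl
  have e7 : ∀ k p q, derivComp φ k Z.x p q = fk φ k Z .one p q := fun _ _ _ => rfl
  have e8 : ∀ p p' q q', Z.Cd .one .x .x p p' q q' = Z.C .x .x p p' q q' := fun _ _ _ _ => rfl
  simp only [dxd_eq, e4, e5] at b1 b2 e1 e2
  simp only [swap22, SheetData.Ad] at b1 b2
  unfold rect at *
  simp only [remainder, controlledComp, hC.A_x, rect, dxd_eq, e7, e6, e8] at *
  linear_combination (-1 : ℝ) * b1 - b2 - fk φ 2 Z .one s₁ t₁ * e3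

section

variable [Fact (1 / 3 < α)] [Fact (1 / 3 < β)] {a : Dir}

namespace Dom

theorem remainderPart : Dom a (Ctx.cst · 1) 2 2 0
    (fun (I : Idx T α β) Z => remainderPart I.φ Z a I.p1 I.p2 I.q1 I.q2) := by
  have e : Dom a one 1 1 0 (fun (I : Idx T α β) Z => Z.dxd a I.p1 I.p2 I.q1 I.q2) :=
    dx Idx.dp12 Idx.dq12
  have hd : Dom a one 0 1 0 (fun (I : Idx T α β) Z => Z.xd a I.p1 I.q2 - Z.xd a I.p1 I.q1) :=
    x_q Idx.dq12
  refine Dom.add (Dom.add ?_ (sew_splitIncr.mono (by omega) le_rfl le_rfl))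
    (defect.mono (by omega) le_rfl le_rfl)
  refine (fk (by omega) (by omega)).mul_right (i' := 2) (j' := 2) (k' := 0) ?_
  exact (((hd.mul_right (Q Idx.dp12 Idx.dq12)).add (J Idx.dp12 Idx.dq12)).sub
    ((x_p Idx.dp12).mul_right (hd.mul_right e : Dom a one 1 2 0 _))).sub
    ((hd.mul_right (e.mul_right e : Dom a one 2 2 0 _) : Dom a one 2 2 0 _).const_mul _)

/-- The remainder of `φ(x)` is of second order in both directions. -/
theorem remainder : Dom .one (Ctx.cst · 1) 2 2 0
    (fun (I : Idx T α β) Z => remainder Z (controlledComp I.φ Z.x) I.p1 I.p2 I.q1 I.q2) := by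
  have e : Dom .one one 1 1 0 (fun (I : Idx T α β) Z => Z.dxd .one I.p1 I.p2 I.q1 I.q2) :=
    dx Idx.dp12 Idx.dq12
  refine Dom.congr ?_ fun I Z hZ => remainder_eq hZ.rough.chen hZ.rough.splitting
    hZ.rough.oneDim I.φ I.p1 I.p2 I.q1 I.q2
  refine (((rect_taylor Idx.dp12 Idx.dq12).add ?_).add remainderPart).add
    (remainderPart (a := .two)).swap
  exact (fk (by omega) (by omega)).mul_right
    ((Cd .x .x Idx.dp12 Idx.dq12).sub ((e.mul_right e : Dom .one one 2 2 0 _).const_mul (1 / 2)))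

end Dom

end

/-! ### The boundary integrals with two integrators -/

/-- `D` is additive in its first pair of points as well. -/
theorem cob_D_left {Z : SheetData T} (hZ : Z.ChenRelations) (a : Dir) (μ ν : Letter)
    (p₁ p₂ p₃ r₁ r₂ q₁ q₂ : Tm T) :
    cob (fun p p' => Z.D a μ ν p p' r₁ r₂ q₁ q₂) p₁ p₂ p₃ = 0 := by
  -- the two coboundaries of `C` on four points agree, which is additivity for second pairs
  -- that start at `p₃`
  have key : ∀ r, Z.D a μ ν p₁ p₃ p₃ r q₁ q₂ - Z.D a μ ν p₁ p₂ p₃ r q₁ q₂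
      - Z.D a μ ν p₂ p₃ p₃ r q₁ q₂ = 0 := by
    intro r
    have e1 := hZ.cob_C a μ ν p₂ p₃ r q₁ q₂
    have e2 := hZ.cob_C a μ ν p₁ p₃ r q₁ q₂
    have e3 := hZ.cob_C a μ ν p₁ p₂ r q₁ q₂
    have e4 := hZ.cob_C a μ ν p₁ p₂ p₃ q₁ q₂
    have e5 := hZ.cob_D a μ ν p₁ p₂ p₂ p₃ r q₁ q₂
    unfold cob at *
    linear_combination e1 - e2 + e3 - e4 + e5
  have k1 := key r₁
  have k2 := key r₂
  have a1 := hZ.cob_D a μ ν p₁ p₃ p₃ r₁ r₂ q₁ q₂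
  have a2 := hZ.cob_D a μ ν p₁ p₂ p₃ r₁ r₂ q₁ q₂
  have a3 := hZ.cob_D a μ ν p₂ p₃ p₃ r₁ r₂ q₁ q₂
  unfold cob at *
  linear_combination k2 - k1 - a1 + a2 + a3

/-- The function sewn in the first group of points in `∫_a φ⁽ᵏ⁾(x) ∫_â dμ dν`. -/
noncomputable def sepIncr (φ : ℝ → ℝ) (k : ℕ) (μ ν : Letter) (Z : SheetData T) (a : Dir)
    (q₁ q₂ r₁ r₂ : Tm T) (p₁ p₂ p₃ : Tm T) : ℝ :=
  sharp φ k Z a p₁ p₂ q₁ * Z.D a μ ν p₂ p₃ r₁ r₂ q₁ q₂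
    + (fk φ (k + 1) Z a p₂ q₁ - fk φ (k + 1) Z a p₁ q₁) * Z.E a μ ν p₂ p₃ r₁ r₂ q₁ q₂

theorem sepIncr_eq_cob {Z : SheetData T} (hZ : Z.ChenRelations) (φ : ℝ → ℝ) (k : ℕ) (μ ν : Letter)
    (a : Dir) (q₁ q₂ r₁ r₂ p₁ p₂ p₃ : Tm T) :
    sepIncr φ k μ ν Z a q₁ q₂ r₁ r₂ p₁ p₂ p₃
      = cob (fun p p' => -(fk φ k Z a p q₁ * Z.D a μ ν p p' r₁ r₂ q₁ q₂
        + fk φ (k + 1) Z a p q₁ * Z.E a μ ν p p' r₁ r₂ q₁ q₂)) p₁ p₂ p₃ := by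
  have e1 := cob_D_left hZ a μ ν p₁ p₂ p₃ r₁ r₂ q₁ q₂
  have e2 := hZ.cob_E_left a μ ν p₁ p₂ p₃ r₁ r₂ q₁ q₂
  unfold cob at *
  unfold sepIncr sharp
  linear_combination (fk φ k Z a p₁ q₁) * e1 + (fk φ (k + 1) Z a p₁ q₁) * e2

/-- The two-parameter integral `∫_{p₁p₂} φ⁽ᵏ⁾(x) ∫ dμ ⊗ ∫_{r₁r₂} ∫ dν`, in which the intervals of
integration in direction `a` of the two integrators are separated. -/
noncomputable def sepInt (φ : ℝ → ℝ) (k : ℕ) (μ ν : Letter) (Z : SheetData T) (a : Dir)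
    (q₁ q₂ r₁ r₂ : Tm T) (p₁ p₂ : Tm T) : ℝ :=
  fk φ k Z a p₁ q₁ * Z.D a μ ν p₁ p₂ r₁ r₂ q₁ q₂
    + fk φ (k + 1) Z a p₁ q₁ * Z.E a μ ν p₁ p₂ r₁ r₂ q₁ q₂
    + sew (sepIncr φ k μ ν Z a q₁ q₂ r₁ r₂) p₁ p₂

/-- The function sewn in `∫_a φ⁽ᵏ⁾(x) ∫_â dμ dν`. -/
noncomputable def doubleIncr (φ : ℝ → ℝ) (k : ℕ) (μ ν : Letter) (Z : SheetData T) (a : Dir)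
    (q₁ q₂ : Tm T) (p₁ p₂ p₃ : Tm T) : ℝ :=
  (fk φ k Z a p₂ q₁ - fk φ k Z a p₁ q₁) * Z.Cd a μ ν p₂ p₃ q₁ q₂
    + fk φ (k + 1) Z a p₁ q₁ * Z.E a μ ν p₁ p₂ p₂ p₃ q₁ q₂
    + sew (sepIncr φ k μ ν Z a q₁ q₂ p₂ p₃) p₁ p₂

theorem doubleIncr_eq {Z : SheetData T} (hZ : Z.ChenRelations) (φ : ℝ → ℝ) (k : ℕ) (μ ν : Letter)
    (a : Dir) (q₁ q₂ p₁ p₂ p₃ : Tm T) :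
    doubleIncr φ k μ ν Z a q₁ q₂ p₁ p₂ p₃ = sepInt φ k μ ν Z a q₁ q₂ p₂ p₃ p₁ p₂
      - cob (fun p p' => fk φ k Z a p q₁ * Z.Cd a μ ν p p' q₁ q₂) p₁ p₂ p₃ := by
  have e1 := hZ.cob_C a μ ν p₁ p₂ p₃ q₁ q₂
  unfold cob at *
  unfold doubleIncr sepInt
  linear_combination (fk φ k Z a p₁ q₁) * e1

section Additivity

variable {Z : SheetData T} {φ : ℝ → ℝ} {k : ℕ} {μ ν : Letter} {a : Dir}

/-- The condition that the functions `sepIncr` can be sewn. -/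
def SewableSep (φ : ℝ → ℝ) (k : ℕ) (μ ν : Letter) (Z : SheetData T) (a : Dir) : Prop :=
  ∀ q₁ q₂ r₁ r₂, IsSewing (sepIncr φ k μ ν Z a q₁ q₂ r₁ r₂) (sew (sepIncr φ k μ ν Z a q₁ q₂ r₁ r₂))

theorem cob_sepInt_left (hZ : Z.ChenRelations) (hs : SewableSep φ k μ ν Z a)
    (q₁ q₂ r₁ r₂ p₁ p₂ p₃ : Tm T) : cob (sepInt φ k μ ν Z a q₁ q₂ r₁ r₂) p₁ p₂ p₃ = 0 := by
  have e1 := (hs q₁ q₂ r₁ r₂).2 p₁ p₂ p₃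
  rw [sepIncr_eq_cob hZ] at e1
  unfold cob at *
  unfold sepInt
  linear_combination e1

theorem cob_sepInt_right (hZ : Z.ChenRelations) (hs : SewableSep φ k μ ν Z a)
    (q₁ q₂ p₁ p₂ r₁ r₂ r₃ : Tm T) :
    cob (fun r r' => sepInt φ k μ ν Z a q₁ q₂ r r' p₁ p₂) r₁ r₂ r₃ = 0 := by
  -- the sewn part is additive by uniqueness, because `sepIncr` is
  have e0 : sew (sepIncr φ k μ ν Z a q₁ q₂ r₁ r₃) p₁ p₂
      - sew (sepIncr φ k μ ν Z a q₁ q₂ r₁ r₂) p₁ p₂ = sew (sepIncr φ k μ ν Z a q₁ q₂ r₂ r₃) p₁ p₂ := by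
    refine (IsSuperHolder.sub (hs q₁ q₂ r₁ r₃).1 (hs q₁ q₂ r₁ r₂).1).eq_of_cob_eq
      (hs q₁ q₂ r₂ r₃).1 (fun p p' p'' => ?_) p₁ p₂
    rw [cob_sub, (hs q₁ q₂ r₁ r₃).2, (hs q₁ q₂ r₁ r₂).2, (hs q₁ q₂ r₂ r₃).2]
    have e1 := hZ.cob_D a μ ν p' p'' r₁ r₂ r₃ q₁ q₂
    have e2 := hZ.cob_E_right a μ ν p' p'' r₁ r₂ r₃ q₁ q₂
    unfold cob at *
    unfold sepIncr
    linear_combination sharp φ k Z a p p' q₁ * e1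
      + (fk φ (k + 1) Z a p' q₁ - fk φ (k + 1) Z a p q₁) * e2
  have e1 := hZ.cob_D a μ ν p₁ p₂ r₁ r₂ r₃ q₁ q₂
  have e2 := hZ.cob_E_right a μ ν p₁ p₂ r₁ r₂ r₃ q₁ q₂
  unfold cob at *
  unfold sepInt
  linear_combination e0 + fk φ k Z a p₁ q₁ * e1 + fk φ (k + 1) Z a p₁ q₁ * e2

theorem isClosedInc_doubleIncr (hZ : Z.ChenRelations) (hs : SewableSep φ k μ ν Z a) (q₁ q₂ : Tm T) :
    IsClosedInc (doubleIncr φ k μ ν Z a q₁ q₂) := by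
  intro p₁ p₂ p₃ p₄
  have e1 := isClosedInc_cob (fun p p' => fk φ k Z a p q₁ * Z.Cd a μ ν p p' q₁ q₂) p₁ p₂ p₃ p₄
  have e2 := cob_sepInt_left hZ hs q₁ q₂ p₃ p₄ p₁ p₂ p₃
  have e3 := cob_sepInt_right hZ hs q₁ q₂ p₁ p₂ p₂ p₃ p₄
  simp only [doubleIncr_eq hZ]
  unfold cob at *
  linear_combination -e1 - e2 + e3

end Additivity

section

variable [Fact (1 / 3 < α)] [Fact (1 / 3 < β)] {a : Dir}

namespace Dom

theorem sepIncr {j k : ℕ} (hj : j ≤ 1) (hk : k ≤ 5) (μ ν : Letter) :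
    Dom a (Ctx.cst · j) 3 2 1
      (fun (I : Idx T α β) Z => sepIncr I.φ k μ ν Z a I.q1 I.q2 I.r1 I.r2 I.p1 I.p2 I.p3) :=
  ((sharp hj hk Idx.dp12).mul_right (D μ ν Idx.dp23 Idx.dq12)).add
    ((fk_p hj (by omega) Idx.dp12).mul_right (E μ ν Idx.dp23 Idx.dq12))

theorem sew_sepIncr {j k : ℕ} (hj : j ≤ 1) (hk : k ≤ 5) (μ ν : Letter) :
    Dom a (Ctx.cst · j) 3 2 1 (fun (I : Idx T α β) Z =>
      RoughSheets.sew (RoughSheets.sepIncr I.φ k μ ν Z a I.q1 I.q2 I.r1 I.r2) I.p1 I.p2) :=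
  sew (h := fun I Z => RoughSheets.sepIncr I.φ k μ ν Z a I.q1 I.q2 I.r1 I.r2) (fun _ _ _ _ => rfl)
    (fun _ _ hZ => IsClosedInc.of_eq_cob _ (sepIncr_eq_cob hZ.rough.chen _ _ _ _ _ _ _ _ _))
    (sepIncr hj hk μ ν)

theorem sewableSep {k : ℕ} (hk : k ≤ 5) (μ ν : Letter) (I : Idx T α β) (Z : SheetData T)
    (hZ : I.Has Z) (a : Dir) : SewableSep I.φ k μ ν Z a := fun q₁ q₂ r₁ r₂ =>
  isSewing (h := fun I Z => RoughSheets.sepIncr I.φ k μ ν Z a I.q1 I.q2 I.r1 I.r2)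
    (fun _ _ _ _ => rfl)
    (fun _ _ hZ => IsClosedInc.of_eq_cob _ (sepIncr_eq_cob hZ.rough.chen _ _ _ _ _ _ _ _ _))
    (sepIncr le_rfl hk μ ν) { I with q1 := q₁, q2 := q₂, r1 := r₁, r2 := r₂ } Z hZ

/-- The points `r` may be taken to be the last two of the points `p`. -/
theorem fold {κ : Ctx T α β → ℝ≥0} {i j k : ℕ} {f : Idx T α β → SheetData T → ℝ}
    (hf : Dom a κ i j k f) :
    Dom a κ (i + k) j 0 (fun I Z => f { I with r1 := I.p2, r2 := I.p3 } Z) :=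
  hf.comp_fold (fun I => { I with r1 := I.p2, r2 := I.p3 }) (fun _ => rfl) (fun _ => le_rfl)
    (fun _ => le_rfl) Idx.dp23

theorem doubleIncr {j k : ℕ} (hj : j ≤ 1) (hjk : j ≤ k) (hk : k ≤ 5) (μ ν : Letter) :
    Dom a (Ctx.cst · j) 3 2 0
      (fun (I : Idx T α β) Z => doubleIncr I.φ k μ ν Z a I.q1 I.q2 I.p1 I.p2 I.p3) := by
  refine Dom.add (Dom.add ?_ ?_) ((sew_sepIncr hj hk μ ν).fold.mono (by omega) le_rfl le_rfl)
  · exact (fk_p hj (by omega) Idx.dp12).mul_right (Cd μ ν Idx.dp23 Idx.dq12)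
  · exact (fk (by omega) (by omega)).mul_right (E μ ν Idx.dp12 Idx.dq12).fold

theorem sew_doubleIncr {j k : ℕ} (hj : j ≤ 1) (hjk : j ≤ k) (hk : k ≤ 5) (μ ν : Letter) :
    Dom a (Ctx.cst · j) 3 2 0 (fun (I : Idx T α β) Z =>
      RoughSheets.sew (RoughSheets.doubleIncr I.φ k μ ν Z a I.q1 I.q2) I.p1 I.p2) :=
  sew (h := fun I Z => RoughSheets.doubleIncr I.φ k μ ν Z a I.q1 I.q2) (fun _ _ _ _ => rfl)
    (fun I Z hZ => isClosedInc_doubleIncr hZ.rough.chen (sewableSep hk μ ν I Z hZ a) _ _)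
    (doubleIncr hj hjk hk μ ν)

theorem isSewing_doubleIncr {k : ℕ} (hk : k ≤ 5) (μ ν : Letter) (I : Idx T α β) (Z : SheetData T)
    (hZ : I.Has Z) (a : Dir) (q₁ q₂ : Tm T) : IsSewing (RoughSheets.doubleIncr I.φ k μ ν Z a q₁ q₂)
      (RoughSheets.sew (RoughSheets.doubleIncr I.φ k μ ν Z a q₁ q₂)) :=
  isSewing (h := fun I Z => RoughSheets.doubleIncr I.φ k μ ν Z a I.q1 I.q2) (fun _ _ _ _ => rfl)
    (fun I Z hZ => isClosedInc_doubleIncr hZ.rough.chen (sewableSep hk μ ν I Z hZ a) _ _)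
    (doubleIncr (j := 0) (by omega) (by omega) hk μ ν) { I with q1 := q₁, q2 := q₂ } Z hZ

end Dom

end

/-! ### The coboundary in the other direction -/

theorem IsSuperHolder.mul_const {r : Tm T → Tm T → ℝ} (hr : IsSuperHolder r) (c : ℝ) :
    IsSuperHolder (fun a b => r a b * c) := by
  obtain ⟨μ, C, hμ, h⟩ := hr
  refine ⟨μ, C * |c|, hμ, fun a b => ?_⟩
  rw [abs_mul, mul_right_comm]
  exact mul_le_mul_of_nonneg_right (h a b) (abs_nonneg c)

/-- The value of the boundary integral `∫_a φ⁽ᵏ⁾(x) ∫_â dμ` with the arguments in direction `a`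
first. -/
noncomputable def bdry (φ : ℝ → ℝ) (k : ℕ) (μ : Letter) (Z : SheetData T) (a : Dir)
    (p₁ p₂ q₁ q₂ : Tm T) : ℝ :=
  fk φ k Z a p₁ q₁ * Z.Ad a μ p₁ p₂ q₁ q₂ + fk φ (k + 1) Z a p₁ q₁ * Z.B a μ p₁ p₂ q₁ q₂
    + sew (bdryIncr φ k μ Z a q₁ q₂) p₁ p₂

/-- The failure of the sewn part of the separated integral to satisfy Chen's relation in the other
direction. -/
noncomputable def sepDefect (φ : ℝ → ℝ) (k : ℕ) (μ ν : Letter) (Z : SheetData T) (a : Dir)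
    (q₁ q₂ q₃ r₁ r₂ p₁ p₂ : Tm T) : ℝ :=
  sew (sepIncr φ k μ ν Z a q₁ q₃ r₁ r₂) p₁ p₂ - sew (sepIncr φ k μ ν Z a q₁ q₂ r₁ r₂) p₁ p₂
    - sew (sepIncr φ k μ ν Z a q₂ q₃ r₁ r₂) p₁ p₂
    - sew (bdryIncr φ k μ Z a q₁ q₂) p₁ p₂ * Z.Ad a ν r₁ r₂ q₂ q₃

/-- The coboundary of `sepDefect` in direction `a`. -/
noncomputable def cobSepDefect (φ : ℝ → ℝ) (k : ℕ) (μ ν : Letter) (Z : SheetData T) (a : Dir)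
    (q₁ q₂ q₃ r₁ r₂ p₁ p₂ p₃ : Tm T) : ℝ :=
  (fk φ (k + 1) Z a p₂ q₁ - fk φ (k + 1) Z a p₁ q₁) * Z.F a μ ν p₂ p₃ r₁ r₂ q₁ q₂ q₃
    - (sharp φ k Z a p₁ p₂ q₂ - sharp φ k Z a p₁ p₂ q₁) * Z.D a μ ν p₂ p₃ r₁ r₂ q₂ q₃
    - rect (fk φ (k + 1) Z a) p₁ p₂ q₁ q₂ * Z.E a μ ν p₂ p₃ r₁ r₂ q₂ q₃

section

variable {Z : SheetData T} {φ : ℝ → ℝ} {k : ℕ} {μ ν : Letter} {a : Dir}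

/-- The condition that the functions `bdryIncr` can be sewn. -/
def SewableBdry (φ : ℝ → ℝ) (k : ℕ) (μ : Letter) (Z : SheetData T) (a : Dir) : Prop :=
  ∀ q₁ q₂, IsSewing (bdryIncr φ k μ Z a q₁ q₂) (sew (bdryIncr φ k μ Z a q₁ q₂))

theorem isSuperHolder_sepDefect (hs : SewableSep φ k μ ν Z a) (h1 : SewableBdry φ k μ Z a)
    (q₁ q₂ q₃ r₁ r₂ : Tm T) : IsSuperHolder (sepDefect φ k μ ν Z a q₁ q₂ q₃ r₁ r₂) :=
  (((IsSuperHolder.sub (hs q₁ q₃ r₁ r₂).1 (hs q₁ q₂ r₁ r₂).1)).sub (hs q₂ q₃ r₁ r₂).1).sub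
    (IsSuperHolder.mul_const (h1 q₁ q₂).1 _)

/-- The terms with `A^ν` cancel against the coboundary of the sewn part of the boundary integral. -/
theorem cob_sepDefect (hZ : Z.ChenRelations) (hs : SewableSep φ k μ ν Z a)
    (h1 : SewableBdry φ k μ Z a) (q₁ q₂ q₃ r₁ r₂ p₁ p₂ p₃ : Tm T) :
    cob (sepDefect φ k μ ν Z a q₁ q₂ q₃ r₁ r₂) p₁ p₂ p₃
      = cobSepDefect φ k μ ν Z a q₁ q₂ q₃ r₁ r₂ p₁ p₂ p₃ := by
  have e1 := (hs q₁ q₃ r₁ r₂).2 p₁ p₂ p₃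
  have e2 := (hs q₁ q₂ r₁ r₂).2 p₁ p₂ p₃
  have e3 := (hs q₂ q₃ r₁ r₂).2 p₁ p₂ p₃
  have e4 := (h1 q₁ q₂).2 p₁ p₂ p₃
  have e5 := hZ.cob_D' a μ ν p₂ p₃ r₁ r₂ q₁ q₂ q₃
  have e6 := hZ.cob_E' a μ ν p₂ p₃ r₁ r₂ q₁ q₂ q₃
  unfold cob sepDefect cobSepDefect rect at *
  generalize sew (sepIncr φ k μ ν Z a q₁ q₃ r₁ r₂) = R₁ at *
  generalize sew (sepIncr φ k μ ν Z a q₁ q₂ r₁ r₂) = R₂ at *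
  generalize sew (sepIncr φ k μ ν Z a q₂ q₃ r₁ r₂) = R₃ at *
  generalize sew (RoughSheets.bdryIncr φ k μ Z a q₁ q₂) = R₄ at *
  unfold sepIncr at e1 e2 e3
  unfold RoughSheets.bdryIncr at e4
  linear_combination e1 - e2 - e3 - Z.Ad a ν r₁ r₂ q₂ q₃ * e4
    + sharp φ k Z a p₁ p₂ q₁ * e5 + (fk φ (k + 1) Z a p₂ q₁ - fk φ (k + 1) Z a p₁ q₁) * e6

/-- Chen's relation for the separated integral in the other direction, up to terms of third
order. -/
theorem cob_sepInt_q (hZ : Z.ChenRelations) (q₁ q₂ q₃ r₁ r₂ p₁ p₂ : Tm T) :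
    cob (fun q q' => sepInt φ k μ ν Z a q q' r₁ r₂ p₁ p₂) q₁ q₂ q₃
      = bdry φ k μ Z a p₁ p₂ q₁ q₂ * Z.Ad a ν r₁ r₂ q₂ q₃
        - (fk φ k Z a p₁ q₂ - fk φ k Z a p₁ q₁) * Z.D a μ ν p₁ p₂ r₁ r₂ q₂ q₃
        - (fk φ (k + 1) Z a p₁ q₂ - fk φ (k + 1) Z a p₁ q₁) * Z.E a μ ν p₁ p₂ r₁ r₂ q₂ q₃
        + fk φ (k + 1) Z a p₁ q₁ * Z.F a μ ν p₁ p₂ r₁ r₂ q₁ q₂ q₃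
        + sepDefect φ k μ ν Z a q₁ q₂ q₃ r₁ r₂ p₁ p₂ := by
  have e5 := hZ.cob_D' a μ ν p₁ p₂ r₁ r₂ q₁ q₂ q₃
  have e6 := hZ.cob_E' a μ ν p₁ p₂ r₁ r₂ q₁ q₂ q₃
  unfold cob at *
  unfold sepInt bdry sepDefect
  linear_combination fk φ k Z a p₁ q₁ * e5 + fk φ (k + 1) Z a p₁ q₁ * e6

end

section

variable [Fact (1 / 3 < α)] [Fact (1 / 3 < β)] {a : Dir}

namespace Dom

theorem sewableBdry {k : ℕ} (hk : k ≤ 5) (μ : Letter) (I : Idx T α β) (Z : SheetData T)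
    (hZ : I.Has Z) (a : Dir) : SewableBdry I.φ k μ Z a := fun q₁ q₂ =>
  isSewing_bdryIncr hk μ { I with q1 := q₁, q2 := q₂ } Z hZ a

theorem cobSepDefect {j k : ℕ} (hj : j ≤ 1) (hk : k ≤ 4) (μ ν : Letter) :
    Dom a (Ctx.cst · j) 3 3 1 (fun (I : Idx T α β) Z =>
      cobSepDefect I.φ k μ ν Z a I.q1 I.q2 I.q3 I.r1 I.r2 I.p1 I.p2 I.p3) :=
  (((fk_p hj (by omega) Idx.dp12).mul_right (F μ ν Idx.dp23)).sub
    ((sharp_q hj hk Idx.dp12 Idx.dq12).mul_right (D μ ν Idx.dp23 Idx.dq23))).sub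
    ((fk_rect hj (by omega) Idx.dp12 Idx.dq12).mul_right (E μ ν Idx.dp23 Idx.dq23))

theorem sepDefect {j k : ℕ} (hj : j ≤ 1) (hk : k ≤ 4) (μ ν : Letter) :
    Dom a (Ctx.cst · j) 3 3 1 (fun (I : Idx T α β) Z =>
      sepDefect I.φ k μ ν Z a I.q1 I.q2 I.q3 I.r1 I.r2 I.p1 I.p2) :=
  of_cob (r := fun I Z => RoughSheets.sepDefect I.φ k μ ν Z a I.q1 I.q2 I.q3 I.r1 I.r2)
    (h := fun I Z => RoughSheets.cobSepDefect I.φ k μ ν Z a I.q1 I.q2 I.q3 I.r1 I.r2)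
    (fun _ _ _ _ => rfl)
    (fun I Z hZ => isSuperHolder_sepDefect (sewableSep (by omega) μ ν I Z hZ a)
      (sewableBdry (by omega) μ I Z hZ a) _ _ _ _ _)
    (fun I Z hZ => cob_sepDefect hZ.rough.chen (sewableSep (by omega) μ ν I Z hZ a)
      (sewableBdry (by omega) μ I Z hZ a) _ _ _ _ _) (cobSepDefect hj hk μ ν)

end Dom

end

/-! ### The rough integral -/

/-- The function sewn in both directions in the rough integral of `φ(x)`. -/
noncomputable def flatIncr (φ : ℝ → ℝ) (ν : Letter) (Z : SheetData T)
    (s₁ s₂ s₃ t₁ t₂ t₃ : Tm T) : ℝ :=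
  rect (derivComp φ 0 Z.x) s₁ s₂ t₁ t₂ * Z.A ν s₂ s₃ t₂ t₃
    - cob22 (innerPart Z ν (controlledComp φ Z.x)) s₁ s₂ s₃ t₁ t₂ t₃

/-- The contribution of the integrator `μ`, with coefficient `φ⁽ᵏ⁾(x)`, to the inner part of the
rough integral. -/
noncomputable def innerLetter (φ : ℝ → ℝ) (k : ℕ) (μ ν : Letter) (Z : SheetData T) : Inc22 T :=
  fun s₁ s₂ t₁ t₂ => fk φ k Z .one s₁ t₁ * Z.C μ ν s₁ s₂ t₁ t₂
    + sew (doubleIncr φ k μ ν Z .one t₁ t₂) s₁ s₂ + sew (doubleIncr φ k μ ν Z .two s₁ s₂) t₁ t₂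

theorem innerPart_eq (φ : ℝ → ℝ) (ν : Letter) (Z : SheetData T) :
    innerPart Z ν (controlledComp φ Z.x)
      = fun s₁ s₂ t₁ t₂ => innerLetter φ 1 .x ν Z s₁ s₂ t₁ t₂
        + innerLetter φ 2 .ω ν Z s₁ s₂ t₁ t₂ := by
  funext s₁ s₂ t₁ t₂
  have e1 : ∀ k μ, boundary2 Z .one μ ν (derivComp φ k Z.x) (derivComp φ (k + 1) Z.x) s₁ s₂ t₁ t₂
      = fk φ k Z .one s₁ t₁ * Z.C μ ν s₁ s₂ t₁ t₂ + sew (doubleIncr φ k μ ν Z .one t₁ t₂) s₁ s₂ :=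
    fun _ _ => rfl
  have e2 : ∀ k μ, boundary2 Z .two μ ν (derivComp φ k Z.x) (derivComp φ (k + 1) Z.x) s₁ s₂ t₁ t₂
      = fk φ k Z .one s₁ t₁ * Z.C μ ν s₁ s₂ t₁ t₂ + sew (doubleIncr φ k μ ν Z .two s₁ s₂) t₁ t₂ :=
    fun _ _ => rfl
  have e3 : ∀ k, derivComp φ k Z.x s₁ t₁ = fk φ k Z .one s₁ t₁ := fun _ => rfl
  have e4 := e1 1 .x
  have e5 := e2 1 .x
  have e6 := e1 2 .ω
  have e7 := e2 2 .ω
  simp only [innerPart, controlledComp, innerLetter, e3]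
  linear_combination e4 + e5 + e6 + e7

/-- The terms of the coboundary of the inner part which are of third order in both directions. -/
noncomputable def innerRest (φ : ℝ → ℝ) (k : ℕ) (μ ν : Letter) (Z : SheetData T) (a : Dir)
    (p₁ p₂ p₃ q₁ q₂ q₃ : Tm T) : ℝ :=
  fk φ (k + 1) Z a p₁ q₁ * Z.F a μ ν p₁ p₂ p₂ p₃ q₁ q₂ q₃
    - (fk φ (k + 1) Z a p₁ q₂ - fk φ (k + 1) Z a p₁ q₁) * Z.E a μ ν p₁ p₂ p₂ p₃ q₂ q₃
    + sepDefect φ k μ ν Z a q₁ q₂ q₃ p₂ p₃ p₁ p₂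

section

variable {Z : SheetData T} {φ : ℝ → ℝ} {k : ℕ} {μ ν : Letter}

theorem cob22_mul_C (hZ : Z.ChenRelations) (f : Sheet T) (s₁ s₂ s₃ t₁ t₂ t₃ : Tm T) :
    cob22 (fun s s' t t' => f s t * Z.C μ ν s s' t t') s₁ s₂ s₃ t₁ t₂ t₃
      = f s₁ t₁ * Z.A μ s₁ s₂ t₁ t₂ * Z.A ν s₂ s₃ t₂ t₃
        - (f s₂ t₁ - f s₁ t₁) * Z.D .two μ ν t₁ t₂ t₂ t₃ s₂ s₃
        - (f s₁ t₂ - f s₁ t₁) * Z.D .one μ ν s₁ s₂ s₂ s₃ t₂ t₃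
        + rect f s₁ s₂ t₁ t₂ * Z.C μ ν s₂ s₃ t₂ t₃ := by
  have c13 := hZ.cob_C .two μ ν t₁ t₂ t₃ s₁ s₃
  have c12 := hZ.cob_C .two μ ν t₁ t₂ t₃ s₁ s₂
  have c23 := hZ.cob_C .two μ ν t₁ t₂ t₃ s₂ s₃
  have c1 := hZ.cob_C .one μ ν s₁ s₂ s₃ t₂ t₃
  have d := hZ.cob_D' .two μ ν t₁ t₂ t₂ t₃ s₁ s₂ s₃
  simp only [SheetData.Cd, SheetData.Ad, swap22] at *
  unfold cob22 rect
  unfold cob at *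
  linear_combination f s₁ t₁ * c13 - f s₁ t₁ * c12 - f s₂ t₁ * c23 - (f s₁ t₂ - f s₁ t₁) * c1
    + f s₁ t₁ * d

/-- The terms with `D` from the separated integrals cancel those from `φ⁽ᵏ⁾(x) C^{μν}`. -/
theorem cob22_innerLetter (hZ : Z.ChenRelations)
    (hs : ∀ a q₁ q₂, IsSewing (doubleIncr φ k μ ν Z a q₁ q₂) (sew (doubleIncr φ k μ ν Z a q₁ q₂)))
    (s₁ s₂ s₃ t₁ t₂ t₃ : Tm T) :
    cob22 (innerLetter φ k μ ν Z) s₁ s₂ s₃ t₁ t₂ t₃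
      = (bdry φ k μ Z .one s₁ s₂ t₁ t₂ + bdry φ k μ Z .two t₁ t₂ s₁ s₂
          - fk φ k Z .one s₁ t₁ * Z.A μ s₁ s₂ t₁ t₂) * Z.A ν s₂ s₃ t₂ t₃
        - rect (fk φ k Z .one) s₁ s₂ t₁ t₂ * Z.C μ ν s₂ s₃ t₂ t₃
        + innerRest φ k μ ν Z .one s₁ s₂ s₃ t₁ t₂ t₃
        + innerRest φ k μ ν Z .two t₁ t₂ t₃ s₁ s₂ s₃ := by
  have c := cob22_mul_C (μ := μ) (ν := ν) hZ (fk φ k Z .one) s₁ s₂ s₃ t₁ t₂ t₃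
  -- the coboundary of each sewn part in its own direction
  have f1 : ∀ t t', cob (sew (doubleIncr φ k μ ν Z .one t t')) s₁ s₂ s₃
      = sepInt φ k μ ν Z .one t t' s₂ s₃ s₁ s₂
        - cob (fun p p' => fk φ k Z .one p t * Z.C μ ν p p' t t') s₁ s₂ s₃ := fun t t' => by
    rw [(hs .one t t').2, doubleIncr_eq hZ]; rfl
  have f2 : ∀ s s', cob (sew (doubleIncr φ k μ ν Z .two s s')) t₁ t₂ t₃
      = sepInt φ k μ ν Z .two s s' t₂ t₃ t₁ t₂
        - cob (fun p p' => fk φ k Z .one s p * Z.C μ ν s s' p p') t₁ t₂ t₃ := fun s s' => by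
    rw [(hs .two s s').2, doubleIncr_eq hZ]; rfl
  have g1 := cob_sepInt_q (φ := φ) (k := k) (μ := μ) (ν := ν) (a := .one) hZ t₁ t₂ t₃ s₂ s₃ s₁ s₂
  have g2 := cob_sepInt_q (φ := φ) (k := k) (μ := μ) (ν := ν) (a := .two) hZ s₁ s₂ s₃ t₂ t₃ t₁ t₂
  have a13 := f1 t₁ t₃
  have a12 := f1 t₁ t₂
  have a23 := f1 t₂ t₃
  have b13 := f2 s₁ s₃
  have b12 := f2 s₁ s₂
  have b23 := f2 s₂ s₃
  have e4 : ∀ k p q, fk φ k Z .two q p = fk φ k Z .one p q := fun _ _ _ => rfl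
  have e5 : Z.Ad .one ν s₂ s₃ t₂ t₃ = Z.A ν s₂ s₃ t₂ t₃ := rfl
  have e6 : Z.Ad .two ν t₂ t₃ s₂ s₃ = Z.A ν s₂ s₃ t₂ t₃ := rfl
  rw [e5] at g1
  rw [e6] at g2
  clear f1 f2 hs
  unfold innerRest innerLetter
  unfold cob22 at *
  unfold cob at *
  simp only [e4] at *
  linear_combination a13 - a12 - a23 + b13 - b12 - b23 + g1 + g2 - c

/-- The coefficient of `A^ν` in the coboundary of the inner part completes `δφ(x)` to the remainder
of `φ(x)`. -/
theorem flatIncr_eq (hZ : Z.ChenRelations)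
    (hs : ∀ a q₁ q₂, IsSewing (doubleIncr φ 1 .x ν Z a q₁ q₂)
      (sew (doubleIncr φ 1 .x ν Z a q₁ q₂)))
    (hs' : ∀ a q₁ q₂, IsSewing (doubleIncr φ 2 .ω ν Z a q₁ q₂)
      (sew (doubleIncr φ 2 .ω ν Z a q₁ q₂)))
    (s₁ s₂ s₃ t₁ t₂ t₃ : Tm T) :
    flatIncr φ ν Z s₁ s₂ s₃ t₁ t₂ t₃
      = remainder Z (controlledComp φ Z.x) s₁ s₂ t₁ t₂ * Z.Ad .one ν s₂ s₃ t₂ t₃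
        + (rect (fk φ 1 Z .one) s₁ s₂ t₁ t₂ * Z.Cd .one .x ν s₂ s₃ t₂ t₃
          + rect (fk φ 2 Z .one) s₁ s₂ t₁ t₂ * Z.Cd .one .ω ν s₂ s₃ t₂ t₃)
        - (innerRest φ 1 .x ν Z .one s₁ s₂ s₃ t₁ t₂ t₃
          + innerRest φ 2 .ω ν Z .one s₁ s₂ s₃ t₁ t₂ t₃)
        - (innerRest φ 1 .x ν Z .two t₁ t₂ t₃ s₁ s₂ s₃
          + innerRest φ 2 .ω ν Z .two t₁ t₂ t₃ s₁ s₂ s₃) := by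
  have c1 := cob22_innerLetter hZ hs s₁ s₂ s₃ t₁ t₂ t₃
  have c2 := cob22_innerLetter hZ hs' s₁ s₂ s₃ t₁ t₂ t₃
  have e : remainder Z (controlledComp φ Z.x) s₁ s₂ t₁ t₂
      = rect (derivComp φ 0 Z.x) s₁ s₂ t₁ t₂
        + fk φ 1 Z .one s₁ t₁ * Z.A .x s₁ s₂ t₁ t₂ + fk φ 2 Z .one s₁ t₁ * Z.A .ω s₁ s₂ t₁ t₂
        - (bdry φ 1 .x Z .one s₁ s₂ t₁ t₂ + bdry φ 1 .x Z .two t₁ t₂ s₁ s₂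
          + bdry φ 2 .ω Z .one s₁ s₂ t₁ t₂ + bdry φ 2 .ω Z .two t₁ t₂ s₁ s₂) := rfl
  have e5 : Z.Ad .one ν s₂ s₃ t₂ t₃ = Z.A ν s₂ s₃ t₂ t₃ := rfl
  have e6 : ∀ μ, Z.Cd .one μ ν s₂ s₃ t₂ t₃ = Z.C μ ν s₂ s₃ t₂ t₃ := fun _ => rfl
  have c : cob22 (innerPart Z ν (controlledComp φ Z.x)) s₁ s₂ s₃ t₁ t₂ t₃
      = cob22 (innerLetter φ 1 .x ν Z) s₁ s₂ s₃ t₁ t₂ t₃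
        + cob22 (innerLetter φ 2 .ω ν Z) s₁ s₂ s₃ t₁ t₂ t₃ := by
    rw [innerPart_eq]; unfold cob22 cob; ring
  unfold flatIncr
  rw [c, c1, c2, e, e5, e6, e6]
  ring

theorem isClosedInc_flatIncr (hZ : Z.ChenRelations) (s₁ s₂ s₃ : Tm T) :
    IsClosedInc (flatIncr φ ν Z s₁ s₂ s₃) := by
  intro t₁ t₂ t₃ t₄
  have e := congrArg (rect (derivComp φ 0 Z.x) s₁ s₂ t₁ t₂ * ·) (hZ.cob_A .two ν t₂ t₃ t₄ s₂ s₃)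
  simp only [SheetData.Ad, swap22] at e
  unfold flatIncr cob22
  unfold rect at *
  unfold cob at *
  linear_combination e

theorem isClosedInc_flatIncr_left (hZ : Z.ChenRelations) (t₁ t₂ t₃ : Tm T) :
    IsClosedInc (fun s₁ s₂ s₃ => flatIncr φ ν Z s₁ s₂ s₃ t₁ t₂ t₃) := by
  intro s₁ s₂ s₃ s₄
  have e := congrArg (rect (derivComp φ 0 Z.x) s₁ s₂ t₁ t₂ * ·) (hZ.cob_A .one ν s₂ s₃ s₄ t₂ t₃)
  simp only [SheetData.Ad, swap22] at e
  unfold flatIncr cob22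
  unfold rect at *
  unfold cob at *
  linear_combination e

/-- Sewing in one direction preserves closedness in the other. -/
theorem isClosedInc_sew {h : Tm T → Tm T → Tm T → Tm T → Tm T → Tm T → ℝ}
    (hs : ∀ s₁ s₂ s₃, IsSewing (h s₁ s₂ s₃) (sew (h s₁ s₂ s₃)))
    (hc : ∀ t₁ t₂ t₃, IsClosedInc (fun s₁ s₂ s₃ => h s₁ s₂ s₃ t₁ t₂ t₃)) (t₁ t₂ : Tm T) :
    IsClosedInc (fun s₁ s₂ s₃ => sew (h s₁ s₂ s₃) t₁ t₂) := by
  intro a b c d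
  have := IsSuperHolder.eq_of_cob_eq
    (IsSuperHolder.sub (hs b c d).1 (hs a c d).1)
    (IsSuperHolder.sub (hs a b c).1 (hs a b d).1) (fun t t' t'' => by
      rw [cob_sub, cob_sub, (hs b c d).2, (hs a c d).2, (hs a b c).2, (hs a b d).2]
      linear_combination hc t t' t'' a b c d) t₁ t₂
  linear_combination this

end

theorem Ctx.cst_one_le (c : Ctx T α β) : c.cst 1 ≤ c.cst 0 := by
  rw [← ENNReal.coe_le_coe, c.coe_cst, c.coe_cst]
  exact Finset.sum_le_sum_of_subset (Finset.Icc_subset_Icc_left zero_le_one)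

theorem Dom.cst_zero {a : Dir} {i j k : ℕ} {f : Idx T α β → SheetData T → ℝ}
    (hf : Dom a (Ctx.cst · 1) i j k f) :
    Dom a (Ctx.cst · 0) i j k f := by
  obtain ⟨c, n, hc, hf⟩ := hf
  refine ⟨c, n, hc, fun I => (hf I).mono I.hε.le ?_⟩
  have h1 := I.one_le_Θ
  have h2 := I.wt_nonneg a i j k
  have h3 := I.cst_one_le
  gcongr

section

variable [Fact (1 / 3 < α)] [Fact (1 / 3 < β)] {a : Dir}

namespace Dom

theorem bdry {k : ℕ} (hk : k ≤ 5) (μ : Letter) : Dom a (Ctx.cst · 0) 1 1 0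
    (fun (I : Idx T α β) Z => bdry I.φ k μ Z a I.p1 I.p2 I.q1 I.q2) :=
  (((fk (by omega) (by omega)).mul_right (Ad μ Idx.dp12 Idx.dq12)).add
    ((fk (by omega) (by omega)).mul_right (B μ Idx.dp12 Idx.dq12))).add
    ((sew_bdryIncr (by omega) hk μ).mono (by omega) le_rfl le_rfl)

theorem innerLetter {k : ℕ} (hk : k ≤ 5) (μ ν : Letter) : Dom .one (Ctx.cst · 0) 2 2 0
    (fun (I : Idx T α β) Z => innerLetter I.φ k μ ν Z I.p1 I.p2 I.q1 I.q2) := by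
  refine Dom.add (Dom.add ?_
    ((sew_doubleIncr (by omega) (by omega) hk μ ν).mono (by omega) le_rfl le_rfl))
    ((sew_doubleIncr (a := .two) (by omega) (by omega) hk μ ν).mono (by omega) le_rfl le_rfl).swap
  exact (fk (by omega) (by omega)).mul_right (Cd μ ν Idx.dp12 Idx.dq12)

theorem innerRest {k : ℕ} (hk : k ≤ 4) (μ ν : Letter) : Dom a (Ctx.cst · 0) 3 3 0
    (fun (I : Idx T α β) Z => innerRest I.φ k μ ν Z a I.p1 I.p2 I.p3 I.q1 I.q2 I.q3) := by
  refine Dom.add (Dom.sub ?_ ?_)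
    ((sepDefect (by omega) hk μ ν).fold.mono (by omega) le_rfl le_rfl)
  · exact (fk (by omega) (by omega)).mul_right (F μ ν Idx.dp12).fold
  · exact (fk_q (by omega) (by omega) Idx.dq12).mul_right (E μ ν Idx.dp12 Idx.dq23).fold

/-- The function sewn in the rough integral is of third order in both directions. -/
theorem flatIncr (ν : Letter) : Dom .one (Ctx.cst · 0) 3 3 0
    (fun (I : Idx T α β) Z => flatIncr I.φ ν Z I.p1 I.p2 I.p3 I.q1 I.q2 I.q3) := by
  refine Dom.congr ?_ fun I Z hZ => flatIncr_eq hZ.rough.chen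
    (fun a q₁ q₂ => isSewing_doubleIncr (by omega) .x ν I Z hZ a q₁ q₂)
    (fun a q₁ q₂ => isSewing_doubleIncr (by omega) .ω ν I Z hZ a q₁ q₂) _ _ _ _ _ _
  refine Dom.sub (Dom.sub (Dom.add ?_ (Dom.add ?_ ?_)) (Dom.add ?_ ?_))
    (Dom.add ?_ ?_)
  · exact remainder.cst_zero.mul_right (Ad ν Idx.dp23 Idx.dq23)
  · exact (fk_rect (by omega) (by omega) Idx.dp12 Idx.dq12).mul_right (Cd .x ν Idx.dp23 Idx.dq23)
  · exact (fk_rect (by omega) (by omega) Idx.dp12 Idx.dq12).mul_right (Cd .ω ν Idx.dp23 Idx.dq23)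
  · exact innerRest (by omega) .x ν
  · exact innerRest (by omega) .ω ν
  · exact (innerRest (a := .two) (by omega) .x ν).swap
  · exact (innerRest (a := .two) (by omega) .ω ν).swap

theorem isSewing_flatIncr (ν : Letter) (I : Idx T α β) (Z : SheetData T) (hZ : I.Has Z)
    (s₁ s₂ s₃ : Tm T) :
    IsSewing (RoughSheets.flatIncr I.φ ν Z s₁ s₂ s₃)
      (RoughSheets.sew (RoughSheets.flatIncr I.φ ν Z s₁ s₂ s₃)) :=
  isSewing (h := fun I Z => RoughSheets.flatIncr I.φ ν Z I.q1 I.q2 I.q3) (fun _ _ _ _ => rfl)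
    (fun _ _ hZ => isClosedInc_flatIncr hZ.rough.chen _ _ _) (flatIncr ν).swap
    { I with q1 := s₁, q2 := s₂, q3 := s₃ } Z hZ

theorem sew_flatIncr (ν : Letter) : Dom .one (Ctx.cst · 0) 3 3 0
    (fun (I : Idx T α β) Z =>
      RoughSheets.sew (RoughSheets.flatIncr I.φ ν Z I.p1 I.p2 I.p3) I.q1 I.q2) :=
  (sew (h := fun I Z => RoughSheets.flatIncr I.φ ν Z I.q1 I.q2 I.q3) (fun _ _ _ _ => rfl)
    (fun _ _ hZ => isClosedInc_flatIncr hZ.rough.chen _ _ _) (flatIncr ν).swap).swap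

theorem flatPart (ν : Letter) : Dom .one (Ctx.cst · 0) 3 3 0
    (fun (I : Idx T α β) Z => flatPart Z ν (controlledComp I.φ Z.x) I.p1 I.p2 I.q1 I.q2) :=
  sew (h := fun I Z a₁ a₂ a₃ => RoughSheets.sew (RoughSheets.flatIncr I.φ ν Z a₁ a₂ a₃) I.q1 I.q2)
    (fun _ _ _ _ => rfl)
    (fun I Z hZ => isClosedInc_sew (isSewing_flatIncr ν I Z hZ)
      (isClosedInc_flatIncr_left hZ.rough.chen) _ _) (sew_flatIncr ν)

/-- The rough integral is of first order in both directions. -/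
theorem integral (ν : Letter) : Dom .one (Ctx.cst · 0) 1 1 0
    (fun (I : Idx T α β) Z => integral Z ν (controlledComp I.φ Z.x) I.p1 I.p2 I.q1 I.q2) := by
  refine Dom.add (Dom.add (Dom.add (Dom.neg ?_) (Dom.add ?_ ?_)) ?_)
    ((flatPart ν).mono (by omega) (by omega) le_rfl)
  · exact (fk le_rfl (by omega)).mul_right (Ad ν Idx.dp12 Idx.dq12)
  · exact bdry (k := 0) (by omega) ν
  · exact (bdry (k := 0) (a := .two) (by omega) ν).swap
  · refine ((((innerLetter (k := 1) (by omega) .x ν).add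
      (innerLetter (k := 2) (by omega) .ω ν)).mono (by omega) (by omega) le_rfl).congr
      fun I Z _ => ?_)
    rw [innerPart_eq]

end Dom

end

/-! ### From the uniform bounds to the norms -/

theorem hol22_zero (p q : ℝ) : hol22 p q (0 : Inc22 T) = 0 := by simp [hol22]

theorem norm_sub_self (hα : 0 < α) (hβ : 0 < β) (X : SheetData T) : (X - X).norm α β = 0 := by
  have h21 : ∀ p, hol21 p (0 : Inc21 T) = 0 := fun p => by simp [hol21]
  have h42 : ∀ p p' q, hol42 p p' q (0 : Inc42 T) = 0 := fun p p' q => by simp [hol42]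
  have h43 : ∀ p p' z, 0 < z → hol43 p p' z (0 : Inc43 T) = 0 := by
    intro p p' z hz
    refine le_antisymm (iInf_le_of_le (fun _ => 0) (iInf_le_of_le
      (fun _ => ⟨z / 2, by constructor <;> linarith⟩) (iInf_le_of_le ?_ ?_))) zero_le
    · intro a₁ a₂ a₃ a₄ c d e
      simp
    · simp [hol43w]
  have hdir : ∀ γ γ' a, 0 < γ' → (X - X).dirNorm γ γ' a = 0 := by
    intro γ γ' a hγ
    have h3 : 0 < 3 * γ' := by linarith
    unfold SheetData.dirNorm
    rw [show (X - X).B = 0 from sub_self _, show (X - X).D = 0 from sub_self _,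
      show (X - X).E = 0 from sub_self _, show (X - X).F = 0 from sub_self _,
      show (X - X).G = 0 from sub_self _, show (X - X).H = 0 from sub_self _,
      show (X - X).I = 0 from sub_self _, show (X - X).J = 0 from sub_self _,
      show (X - X).K = 0 from sub_self _, show (X - X).L = 0 from sub_self _,
      show (X - X).M = 0 from sub_self _, show (X - X).N = 0 from sub_self _,
      show (X - X).O = 0 from sub_self _, show (X - X).P = 0 from sub_self _,
      show (X - X).Q = 0 from sub_self _]
    simp only [Pi.zero_apply, hol22_zero, h21, h42, h43 _ _ _ h3, add_zero]
  unfold SheetData.norm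
  rw [hdir _ _ _ hβ, hdir _ _ _ hα, show (X - X).x = 0 from sub_self _,
    show (X - X).A = 0 from sub_self _, show (X - X).C = 0 from sub_self _]
  simp only [Pi.zero_apply, hol22_zero, add_zero]
  simp [sheetNorm, hol22, hol21, rect, supNorm]

/-- The context of a pair of rough sheets at distance at most `ε`. -/
noncomputable def Ctx.ofPair {X Y : SheetData T} (hX : X.IsRoughSheet α β)
    (hY : Y.IsRoughSheet α β) {φ : ℝ → ℝ} (hφ : ContDiff ℝ 8 φ) {R : ℝ≥0∞} (hR : R ≠ ⊤)
    (hXR : supNorm X.x ≤ R) (hYR : supNorm Y.x ≤ R) {ε : ℝ} (hε : 0 < ε)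
    (h : (X - Y).norm α β ≤ ENNReal.ofReal ε) : Ctx T α β :=
  ⟨X, Y, hX, hY, φ, hφ, ε, hε, h, R, hR, hXR, hYR⟩

/-- A uniform bound, for pairs of rough sheets, on an increment of two points in each direction
gives a local Lipschitz estimate in the Hölder norm. -/
theorem Dom.hol22_le [Fact (1 / 3 < α)] [Fact (1 / 3 < β)] {i i' j : ℕ}
    {g : (ℝ → ℝ) → SheetData T → Inc22 T}
    (hg : Dom .one (Ctx.cst · j) i i' 0
      (fun (I : Idx T α β) Z => g I.φ Z I.p1 I.p2 I.q1 I.q2)) :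
    ∃ (c : ℝ≥0) (n : ℕ), ∀ φ : ℝ → ℝ, ContDiff ℝ 8 φ → ∀ X Y : SheetData T,
      X.IsRoughSheet α β → Y.IsRoughSheet α β → ∀ m, n ≤ m →
      hol22 (i * α) (i' * β) (g φ X - g φ Y)
        ≤ c * (∑ k ∈ Finset.Icc j 8, derivSup φ k (supNorm X.x + supNorm Y.x))
          * ENNReal.ofReal ((1 + (X.norm α β + Y.norm α β).toReal) ^ m) * (X - Y).norm α β := by
  obtain ⟨c, n, hc, hg⟩ := hg
  have hα : 0 < α := by linarith [(inferInstance : Fact (1 / 3 < α)).out]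
  have hβ : 0 < β := by linarith [(inferInstance : Fact (1 / 3 < β)).out]
  refine ⟨c.toNNReal + 1, n, fun φ hφ X Y hX hY m hm => ?_⟩
  have hR : supNorm X.x + supNorm Y.x ≠ ⊤ := ENNReal.add_ne_top.2
    ⟨((supNorm_x_le (α := α) (β := β) X).trans_lt hX.norm_lt_top).ne,
      ((supNorm_x_le (α := α) (β := β) Y).trans_lt hY.norm_lt_top).ne⟩
  have hXR : supNorm X.x ≤ supNorm X.x + supNorm Y.x := le_add_right le_rfl
  have hYR : supNorm Y.x ≤ supNorm X.x + supNorm Y.x := le_add_left le_rfl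
  have hXX : (X - X).norm α β ≤ ENNReal.ofReal 1 := by rw [norm_sub_self hα hβ]; exact zero_le
  have hYY : (Y - Y).norm α β ≤ ENNReal.ofReal 1 := by rw [norm_sub_self hα hβ]; exact zero_le
  obtain ⟨S, hS⟩ : ∃ S : ℝ≥0, (S : ℝ≥0∞)
      = ∑ k ∈ Finset.Icc j 8, derivSup φ k (supNorm X.x + supNorm Y.x) :=
    ⟨_, (Ctx.ofPair hX hX hφ hR hXR hXR one_pos hXX).coe_cst j⟩
  have hcst : ∀ D : Ctx T α β, D.φ = φ → D.rad = supNorm X.x + supNorm Y.x → D.cst j = S := by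
    intro D h h'
    rw [← ENNReal.coe_inj, D.coe_cst, h, h', hS]
  rw [← hS]
  -- an infinite distance makes the right-hand side infinite, unless the sum over `k` is zero
  rcases eq_or_ne ((X - Y).norm α β) ⊤ with htop | htop
  · rcases eq_or_ne S 0 with h0 | h0
    · -- the coefficients vanish, and so do both increments
      have hz : ∀ Z : SheetData T, Z.IsRoughSheet α β →
          supNorm Z.x ≤ supNorm X.x + supNorm Y.x → (Z - Z).norm α β ≤ ENNReal.ofReal 1 →
          g φ Z = 0 := by
        intro Z hZ hle hZZ
        funext s s' t t'
        have := (hg (Idx.mk (Ctx.ofPair hZ hZ hφ hR hle hle one_pos hZZ) s s' s' t t' t' s s)).1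
        simp only [hcst (Ctx.ofPair hZ hZ hφ hR hle hle one_pos hZZ) rfl rfl, h0, NNReal.coe_zero,
          mul_zero, zero_mul, abs_nonpos_iff] at this
        exact this
      rw [hz X hX hXR hXX, hz Y hY hYR hYY, sub_self, hol22_zero]
      exact zero_le
    · rw [htop, ENNReal.mul_top]
      · exact le_top
      · refine mul_ne_zero (mul_ne_zero ?_ (ENNReal.coe_ne_zero.2 h0)) ?_
        · exact ENNReal.coe_ne_zero.2 (add_pos_of_nonneg_of_pos zero_le one_pos).ne'
        · rw [Ne, ENNReal.ofReal_eq_zero, not_le]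
          positivity
  · refine iSup_le fun s => iSup_le fun s' => iSup_le fun t => iSup_le fun t' => ?_
    obtain ⟨w, hw⟩ : ∃ w, w = dist s s' ^ ((i : ℝ) * α) * dist t t' ^ ((i' : ℝ) * β) := ⟨_, rfl⟩
    have hw0 : 0 ≤ w := by rw [hw]; positivity
    obtain ⟨N, hN0, hN⟩ : ∃ N : ℝ, 0 ≤ N ∧ (X - Y).norm α β = ENNReal.ofReal N :=
      ⟨_, ENNReal.toReal_nonneg, (ENNReal.ofReal_toReal htop).symm⟩
    obtain ⟨r, hr⟩ : ∃ r, r = (X.norm α β + Y.norm α β).toReal := ⟨_, rfl⟩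
    have hr0 : 0 ≤ r := by rw [hr]; exact ENNReal.toReal_nonneg
    -- the distance of the two sheets may vanish, so it is approximated from above
    have key : ∀ η, 0 < η → |g φ X s s' t t' - g φ Y s s' t t'|
        ≤ (N + η) * (c * (1 + r) ^ n * S * w) := by
      intro η hη
      have hle : (X - Y).norm α β ≤ ENNReal.ofReal (N + η) := by
        rw [hN]; exact ENNReal.ofReal_le_ofReal (by linarith)
      have hpos : 0 < N + η := by linarith
      have := (hg (Idx.mk (Ctx.ofPair hX hY hφ hR hXR hYR hpos hle) s s' s' t t' t' s s)).2.2
      simp only [hcst (Ctx.ofPair hX hY hφ hR hXR hYR hpos hle) rfl rfl] at this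
      refine this.trans (le_of_eq ?_)
      simp only [Ctx.ofPair, Ctx.Θ, Idx.wt, Idx.lp, Idx.lq, dist_self, add_zero, pow_zero, mul_one]
      rw [hw, hr, rpow_nat_mul_eq dist_nonneg, rpow_nat_mul_eq dist_nonneg]
      rfl
    have key' : |g φ X s s' t t' - g φ Y s s' t t'| ≤ N * (c * (1 + r) ^ n * S * w) := by
      have hlim : Filter.Tendsto (fun η : ℝ => (N + η) * (c * (1 + r) ^ n * S * w))
          (nhdsWithin 0 (Set.Ioi 0)) (nhds (N * (c * (1 + r) ^ n * S * w))) := by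
        have : Continuous fun η : ℝ => (N + η) * (c * (1 + r) ^ n * S * w) := by fun_prop
        simpa using (this.tendsto 0).mono_left nhdsWithin_le_nhds
      refine ge_of_tendsto hlim ?_
      filter_upwards [self_mem_nhdsWithin] with η hη using key η hη
    refine ENNReal.div_le_of_le_mul ?_
    rw [← hw, ← hr, hN, ← ENNReal.ofReal_coe_nnreal, ← ENNReal.ofReal_coe_nnreal,
      ← ENNReal.ofReal_mul (by positivity), ← ENNReal.ofReal_mul (by positivity),
      ← ENNReal.ofReal_mul (by positivity), ← ENNReal.ofReal_mul (by positivity)]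
    refine ENNReal.ofReal_le_ofReal (key'.trans ?_)
    rw [NNReal.coe_add, Real.coe_toNNReal _ hc, NNReal.coe_one]
    have h1 : (1 + r) ^ n ≤ (1 + r) ^ m := pow_le_pow_right₀ (by linarith) hm
    calc N * (c * (1 + r) ^ n * S * w) ≤ N * ((c + 1) * (1 + r) ^ m * S * w) := by
          gcongr; linarith
      _ = _ := by ring

end RoughSheets

theorem mainTheorem3 (T : ℝ) (hT : 0 < T) (α β : ℝ) (hα : 1 / 3 < α) (hβ : 1 / 3 < β) :
    ∃ K : Polynomial ℝ, (∀ r : ℝ, 0 ≤ r → 0 ≤ K.eval r) ∧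
      ∃ c : NNReal, ∀ (φ : ℝ → ℝ), ContDiff ℝ 8 φ →
        ∀ (X Y : RoughSheets.SheetData T), X.IsRoughSheet α β → Y.IsRoughSheet α β →
          RoughSheets.hol22 (2 * α) (2 * β)
              (RoughSheets.remainder X (RoughSheets.controlledComp φ X.x)
                - RoughSheets.remainder Y (RoughSheets.controlledComp φ Y.x))
            ≤ c * (∑ k ∈ Finset.Icc 1 8, RoughSheets.derivSup φ k
                    (RoughSheets.supNorm X.x + RoughSheets.supNorm Y.x))
                * ENNReal.ofReal (K.eval (X.norm α β + Y.norm α β).toReal)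
                * (X - Y).norm α β ∧
          RoughSheets.hol22 α β
              (RoughSheets.integral X .x (RoughSheets.controlledComp φ X.x)
                - RoughSheets.integral Y .x (RoughSheets.controlledComp φ Y.x))
            + RoughSheets.hol22 α β
              (RoughSheets.integral X .ω (RoughSheets.controlledComp φ X.x)
                - RoughSheets.integral Y .ω (RoughSheets.controlledComp φ Y.x))
            ≤ c * (∑ k ∈ Finset.Icc 0 8, RoughSheets.derivSup φ k
                    (RoughSheets.supNorm X.x + RoughSheets.supNorm Y.x))
                * ENNReal.ofReal (K.eval (X.norm α β + Y.norm α β).toReal)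
                * (X - Y).norm α β := by
  have := Fact.mk hα
  have := Fact.mk hβ
  obtain ⟨c₁, n₁, h₁⟩ := (RoughSheets.Dom.remainder (T := T) (α := α) (β := β)).hol22_le
    (g := fun φ Z => RoughSheets.remainder Z (RoughSheets.controlledComp φ Z.x))
  obtain ⟨c₂, n₂, h₂⟩ := (RoughSheets.Dom.integral (T := T) (α := α) (β := β) .x).hol22_le
    (g := fun φ Z => RoughSheets.integral Z .x (RoughSheets.controlledComp φ Z.x))
  obtain ⟨c₃, n₃, h₃⟩ := (RoughSheets.Dom.integral (T := T) (α := α) (β := β) .ω).hol22_le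
    (g := fun φ Z => RoughSheets.integral Z .ω (RoughSheets.controlledComp φ Z.x))
  refine ⟨(1 + Polynomial.X) ^ (n₁ + n₂ + n₃), fun r hr => by simp; positivity, c₁ + c₂ + c₃,
    fun φ hφ X Y hX hY => ⟨?_, ?_⟩⟩
  · have := h₁ φ hφ X Y hX hY (n₁ + n₂ + n₃) (by omega)
    simp only [Nat.cast_ofNat] at this
    refine this.trans ?_
    simp only [Polynomial.eval_pow, Polynomial.eval_add, Polynomial.eval_one, Polynomial.eval_X]
    gcongr
    rw [add_assoc]
    exact le_self_add
  · have e₂ := h₂ φ hφ X Y hX hY (n₁ + n₂ + n₃) (by omega)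
    have e₃ := h₃ φ hφ X Y hX hY (n₁ + n₂ + n₃) (by omega)
    simp only [Nat.cast_one, one_mul] at e₂ e₃
    refine (add_le_add e₂ e₃).trans ?_
    simp only [Polynomial.eval_pow, Polynomial.eval_add, Polynomial.eval_one, Polynomial.eval_X]
    rw [← add_mul, ← add_mul, ← add_mul]
    gcongr
    rw [← ENNReal.coe_add, ENNReal.coe_le_coe, add_assoc]
    exact le_add_self
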